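/- Let $n\ge 2$ and $1\le p<n$. Let $\varphi:[0,\infty)\to[0,\infty)$ be continuous and strictly increasing, satisfying $\varphi(2t)\le C\varphi(t)$ for all $t>0$ and some constant $C$, and $\varphi(t_1)/t_1\le C_\varphi\,\varphi(t_2)/t_2$ whenever $0<t_1\le t_2$, for some constant $C_\varphi$. Let $h:[0,\infty)\to[0,\infty)$ be a continuous function with $$\sum_{k=1}^\infty \frac{(2^{-k}t)^n}{\varphi(2^{-k}t)^{n-1}}\le h(t)\quad\text{for all } t>0 .$$ Let $H:[0,\infty)\to[0,\infty)$ be an $N$-function, that is, continuous, strictly increasing and convex, with $\lim_{t\to0^+}H(t)/t=0$, $\lim_{t\to\infty}H(t)/t=\infty$ and $H(t)/t<H(s)/s$ for $0<t<s$; assume that $H(2t)\le C_H^{\Delta_2}H(t)$ for all $t>0$ and some constant $C_H^{\Delta_2}$. Suppose that there are a continuous function $\delta:(0,\infty)\to(0,\infty)$ and a finite constant $C_H$ such that $$H\Bigl(h(\delta(t))\,t+\varphi(\delta(t))^{1-n}\,\delta(t)^{n(1-\frac1p)}\Bigr)\le C_H\,t^p\quad\text{for all } t>0 .$$ If $p=1$,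 suppose in addition that $\sum_{j=1}^\infty H(2^{-j})<\infty$. Let $D\subset\mathbb R^n$ be a $\varphi$-John domain: a bounded domain (a nonempty, open, connected set) for which there are a constant $c_J>0$ and a point $x_0\in D$ such that every $x\in D$ can be joined to $x_0$ by a rectifiable curve $\gamma:[0,l]\to D$, parametrized by arc length, with $\gamma(0)=x$, $\gamma(l)=x_0$, $l\le c_J$ and $\varphi(t)\le c_J\,\mathrm{dist}(\gamma(t),\partial D)$ for all $t\in[0,l]$. Let $L^1_p(D)$ be the space of real distributions on $D$ whose first order distributional derivatives are (functions) in $L^p(D)$. Then every $u\in L^1_p(D)$ is a function, integrable on $D$, and there exists a constant $C<\infty$, not depending on $u$, such that $$\|u-u_D\|_{L^H(D)}\le C\,\|\nabla u\|_{L^p(D)}\quad\text{for every } u\in L^1_p(D),$$ where $u_D=|D|^{-1}\int_D u\,dx$ and $\|v\|_{L^H(D)}=\inf\{\lambda>0:\int_D H(|v(x)|/\lambda)\,dx\le1\}$. -/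

import Mathlib

open MeasureTheory Set Filter Topology
open scoped Distributions LineDeriv

/-- The standing assumptions on an Orlicz function `H : [0, ∞) → [0, ∞)`: it is an `N`-function.
Only the values of `H` on `[0, ∞)` matter. -/
structure IsNFunction (H : ℝ → ℝ) : Prop where
  nonneg : ∀ t, 0 ≤ t → 0 ≤ H t
  continuousOn : ContinuousOn H (Ici 0)
  strictMonoOn : StrictMonoOn H (Ici 0)
  convexOn : ConvexOn ℝ (Ici 0) H
  tendsto_zero : Tendsto (fun t => H t / t) (𝓝[>] 0) (𝓝 0)
  tendsto_atTop : Tendsto (fun t => H t / t) atTop atTop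
  div_lt_div : ∀ t s, 0 < t → t < s → H t / t < H s / s

/-- The `Δ₂`-condition for a function on `[0, ∞)`. -/
def IsDeltaTwo (H : ℝ → ℝ) : Prop :=
  ∃ C : ℝ, ∀ t, 0 < t → H (2 * t) ≤ C * H t

/-- `φ : [0, ∞) → [0, ∞)` is continuous and strictly increasing.
Only the values of `φ` on `[0, ∞)` matter. -/
structure IsStrictGauge (φ : ℝ → ℝ) : Prop where
  nonneg : ∀ t, 0 ≤ t → 0 ≤ φ t
  continuousOn : ContinuousOn φ (Ici 0)
  strictMonoOn : StrictMonoOn φ (Ici 0)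

/-- `φ(t₁)/t₁ ≤ C_φ φ(t₂)/t₂` whenever `0 < t₁ ≤ t₂`, for some constant `C_φ`. -/
def HasAlmostIncreasingQuotient (φ : ℝ → ℝ) : Prop :=
  ∃ C : ℝ, ∀ t₁ t₂, 0 < t₁ → t₁ ≤ t₂ → φ t₁ / t₁ ≤ C * (φ t₂ / t₂)

/-- `h : [0, ∞) → [0, ∞)` is continuous and
`∑_{k ≥ 1} (2^{-k} t)^n / φ(2^{-k} t)^{n-1} ≤ h(t)` for all `t > 0`
(in particular the series converges). -/
structure DominatesDyadicSum (n : ℕ) (φ h : ℝ → ℝ) : Prop where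
  nonneg : ∀ t, 0 ≤ t → 0 ≤ h t
  continuousOn : ContinuousOn h (Ici 0)
  summable : ∀ t, 0 < t →
    Summable fun k : ℕ => (t / 2 ^ (k + 1)) ^ n / φ (t / 2 ^ (k + 1)) ^ (n - 1)
  tsum_le : ∀ t, 0 < t →
    ∑' k : ℕ, (t / 2 ^ (k + 1)) ^ n / φ (t / 2 ^ (k + 1)) ^ (n - 1) ≤ h t

/-- There is a continuous `δ : (0, ∞) → (0, ∞)` and a constant `C_H` such that
`H(h(δ(t)) t + φ(δ(t))^{1-n} δ(t)^{n(1-1/p)}) ≤ C_H t^p` for all `t > 0`. -/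
def SatisfiesGrowthCondition (n : ℕ) (p : ℝ) (φ h H : ℝ → ℝ) : Prop :=
  ∃ δ : ℝ → ℝ, (∀ t, 0 < t → 0 < δ t) ∧ ContinuousOn δ (Ioi 0) ∧
    ∃ C : ℝ, ∀ t, 0 < t →
      H (h (δ t) * t + (φ (δ t) ^ (n - 1))⁻¹ * δ t ^ ((n : ℝ) * (1 - 1 / p))) ≤ C * t ^ p

/-- A bounded domain (open, connected, nonempty) `D` in `ℝⁿ` is a `φ`-John domain: there are a John
constant `c > 0` and a John center `x₀ ∈ D` such that every `x ∈ D` is joined to `x₀` by a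
rectifiable curve `γ : [0, l] → D`, parametrized by arc length, with `γ 0 = x`, `γ l = x₀`, `l ≤ c`
and `φ t ≤ c * dist (γ t, ∂D)` along the curve. -/
def IsJohnDomain {n : ℕ} (φ : ℝ → ℝ) (D : Set (EuclideanSpace ℝ (Fin n))) : Prop :=
  IsOpen D ∧ IsConnected D ∧ Bornology.IsBounded D ∧
    ∃ c : ℝ, 0 < c ∧ ∃ x₀ ∈ D, ∀ x ∈ D,
      ∃ (l : ℝ) (γ : ℝ → EuclideanSpace ℝ (Fin n)),
        0 ≤ l ∧ l ≤ c ∧ HasUnitSpeedOn γ (Icc 0 l) ∧ γ 0 = x ∧ γ l = x₀ ∧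
        (∀ t ∈ Icc 0 l, γ t ∈ D) ∧
        ∀ t ∈ Icc 0 l, φ t ≤ c * Metric.infDist (γ t) (frontier D)

/-- The distribution `T` on `D` is (given by integration against) the function `u`. -/
def IsRepresentedBy {n : ℕ} {D : TopologicalSpace.Opens (EuclideanSpace ℝ (Fin n))}
    (T : 𝓓'(D, ℝ)) (u : EuclideanSpace ℝ (Fin n) → ℝ) : Prop :=
  LocallyIntegrableOn u (D : Set (EuclideanSpace ℝ (Fin n))) ∧
    ∀ ψ : 𝓓(D, ℝ), T ψ = ∫ x in (D : Set (EuclideanSpace ℝ (Fin n))), u x * ψ x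

/-- The distribution `T` belongs to `L¹_p(D)` and `g` is its gradient: the vector field `g` is in
`L^p(D)`, and each distributional derivative `∂_v T` is given by integration against `⟪g, v⟫`. -/
def HasLpGradient {n : ℕ} {D : TopologicalSpace.Opens (EuclideanSpace ℝ (Fin n))} (p : ℝ)
    (T : 𝓓'(D, ℝ)) (g : EuclideanSpace ℝ (Fin n) → EuclideanSpace ℝ (Fin n)) : Prop :=
  MemLp g (ENNReal.ofReal p) (volume.restrict (D : Set (EuclideanSpace ℝ (Fin n)))) ∧
    ∀ (v : EuclideanSpace ℝ (Fin n)) (ψ : 𝓓(D, ℝ)),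
      (∂_{v} T) ψ = ∫ x in (D : Set (EuclideanSpace ℝ (Fin n))), inner ℝ (g x) v * ψ x

/-- The Luxemburg norm `inf {r > 0 : ∫_D H(|u|/r) ≤ 1}`, with values in `[0, ∞]`
(the infimum of the empty set is `∞`). -/
noncomputable def luxemburgNorm {n : ℕ} (H : ℝ → ℝ) (D : Set (EuclideanSpace ℝ (Fin n)))
    (u : EuclideanSpace ℝ (Fin n) → ℝ) : ENNReal :=
  ⨅ (r : ℝ) (_ : 0 < r) (_ : ∫⁻ x in D, ENNReal.ofReal (H (|u x| / r)) ≤ 1), ENNReal.ofReal r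

/-! Write `n` for the dimension and `g` for the gradient. The proof derives a weak type estimate
from a pointwise bound by a potential, and truncation upgrades it to a strong one.

Two normalized bumps supported in a ball `B` differ by the divergence of a bounded vector field `W`
supported in `B`, so a distribution with gradient `g` takes values on them that differ by `∫ g · W`
(`IsGradFunctional.integral_mul_sub`). Keeping one bump fixed and applying Fubini produces a local
density, so the distribution is a function (`IsGradFunctional.exists_locallyIntegrableOn`). For
bumps of radius comparable to that of `B`, the same identity is a Poincaré inequality: the two means
differ by at most `C r^(1-n) ∫_B |g|`.

Means are telescoped along a chain of balls, from balls shrinking to `x` out to the John center. If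
a ball of radius `r` in the chain contains `y`, the John condition gives `φ(|x - y|) ≤ C r`, and the
overlap is either bounded or geometrically weighted. Hence, for almost every `x`, `|u(x) - d|` is at
most a constant times `∫_D |g(y)| φ(|x - y|)^(1-n) dy` (`exists_abs_sub_mean_le_modifiedRiesz`).

Let `‖g‖_p ≤ 1`, and let `τ^p` bound the maximal function of `|g|^p` at `x`. Cut the potential at
`|x - y| = δ(τ)`. Dyadic annuli bound the near part by `h(δ) τ`; Hölder's inequality and `p < n`
bound the far part by `φ(δ)^(1-n) δ^(n(1-1/p))` (`exists_modifiedRiesz_le`). The growth condition on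
`H` and the weak type inequality for the maximal function give `H(s/K) |{|u - d| ≥ s}| ≤ B ∫ |g|^p`
(`exists_mul_measure_abs_sub_ge_le`).

This holds for every truncation of `u` as well. The truncations between the levels `m + 2^j` and `m
+ 2^(j+1)`, with `m` a median, have gradients living on disjoint sets, so the weak estimates add up
to a bound for `∫ H((u - m)⁺/(8K))` (`IsWeakGradient.lintegral_posPart_le`). Only the weak type
inequality is used, so `p = 1` needs no separate treatment. Jensen's inequality replaces the median
by the average, and scaling removes the normalization of `g`. -/

open Module Metric
open scoped ContDiff

set_option linter.unusedSectionVars false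

/-! ### Parametric integrals over compact sets -/

section ParametricIntegral

variable {P X V : Type} [NormedAddCommGroup P] [NormedSpace ℝ P] [FiniteDimensional ℝ P]
  [NormedAddCommGroup X] [NormedSpace ℝ X] [MeasurableSpace X] [BorelSpace X]
  [SecondCountableTopology X]
  [NormedAddCommGroup V] [NormedSpace ℝ V]

theorem fderiv_comp_prodMk_left {G : P × X → V} (hG : ContDiff ℝ ∞ G) (y : P) (t : X) :
    HasFDerivAt (fun y => G (y, t)) ((fderiv ℝ G (y, t)).comp (ContinuousLinearMap.inl ℝ P X)) y := by
  have h1 : HasFDerivAt G (fderiv ℝ G (y, t)) (y, t) :=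
    (hG.differentiable (by simp)).differentiableAt.hasFDerivAt
  exact h1.comp y (hasFDerivAt_prodMk_left y t)

theorem hasFDerivAt_setIntegral_of_contDiff {μ : Measure X} [IsFiniteMeasureOnCompacts μ]
    {S : Set X} (hS : IsCompact S) {G : P × X → V} (hG : ContDiff ℝ ∞ G) (y : P) :
    HasFDerivAt (fun y => ∫ t in S, G (y, t) ∂μ)
      (∫ t in S, (fderiv ℝ G (y, t)).comp (ContinuousLinearMap.inl ℝ P X) ∂μ) y := by
  have hc : Continuous fun q : P × X => (fderiv ℝ G q).comp (ContinuousLinearMap.inl ℝ P X) :=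
    (hG.continuous_fderiv (by simp)).clm_comp continuous_const
  have : ProperSpace P := FiniteDimensional.proper ℝ P
  obtain ⟨B, hB⟩ := ((isCompact_closedBall y 1).prod hS).exists_bound_of_continuousOn hc.continuousOn
  have hcG (y : P) : Continuous fun t => G (y, t) := hG.continuous.comp (by fun_prop)
  refine hasFDerivAt_integral_of_dominated_of_fderiv_le (bound := fun _ => B)
    (F' := fun y t => (fderiv ℝ G (y, t)).comp (ContinuousLinearMap.inl ℝ P X))
    (closedBall_mem_nhds y one_pos) ?_ ?_ ?_ ?_ ?_ ?_
  · exact Eventually.of_forall fun y => (hcG y).aestronglyMeasurable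
  · exact (hcG y).continuousOn.integrableOn_compact hS
  · exact (hc.comp (by fun_prop : Continuous fun t : X => (y, t))).aestronglyMeasurable
  · filter_upwards [ae_restrict_mem hS.measurableSet] with t ht x hx
    exact hB (x, t) ⟨hx, ht⟩
  · have : IsFiniteMeasure (μ.restrict S) := ⟨by simpa using hS.measure_lt_top⟩
    exact integrable_const B
  · exact Eventually.of_forall fun t x _ => fderiv_comp_prodMk_left hG x t

theorem contDiff_setIntegral {μ : Measure X} [IsFiniteMeasureOnCompacts μ]
    {S : Set X} (hS : IsCompact S) {G : P × X → V} (hG : ContDiff ℝ ∞ G) :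
    ContDiff ℝ ∞ fun y => ∫ t in S, G (y, t) ∂μ := by
  rw [contDiff_infty]
  intro k
  -- The derivative is again a parametric integral, but its values lie in `P →L[ℝ] V`, so the target
  -- space has to vary in the induction.
  induction k generalizing V with
  | zero =>
    rw [Nat.cast_zero, contDiff_zero, continuous_iff_continuousAt]
    exact fun y => (hasFDerivAt_setIntegral_of_contDiff hS hG y).continuousAt
  | succ k ih =>
    rw [Nat.cast_succ, contDiff_succ_iff_hasFDerivAt]
    refine ⟨_, ?_, fun y => hasFDerivAt_setIntegral_of_contDiff hS hG y⟩
    exact ih ((hG.fderiv_right (m := ∞) (by simp)).clm_comp contDiff_const)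

end ParametricIntegral

section FiniteDimensional

variable {E : Type} [NormedAddCommGroup E] [InnerProductSpace ℝ E] [FiniteDimensional ℝ E]
  [MeasurableSpace E] [BorelSpace E]

/-! ### The transport field -/

/-- A vector field whose divergence is the difference between (a multiple of) `a` and the
"midpoint convolution" of `a` and `b`. It is obtained by moving the mass of `a` halfway towards
that of `b` along segments. -/
noncomputable def transportField (K : Set E) (a b : E → ℝ) (y : E) : E :=
  ∫ q in Icc (0 : ℝ) 1 ×ˢ K,
    (b q.2 * (1 + q.1) ^ (finrank ℝ E - 1) * a (y + q.1 • (y - q.2))) • (y - q.2)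

theorem contDiff_transportField_integrand {a b : E → ℝ} (ha : ContDiff ℝ ∞ a)
    (hb : ContDiff ℝ ∞ b) :
    ContDiff ℝ ∞ fun p : E × (ℝ × E) =>
      (b p.2.2 * (1 + p.2.1) ^ (finrank ℝ E - 1) * a (p.1 + p.2.1 • (p.1 - p.2.2))) •
        (p.1 - p.2.2) := by
  have h1 : ContDiff ℝ ∞ fun p : E × (ℝ × E) => p.1 := contDiff_fst
  have h2 : ContDiff ℝ ∞ fun p : E × (ℝ × E) => p.2.1 := contDiff_snd.fst
  have h3 : ContDiff ℝ ∞ fun p : E × (ℝ × E) => p.2.2 := contDiff_snd.snd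
  exact (((hb.comp h3).mul ((contDiff_const.add h2).pow _)).mul
    (ha.comp (h1.add (h2.smul (h1.sub h3))))).smul (h1.sub h3)

theorem contDiff_transportField {K : Set E} (hK : IsCompact K) {a b : E → ℝ}
    (ha : ContDiff ℝ ∞ a) (hb : ContDiff ℝ ∞ b) : ContDiff ℝ ∞ (transportField K a b) :=
  contDiff_setIntegral (isCompact_Icc.prod hK) (contDiff_transportField_integrand ha hb)

/-- The point `y` lies on the segment from `x = y + τ (y - z)` to `z`. If `a x ≠ 0`, both endpoints
are in `K`, and convexity puts `y` in `K`. -/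
theorem transportField_integrand_eq_zero {K : Set E} (hKc : Convex ℝ K) {a b : E → ℝ}
    (ha : tsupport a ⊆ K) {y : E} (hy : y ∉ K) {q : ℝ × E} (hq : q ∈ Icc (0 : ℝ) 1 ×ˢ K) :
    (b q.2 * (1 + q.1) ^ (finrank ℝ E - 1) * a (y + q.1 • (y - q.2))) • (y - q.2) = 0 := by
  obtain ⟨⟨h0, h1⟩, hz⟩ := hq
  have : a (y + q.1 • (y - q.2)) = 0 := by
    by_contra hne
    have hx : y + q.1 • (y - q.2) ∈ K := ha (subset_tsupport _ hne)
    refine hy ?_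
    have h3 : 0 < 1 + q.1 := by linarith
    have := hKc hx hz (a := 1 / (1 + q.1)) (b := q.1 / (1 + q.1)) (by positivity) (by positivity)
      (by field_simp)
    convert this using 1
    have h4 : (1 / (1 + q.1)) • (y + q.1 • (y - q.2)) + (q.1 / (1 + q.1)) • q.2
        = (1 / (1 + q.1)) • ((1 + q.1) • y) := by
      rw [add_smul, one_smul, div_eq_mul_one_div q.1, mul_comm, mul_smul, ← smul_add, smul_sub]
      congr 1
      abel
    rw [h4, smul_smul, one_div_mul_cancel h3.ne', one_smul]
  simp [this]

theorem transportField_eq_zero {K : Set E} (hKc : Convex ℝ K) {a b : E → ℝ}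
    (ha : tsupport a ⊆ K) {y : E} (hy : y ∉ K) : transportField K a b y = 0 :=
  setIntegral_eq_zero_of_forall_eq_zero fun _ hq => transportField_integrand_eq_zero hKc ha hy hq

/-- Mass is moved only up to the midpoint, `τ ≤ 1`, so the factor `(1 + τ)^(n-1)` stays below
`2^(n-1)`. Moving it all the way to `z` would correspond to `τ → ∞` and give a singular field. -/
theorem norm_transportField_le {K : Set E} (hK : IsCompact K) (hKc : Convex ℝ K) {a b : E → ℝ}
    (ha : tsupport a ⊆ K) (hb : Continuous b) {A : ℝ} (hA : ∀ x, |a x| ≤ A) (y : E) :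
    ‖transportField K a b y‖ ≤ 2 ^ (finrank ℝ E - 1) * A * Metric.diam K * ∫ z in K, |b z| := by
  have hA0 : 0 ≤ A := (abs_nonneg _).trans (hA 0)
  by_cases hy : y ∈ K
  swap
  · rw [transportField_eq_zero hKc ha hy, norm_zero]
    have : 0 ≤ ∫ z in K, |b z| := integral_nonneg fun _ => abs_nonneg _
    have := Metric.diam_nonneg (s := K)
    positivity
  have hint : IntegrableOn (fun z => |b z|) K := hb.abs.continuousOn.integrableOn_compact hK
  have hint2 : Integrable (fun q : ℝ × E => 1 * |b q.2|)
      (((volume : Measure ℝ).restrict (Icc 0 1)).prod (volume.restrict K)) :=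
    Integrable.mul_prod (f := fun _ : ℝ => (1 : ℝ)) (g := fun z => |b z|) (integrable_const _) hint
  have hv : (volume : Measure (ℝ × E)).restrict (Icc (0 : ℝ) 1 ×ˢ K) =
      ((volume : Measure ℝ).restrict (Icc 0 1)).prod (volume.restrict K) := by
    rw [Measure.prod_restrict]; rfl
  set c := 2 ^ (finrank ℝ E - 1) * A * Metric.diam K with hc
  calc ‖transportField K a b y‖
      ≤ ∫ q in Icc (0 : ℝ) 1 ×ˢ K, c * (1 * |b q.2|) := by
        refine norm_integral_le_of_norm_le (by rw [hv]; exact hint2.const_mul c) ?_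
        filter_upwards [ae_restrict_mem (measurableSet_Icc.prod hK.measurableSet)] with q hq
        obtain ⟨⟨h0, h1⟩, hz⟩ := hq
        rw [norm_smul, Real.norm_eq_abs, abs_mul, abs_mul]
        have h2 : ‖y - q.2‖ ≤ Metric.diam K := by
          rw [← dist_eq_norm]; exact Metric.dist_le_diam_of_mem hK.isBounded hy hz
        have h3 : |(1 + q.1) ^ (finrank ℝ E - 1)| ≤ 2 ^ (finrank ℝ E - 1) := by
          rw [abs_of_nonneg (by positivity)]
          exact pow_le_pow_left₀ (by linarith) (by linarith) _
        calc |b q.2| * |(1 + q.1) ^ (finrank ℝ E - 1)| * |a (y + q.1 • (y - q.2))| * ‖y - q.2‖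
            ≤ |b q.2| * 2 ^ (finrank ℝ E - 1) * A * Metric.diam K := by
              gcongr
              exact hA _
          _ = c * (1 * |b q.2|) := by rw [hc]; ring
    _ = c * ∫ z in K, |b z| := by
        rw [integral_const_mul, hv, integral_prod_mul (f := fun _ : ℝ => (1 : ℝ))
          (g := fun z => |b z|)]
        simp

/-- For fixed `z`, the divergence in `y` of the integrand is `b z` times the `τ`-derivative of `(1 +
τ)^n a(y + τ (y - z))`, so the integral over `τ` is evaluated by the fundamental theorem of
calculus. -/
theorem sum_inner_fderiv_transportField {K : Set E} (hK : IsCompact K) (hn : 0 < finrank ℝ E)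
    {a b : E → ℝ} (ha : ContDiff ℝ ∞ a) (hb : ContDiff ℝ ∞ b) (y : E) :
    ∑ i, inner ℝ (fderiv ℝ (transportField K a b) y (stdOrthonormalBasis ℝ E i))
        (stdOrthonormalBasis ℝ E i) =
      ∫ z in K, b z * (2 ^ finrank ℝ E * a ((2 : ℝ) • y - z) - a y) := by
  set e := stdOrthonormalBasis ℝ E
  have hG := contDiff_transportField_integrand ha hb
  have hS : IsCompact (Icc (0 : ℝ) 1 ×ˢ K) := isCompact_Icc.prod hK
  have h1 := hasFDerivAt_setIntegral_of_contDiff (μ := (volume : Measure (ℝ × E))) hS hG y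
  have h2 : fderiv ℝ (transportField K a b) y = _ := h1.fderiv
  rw [h2]
  -- The trace, as a continuous linear functional, so that it can be taken inside the integral.
  set L : (E →L[ℝ] E) →L[ℝ] ℝ :=
    ∑ i, (innerSL ℝ (e i)).comp (ContinuousLinearMap.apply ℝ E (e i)) with hL
  have hLapp (M : E →L[ℝ] E) : L M = ∑ i, inner ℝ (M (e i)) (e i) := by
    simp only [hL, _root_.sum_apply, ContinuousLinearMap.comp_apply,
      ContinuousLinearMap.apply_apply, innerSL_apply_apply]
    exact Finset.sum_congr rfl fun i _ => real_inner_comm _ _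
  rw [← hLapp, ← L.integral_comp_comm]
  swap
  · refine ContinuousOn.integrableOn_compact hS (Continuous.continuousOn ?_)
    exact ((hG.continuous_fderiv (by simp)).comp
      (by fun_prop : Continuous fun t : ℝ × E => (y, t))).clm_comp continuous_const
  have hpt (q : ℝ × E) : L ((fderiv ℝ (fun p : E × (ℝ × E) =>
      (b p.2.2 * (1 + p.2.1) ^ (finrank ℝ E - 1) * a (p.1 + p.2.1 • (p.1 - p.2.2))) •
        (p.1 - p.2.2)) (y, q)).comp (ContinuousLinearMap.inl ℝ E (ℝ × E))) =
      b q.2 * (finrank ℝ E * (1 + q.1) ^ (finrank ℝ E - 1) * a (y + q.1 • (y - q.2)) +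
        (1 + q.1) ^ finrank ℝ E * fderiv ℝ a (y + q.1 • (y - q.2)) (y - q.2)) := by
    have h3 := fderiv_comp_prodMk_left hG y q
    have h5 : HasFDerivAt (fun y : E => y + q.1 • (y - q.2))
        (ContinuousLinearMap.id ℝ E + q.1 • ContinuousLinearMap.id ℝ E) y :=
      (hasFDerivAt_id y).add (((hasFDerivAt_id y).sub_const q.2).const_smul q.1)
    have h6 : HasFDerivAt a (fderiv ℝ a (y + q.1 • (y - q.2))) (y + q.1 • (y - q.2)) :=
      (ha.differentiable (by simp)).differentiableAt.hasFDerivAt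
    have h4 := ((h6.comp y h5).const_mul (b q.2 * (1 + q.1) ^ (finrank ℝ E - 1))).smul
      ((hasFDerivAt_id y).sub_const q.2)
    rw [h3.unique h4, hLapp]
    simp only [_root_.add_apply, _root_.smul_apply,
      ContinuousLinearMap.smulRight_apply, ContinuousLinearMap.comp_apply,
      ContinuousLinearMap.id_apply, inner_add_left, inner_smul_left, Finset.sum_add_distrib,
      Function.comp_apply, id, RCLike.conj_to_real, smul_eq_mul, map_add, map_smul]
    have h7 (c : ℝ) : ∑ i, c * inner ℝ (e i) (e i) = finrank ℝ E * c := by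
      simp [mul_comm]
    have h8 : ∑ i, fderiv ℝ a (y + q.1 • (y - q.2)) (e i) * inner ℝ (y - q.2) (e i) =
        fderiv ℝ a (y + q.1 • (y - q.2)) (y - q.2) := by
      generalize fderiv ℝ a (y + q.1 • (y - q.2)) = M
      conv_rhs => rw [← e.sum_repr' (y - q.2)]
      rw [map_sum]
      exact Finset.sum_congr rfl fun i _ => by
        rw [map_smul, smul_eq_mul, real_inner_comm, mul_comm]
    have h9 : (1 + q.1) ^ finrank ℝ E = (1 + q.1) ^ (finrank ℝ E - 1) * (1 + q.1) := by
      rw [← pow_succ, Nat.sub_add_cancel hn]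
    rw [h7, h9, ← h8, Finset.mul_sum, mul_add, Finset.mul_sum]
    congr 1
    · ring
    · exact Finset.sum_congr rfl fun i _ => by ring
  have hcont : Continuous fun q : ℝ × E =>
      b q.2 * (finrank ℝ E * (1 + q.1) ^ (finrank ℝ E - 1) * a (y + q.1 • (y - q.2)) +
        (1 + q.1) ^ finrank ℝ E * fderiv ℝ a (y + q.1 • (y - q.2)) (y - q.2)) := by
    have hbc := hb.continuous
    have hac := ha.continuous
    have hdc := ha.continuous_fderiv (by simp)
    refine (hbc.comp continuous_snd).mul (Continuous.add (by fun_prop) (Continuous.mul (by fun_prop) ?_))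
    exact (hdc.comp (by fun_prop)).clm_apply (by fun_prop)
  simp_rw [hpt]
  rw [Measure.volume_eq_prod, ← Measure.prod_restrict, integral_prod_symm]
  swap
  · rw [Measure.prod_restrict]
    exact hcont.continuousOn.integrableOn_compact hS
  refine setIntegral_congr_fun hK.measurableSet fun z _ => ?_
  simp only
  rw [integral_const_mul]
  congr 1
  rw [integral_Icc_eq_integral_Ioc, ← intervalIntegral.integral_of_le zero_le_one]
  have hd (τ : ℝ) : HasDerivAt (fun τ : ℝ => (1 + τ) ^ finrank ℝ E * a (y + τ • (y - z)))
      (finrank ℝ E * (1 + τ) ^ (finrank ℝ E - 1) * a (y + τ • (y - z)) +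
        (1 + τ) ^ finrank ℝ E * fderiv ℝ a (y + τ • (y - z)) (y - z)) τ := by
    have h1 : HasDerivAt (fun τ : ℝ => (1 + τ) ^ finrank ℝ E)
        (finrank ℝ E * (1 + τ) ^ (finrank ℝ E - 1)) τ := by
      simpa using ((hasDerivAt_id τ).const_add 1).fun_pow (finrank ℝ E)
    have h2 : HasDerivAt (fun τ : ℝ => y + τ • (y - z)) (y - z) τ := by
      simpa using ((hasDerivAt_id τ).smul_const (y - z)).const_add y
    have h6 : HasFDerivAt a (fderiv ℝ a (y + τ • (y - z))) (y + τ • (y - z)) :=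
      (ha.differentiable (by simp)).differentiableAt.hasFDerivAt
    exact h1.mul (h6.comp_hasDerivAt τ h2)
  rw [intervalIntegral.integral_eq_sub_of_hasDerivAt (fun τ _ => hd τ)]
  · have : y + (1 : ℝ) • (y - z) = (2 : ℝ) • y - z := by rw [one_smul, two_smul]; abel
    rw [this]
    norm_num
  · refine Continuous.intervalIntegrable ?_ _ _
    have hac := ha.continuous
    have hdc := ha.continuous_fderiv (by simp)
    refine Continuous.add (by fun_prop) (Continuous.mul (by fun_prop) ?_)
    exact (hdc.comp (by fun_prop)).clm_apply (by fun_prop)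

/-- `ψ` is a test function on `D`. -/
structure IsTest (D : Set E) (ψ : E → ℝ) : Prop where
  contDiff : ContDiff ℝ ∞ ψ
  hasCompactSupport : HasCompactSupport ψ
  tsupport_subset : tsupport ψ ⊆ D

/-! ### Functionals with a gradient -/

/-- `Λ` is a linear functional on the test functions on `D` with distributional gradient `g`. -/
structure IsGradFunctional (D : Set E) (Λ : (E → ℝ) → ℝ) (g : E → E) : Prop where
  map_add : ∀ ψ χ, IsTest D ψ → IsTest D χ → Λ (fun x => ψ x + χ x) = Λ ψ + Λ χ
  map_smul : ∀ (c : ℝ) ψ, IsTest D ψ → Λ (fun x => c * ψ x) = c * Λ ψ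
  map_fderiv : ∀ (v : E) ψ, IsTest D ψ →
    Λ (fun x => fderiv ℝ ψ x v) = -∫ x, inner ℝ (g x) v * ψ x

namespace IsTest

variable {D : Set E} {ψ χ : E → ℝ}

theorem continuous (h : IsTest D ψ) : Continuous ψ := h.contDiff.continuous

theorem integrable (h : IsTest D ψ) : Integrable ψ :=
  h.continuous.integrable_of_hasCompactSupport h.hasCompactSupport

theorem mono {D' : Set E} (h : IsTest D ψ) (hD : D ⊆ D') : IsTest D' ψ :=
  ⟨h.1, h.2, h.3.trans hD⟩

theorem of_subset_compact {K : Set E} (hK : IsCompact K) (hKD : K ⊆ D) (h1 : ContDiff ℝ ∞ ψ)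
    (h2 : ∀ x ∉ K, ψ x = 0) : IsTest D ψ := by
  have h3 : tsupport ψ ⊆ K := closure_minimal (fun y hy => by
    by_contra h
    exact hy (h2 y h)) hK.isClosed
  exact ⟨h1, HasCompactSupport.intro hK fun x hx => h2 x hx, h3.trans hKD⟩

theorem zero : IsTest D (fun _ : E => (0 : ℝ)) :=
  of_subset_compact isCompact_empty (empty_subset _) contDiff_const (by simp)

theorem add (h : IsTest D ψ) (h' : IsTest D χ) : IsTest D fun x => ψ x + χ x :=
  of_subset_compact (h.2.isCompact.union h'.2.isCompact) (union_subset h.3 h'.3) (h.1.add h'.1)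
    fun x hx => by
      rw [image_eq_zero_of_notMem_tsupport fun h => hx (Or.inl h),
        image_eq_zero_of_notMem_tsupport fun h => hx (Or.inr h), add_zero]

theorem const_mul (h : IsTest D ψ) (c : ℝ) : IsTest D fun x => c * ψ x :=
  of_subset_compact h.2.isCompact h.3 (contDiff_const.mul h.1) fun x hx => by
    rw [image_eq_zero_of_notMem_tsupport hx, mul_zero]

theorem sum {ι : Type*} {s : Finset ι} {f : ι → E → ℝ} (h : ∀ i ∈ s, IsTest D (f i)) :
    IsTest D fun x => ∑ i ∈ s, f i x := by
  classical
  induction s using Finset.induction_on with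
  | empty => simpa using zero
  | insert i s hi ih =>
    simp only [Finset.sum_insert hi]
    exact (h i (by simp)).add (ih fun j hj => h j (by simp [hj]))

theorem fderiv_apply (h : IsTest D ψ) (v : E) : IsTest D fun x => fderiv ℝ ψ x v :=
  of_subset_compact h.2.isCompact h.3 ((h.1.fderiv_right (m := ∞) (by simp)).clm_apply contDiff_const)
    fun x hx => by
      have : fderiv ℝ ψ x = 0 := by
        by_contra hne
        exact hx (support_fderiv_subset ℝ (f := ψ) hne)
      simp [this]

end IsTest

namespace IsGradFunctional

variable {D : Set E} {Λ : (E → ℝ) → ℝ} {g : E → E}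

theorem map_sum (h : IsGradFunctional D Λ g) {ι : Type*} {s : Finset ι} {f : ι → E → ℝ}
    (hf : ∀ i ∈ s, IsTest D (f i)) : Λ (fun x => ∑ i ∈ s, f i x) = ∑ i ∈ s, Λ (f i) := by
  classical
  induction s using Finset.induction_on with
  | empty => simpa using h.map_smul 0 _ IsTest.zero
  | insert i s hi ih =>
    simp only [Finset.sum_insert hi]
    rw [h.map_add _ _ (hf i (by simp)) (IsTest.sum fun j hj => hf j (by simp [hj])),
      ih fun j hj => hf j (by simp [hj])]

theorem map_sub (h : IsGradFunctional D Λ g) {ψ χ : E → ℝ} (hψ : IsTest D ψ) (hχ : IsTest D χ) :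
    Λ (fun x => ψ x - χ x) = Λ ψ - Λ χ := by
  have := h.map_add _ _ hψ (hχ.const_mul (-1))
  rw [h.map_smul _ _ hχ] at this
  simpa [sub_eq_add_neg] using this

theorem map_divergence (h : IsGradFunctional D Λ g) (hg : LocallyIntegrableOn g D) {K : Set E}
    (hK : IsCompact K) (hKD : K ⊆ D) {W : E → E} (hW : ContDiff ℝ ∞ W) (hWK : ∀ x ∉ K, W x = 0) :
    Λ (fun x => ∑ i, inner ℝ (fderiv ℝ W x (stdOrthonormalBasis ℝ E i))
        (stdOrthonormalBasis ℝ E i)) = -∫ x in K, inner ℝ (g x) (W x) := by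
  set e := stdOrthonormalBasis ℝ E
  have ht (i) : IsTest D fun x => inner ℝ (W x) (e i) :=
    IsTest.of_subset_compact hK hKD (hW.inner ℝ contDiff_const) fun x hx => by simp [hWK x hx]
  have hd (i) (x : E) : inner ℝ (fderiv ℝ W x (e i)) (e i) =
      fderiv ℝ (fun x => inner ℝ (W x) (e i)) x (e i) := by
    have h1 : HasFDerivAt W (fderiv ℝ W x) x :=
      (hW.differentiable (by simp)).differentiableAt.hasFDerivAt
    rw [(h1.inner ℝ (hasFDerivAt_const (e i) x)).fderiv]
    simp [fderivInnerCLM_apply]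
  simp_rw [hd]
  rw [h.map_sum fun i _ => (ht i).fderiv_apply _]
  simp_rw [h.map_fderiv _ _ (ht _)]
  rw [Finset.sum_neg_distrib]
  congr 1
  have hgK : IntegrableOn g K := hg.integrableOn_compact_subset hKD hK
  have h2 (i) : ∫ x, inner ℝ (g x) (e i) * inner ℝ (W x) (e i) =
      ∫ x in K, inner ℝ (g x) (e i) * inner ℝ (W x) (e i) :=
    (setIntegral_eq_integral_of_forall_compl_eq_zero fun x hx => by simp [hWK x hx]).symm
  simp_rw [h2]
  rw [← integral_finsetSum]
  · refine integral_congr_ae (Eventually.of_forall fun x => ?_)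
    simp only
    rw [← e.sum_inner_mul_inner (g x) (W x)]
    exact Finset.sum_congr rfl fun i _ => by rw [real_inner_comm (W x)]
  · intro i _
    have h3 : IntegrableOn (fun x => inner ℝ (g x) (e i)) K := hgK.inner_const _
    exact h3.mul_continuousOn (hW.continuous.inner continuous_const).continuousOn hK

/-- The values of a functional on two test functions with supports in a convex compact set are
compared through the gradient. -/
theorem integral_mul_sub (h : IsGradFunctional D Λ g) (hg : LocallyIntegrableOn g D)
    (hn : 0 < finrank ℝ E) {K : Set E} (hK : IsCompact K) (hKc : Convex ℝ K) (hKD : K ⊆ D)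
    {a b : E → ℝ} (ha : IsTest K a) (hb : IsTest K b) :
    (∫ z, b z) * Λ a - (∫ z, a z) * Λ b =
      ∫ x in K, inner ℝ (g x) (transportField K a b x - transportField K b a x) := by
  set W : E → E := fun x => transportField K a b x - transportField K b a x with hW
  have hWab := contDiff_transportField hK ha.1 hb.1
  have hWba := contDiff_transportField hK hb.1 ha.1
  have hWc : ContDiff ℝ ∞ W := hWab.sub hWba
  have h1 := h.map_divergence hg hK hKD hWc fun x hx => by
    simp [hW, transportField_eq_zero hKc ha.3 hx, transportField_eq_zero hKc hb.3 hx]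
  have hset {f : E → ℝ} (hf : IsTest K f) : ∫ z in K, f z = ∫ z, f z :=
    setIntegral_eq_integral_of_forall_compl_eq_zero fun x hx =>
      image_eq_zero_of_notMem_tsupport fun h => hx (hf.3 h)
  have hdiv {a b : E → ℝ} (ha : IsTest K a) (hb : IsTest K b) (x : E) :
      ∑ i, inner ℝ (fderiv ℝ (transportField K a b) x (stdOrthonormalBasis ℝ E i))
        (stdOrthonormalBasis ℝ E i) =
      2 ^ finrank ℝ E * (∫ z, b z * a ((2 : ℝ) • x - z)) - (∫ z, b z) * a x := by
    rw [sum_inner_fderiv_transportField hK hn ha.1 hb.1]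
    rw [setIntegral_eq_integral_of_forall_compl_eq_zero fun z hz => by
      rw [image_eq_zero_of_notMem_tsupport fun h => hz (hb.3 h), zero_mul]]
    simp_rw [mul_sub, mul_left_comm (b _)]
    have hac := ha.continuous
    have hbc := hb.continuous
    rw [integral_sub, integral_const_mul, integral_mul_const]
    · refine Integrable.const_mul (Continuous.integrable_of_hasCompactSupport (by fun_prop) ?_) _
      exact hb.2.mul_right
    · exact hb.integrable.mul_const _
  -- The substitution `z ↦ 2x - z` shows that the midpoint convolution is symmetric in `a` and `b`.
  -- It therefore cancels in the divergence of the difference of the two transport fields.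
  have hsymm (x : E) : ∫ z, b z * a ((2 : ℝ) • x - z) = ∫ z, a z * b ((2 : ℝ) • x - z) := by
    rw [← integral_sub_left_eq_self _ _ ((2 : ℝ) • x)]
    refine integral_congr_ae (Eventually.of_forall fun z => ?_)
    simp [mul_comm]
  have h2 : (fun x => ∑ i, inner ℝ (fderiv ℝ W x (stdOrthonormalBasis ℝ E i))
      (stdOrthonormalBasis ℝ E i)) = fun x => (∫ z, a z) * b x - (∫ z, b z) * a x := by
    funext x
    have h3 : fderiv ℝ W x = fderiv ℝ (transportField K a b) x - fderiv ℝ (transportField K b a) x :=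
      fderiv_fun_sub (hWab.differentiable (by simp)).differentiableAt
        (hWba.differentiable (by simp)).differentiableAt
    simp only [h3, _root_.sub_apply, inner_sub_left, Finset.sum_sub_distrib]
    rw [hdiv ha hb, hdiv hb ha, hsymm]
    ring
  have haD := ha.mono hKD
  have hbD := hb.mono hKD
  rw [h2, h.map_sub (hbD.const_mul _) (haD.const_mul _), h.map_smul _ _ hbD, h.map_smul _ _ haD]
    at h1
  linarith

/-- A Poincaré inequality in dual form: each of the two transport fields contributes a sup bound
`2^(n-1) A diam K`. -/
theorem abs_sub_le (h : IsGradFunctional D Λ g) (hg : LocallyIntegrableOn g D)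
    (hn : 0 < finrank ℝ E) {K : Set E} (hK : IsCompact K) (hKc : Convex ℝ K) (hKD : K ⊆ D)
    {a b : E → ℝ} (ha : IsTest K a) (hb : IsTest K b) (ha0 : ∀ x, 0 ≤ a x) (hb0 : ∀ x, 0 ≤ b x)
    (ha1 : ∫ x, a x = 1) (hb1 : ∫ x, b x = 1) {A : ℝ} (haA : ∀ x, a x ≤ A) (hbA : ∀ x, b x ≤ A) :
    |Λ a - Λ b| ≤ 2 ^ finrank ℝ E * A * Metric.diam K * ∫ x in K, ‖g x‖ := by
  have h1 := h.integral_mul_sub hg hn hK hKc hKD ha hb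
  rw [ha1, hb1, one_mul, one_mul] at h1
  have hgK : IntegrableOn g K := hg.integrableOn_compact_subset hKD hK
  have key {a b : E → ℝ} (ha : IsTest K a) (hb : IsTest K b) (ha0 : ∀ x, 0 ≤ a x)
      (hb0 : ∀ x, 0 ≤ b x) (hb1 : ∫ x, b x = 1) (haA : ∀ x, a x ≤ A) (x : E) :
      ‖transportField K a b x‖ ≤ 2 ^ (finrank ℝ E - 1) * A * Metric.diam K := by
    have h2 := norm_transportField_le hK hKc ha.3 hb.continuous (A := A)
      (fun x => by rw [abs_of_nonneg (ha0 x)]; exact haA x) x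
    have h3 : ∫ z in K, |b z| = 1 := by
      rw [← hb1, setIntegral_eq_integral_of_forall_compl_eq_zero fun x hx => by
        rw [image_eq_zero_of_notMem_tsupport fun h => hx (hb.3 h), abs_zero]]
      exact integral_congr_ae (Eventually.of_forall fun x => abs_of_nonneg (hb0 x))
    simpa [h3] using h2
  have h2 : (2 : ℝ) ^ finrank ℝ E = 2 ^ (finrank ℝ E - 1) * 2 := by
    rw [← pow_succ, Nat.sub_add_cancel hn]
  rw [h1, ← Real.norm_eq_abs, ← integral_const_mul]
  refine norm_integral_le_of_norm_le (hgK.norm.const_mul _) (Eventually.of_forall fun x => ?_)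
  calc ‖inner ℝ (g x) (transportField K a b x - transportField K b a x)‖
      ≤ ‖g x‖ * ‖transportField K a b x - transportField K b a x‖ := norm_inner_le_norm _ _
    _ ≤ ‖g x‖ * (2 ^ (finrank ℝ E - 1) * A * Metric.diam K +
          2 ^ (finrank ℝ E - 1) * A * Metric.diam K) := by
        gcongr
        exact (norm_sub_le _ _).trans
          (add_le_add (key ha hb ha0 hb0 hb1 haA x) (key hb ha hb0 ha0 ha1 hbA x))
    _ = 2 ^ finrank ℝ E * A * Metric.diam K * ‖g x‖ := by rw [h2]; ring

end IsGradFunctional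

section Means

/-! ### Normalized bumps -/

/-- A normalized smooth bump supported in the closed ball of radius `r` around the origin. -/
noncomputable def mollifier (r : ℝ) : E → ℝ :=
  if h : 0 < r then (⟨r / 2, r, half_pos h, half_lt_self h⟩ : ContDiffBump (0 : E)).normed volume
  else 0

theorem mollifier_of_pos {r : ℝ} (h : 0 < r) : (mollifier r : E → ℝ) =
    (⟨r / 2, r, half_pos h, half_lt_self h⟩ : ContDiffBump (0 : E)).normed volume := dif_pos h

theorem mollifier_nonneg (r : ℝ) (x : E) : 0 ≤ mollifier r x := by
  unfold mollifier
  split_ifs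
  · exact ContDiffBump.nonneg_normed _ _
  · rfl

theorem contDiff_mollifier (r : ℝ) : ContDiff ℝ ∞ (mollifier r : E → ℝ) := by
  unfold mollifier
  split_ifs
  · exact ContDiffBump.contDiff_normed _
  · exact contDiff_const

theorem integral_mollifier {r : ℝ} (h : 0 < r) : ∫ x : E, mollifier r x = 1 := by
  rw [mollifier_of_pos h]; exact ContDiffBump.integral_normed _

theorem mollifier_eq_zero {r : ℝ} {x : E} (hx : r < ‖x‖) : mollifier r x = 0 := by
  unfold mollifier
  split_ifs with h
  · by_contra hne
    have : x ∈ Function.support ((⟨r / 2, r, half_pos h, half_lt_self h⟩ :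
      ContDiffBump (0 : E)).normed volume) := hne
    rw [ContDiffBump.support_normed_eq, mem_ball_zero_iff] at this
    exact absurd this hx.le.not_gt
  · rfl

theorem mollifier_neg (r : ℝ) (x : E) : mollifier r (-x) = mollifier r x := by
  unfold mollifier
  split_ifs
  · exact ContDiffBump.normed_neg _ _
  · rfl

theorem mollifier_le {r : ℝ} (h : 0 < r) (x : E) :
    mollifier r x ≤ 2 ^ finrank ℝ E / volume.real (ball (0 : E) 1) / r ^ finrank ℝ E := by
  rw [mollifier_of_pos h]
  refine (ContDiffBump.normed_le_div_measure_closedBall_rOut _ volume 2 ?_ x).trans_eq ?_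
  · simp only; linarith
  · simp only
    rw [Measure.addHaar_real_closedBall _ _ h.le]
    rw [div_div, mul_comm (r ^ _)]

theorem isTest_mollifier_sub {r : ℝ} {z : E} {K : Set E} (hzK : closedBall z r ⊆ K) :
    IsTest K fun x : E => mollifier r (x - z) :=
  IsTest.of_subset_compact (isCompact_closedBall z r) hzK
    ((contDiff_mollifier r).comp (contDiff_id.sub contDiff_const)) fun x hx => by
      refine mollifier_eq_zero ?_
      rwa [mem_closedBall, not_le, dist_eq_norm] at hx

theorem integral_mollifier_sub {r : ℝ} (h : 0 < r) (z : E) :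
    ∫ x : E, mollifier r (x - z) = 1 := by
  rw [integral_sub_right_eq_self (fun x : E => mollifier r x) z, integral_mollifier h]

variable (E) in
/-- The constant in the comparison of means over nearby balls. -/
noncomputable def meanConst : ℝ :=
  2 ^ finrank ℝ E * (2 ^ finrank ℝ E / volume.real (ball (0 : E) 1)) * 2

theorem meanConst_nonneg : 0 ≤ meanConst E := by
  unfold meanConst; positivity

variable {D : Set E} {Λ : (E → ℝ) → ℝ} {g : E → E}

/-- The two bumps need not be close in size: both are bounded by a multiple of `s^(-n)`, and the
ball of radius `R` serves as the common convex set, with diameter at most `2 R`. -/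
theorem IsGradFunctional.abs_mean_sub_le (h : IsGradFunctional D Λ g)
    (hg : LocallyIntegrableOn g D) (hn : 0 < finrank ℝ E) {w z z' : E} {R r r' s : ℝ}
    (hs : 0 < s) (hr : s ≤ r) (hr' : s ≤ r') (hD : closedBall w R ⊆ D)
    (hz : closedBall z r ⊆ closedBall w R) (hz' : closedBall z' r' ⊆ closedBall w R) :
    |Λ (fun x => mollifier r (x - z)) - Λ (fun x => mollifier r' (x - z'))| ≤
      meanConst E * (R / s ^ finrank ℝ E) * ∫ x in closedBall w R, ‖g x‖ := by
  have hR : 0 ≤ R := by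
    have : z ∈ closedBall w R := hz (mem_closedBall_self (hs.le.trans hr))
    exact dist_nonneg.trans (mem_closedBall.1 this)
  have hA {r : ℝ} (hr : s ≤ r) (x : E) : mollifier r x ≤
      2 ^ finrank ℝ E / volume.real (ball (0 : E) 1) / s ^ finrank ℝ E := by
    refine (mollifier_le (hs.trans_le hr) x).trans ?_
    gcongr
  refine (h.abs_sub_le hg hn (isCompact_closedBall w R) (convex_closedBall w R) hD
    (isTest_mollifier_sub hz) (isTest_mollifier_sub hz') (fun _ => mollifier_nonneg _ _)
    (fun _ => mollifier_nonneg _ _) (integral_mollifier_sub (hs.trans_le hr) z)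
    (integral_mollifier_sub (hs.trans_le hr') z') (fun x => hA hr _) (fun x => hA hr' _)).trans ?_
  have h1 : Metric.diam (closedBall w R) ≤ 2 * R := diam_closedBall hR
  have h2 : 0 ≤ ∫ x in closedBall w R, ‖g x‖ := integral_nonneg fun _ => norm_nonneg _
  unfold meanConst
  calc _ ≤ 2 ^ finrank ℝ E * (2 ^ finrank ℝ E / volume.real (ball (0 : E) 1) / s ^ finrank ℝ E) *
        (2 * R) * ∫ x in closedBall w R, ‖g x‖ := by gcongr
    _ = _ := by ring

theorem ae_tendsto_integral_mul_mollifier {u : E → ℝ} (hu : LocallyIntegrable u) {r : ℕ → ℝ}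
    (hr : ∀ k, 0 < r k) (hr0 : Tendsto r atTop (𝓝 0)) :
    ∀ᵐ x, Tendsto (fun k => ∫ y, u y * mollifier (r k) (y - x)) atTop (𝓝 (u x)) := by
  have h := ContDiffBump.ae_convolution_tendsto_right_of_locallyIntegrable (μ := volume)
    (φ := fun k => (⟨r k / 2, r k, half_pos (hr k), half_lt_self (hr k)⟩ : ContDiffBump (0 : E)))
    (l := atTop) (K := 2) hr0 (Eventually.of_forall fun k => by simp only; linarith) hu
  filter_upwards [h] with x hx
  refine hx.congr fun k => ?_
  rw [convolution_eq_swap]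
  refine integral_congr_ae (Eventually.of_forall fun y => ?_)
  simp only [ContinuousLinearMap.lsmul_apply, smul_eq_mul]
  rw [mollifier_of_pos (hr k), mul_comm, ← ContDiffBump.normed_neg, neg_sub]

/-! ### Local representation by functions -/

theorem integrable_inner_prod {K : Set E} {X : Type*} [TopologicalSpace X] [MeasurableSpace X]
    [OpensMeasurableSpace X] [SecondCountableTopology X] {μ : Measure X} [SFinite μ] {T : Set X}
    (hK : IsCompact K) (hT : IsCompact T) (hTm : MeasurableSet T) (hμT : μ T ≠ ⊤) {g : E → E}
    (hgi : Integrable g) {Ω : E × X → E} (hΩ : Continuous Ω)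
    (h0 : ∀ y ∉ K, ∀ q ∈ T, Ω (y, q) = 0) :
    Integrable (fun p : E × X => inner ℝ (g p.1) (Ω p)) (volume.prod (μ.restrict T)) := by
  obtain ⟨B, hB⟩ := (hK.prod hT).exists_bound_of_continuousOn hΩ.continuousOn
  have hfin : IsFiniteMeasure (μ.restrict T) := ⟨by simpa using hμT.lt_top⟩
  have hB' : ∀ y, ∀ q ∈ T, ‖Ω (y, q)‖ ≤ max B 0 := fun y q hq => by
    by_cases hy : y ∈ K
    · exact (hB (y, q) ⟨hy, hq⟩).trans (le_max_left _ _)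
    · simp [h0 y hy q hq]
  refine (Integrable.mul_prod (f := fun y => ‖g y‖) (g := fun _ : X => max B 0) hgi.norm
    (integrable_const _)).mono' ?_ ?_
  · exact (hgi.aestronglyMeasurable.comp_fst).inner hΩ.aestronglyMeasurable
  · have h1 : ∀ᵐ p : E × X ∂(volume.prod (μ.restrict T)), p.2 ∈ T :=
      Measure.quasiMeasurePreserving_snd.ae (ae_restrict_mem hTm)
    filter_upwards [h1] with p hp
    exact (norm_inner_le_norm _ _).trans (by gcongr; exact hB' p.1 p.2 hp)

theorem setIntegral_inner_integral {K : Set E} {X : Type*} [TopologicalSpace X] [MeasurableSpace X]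
    [OpensMeasurableSpace X] [SecondCountableTopology X] {μ : Measure X} [SFinite μ]
    [IsFiniteMeasureOnCompacts μ] {T : Set X}
    (hK : IsCompact K) (hT : IsCompact T) (hTm : MeasurableSet T) (hμT : μ T ≠ ⊤) {g g' : E → E}
    (hg' : Integrable g') (hgg' : g' =ᵐ[volume] K.indicator g) {Ω : E × X → E} (hΩ : Continuous Ω)
    (h0 : ∀ y ∉ K, ∀ q ∈ T, Ω (y, q) = 0) :
    ∫ y in K, inner ℝ (g y) (∫ q in T, Ω (y, q) ∂μ) =
      ∫ q in T, (∫ y, inner ℝ (g' y) (Ω (y, q))) ∂μ := by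
  rw [← integral_indicator hK.measurableSet,
    ← integral_integral_swap (integrable_inner_prod hK hT hTm hμT hg' hΩ h0)]
  refine integral_congr_ae ?_
  filter_upwards [hgg'] with y hy
  have hi : IntegrableOn (fun q => Ω (y, q)) T μ := by
    have hc : Continuous fun q => Ω (y, q) := hΩ.comp (by fun_prop)
    obtain ⟨B, hB⟩ := hT.exists_bound_of_continuousOn hc.continuousOn
    exact Measure.integrableOn_of_bounded hμT hc.aestronglyMeasurable
      ((ae_restrict_mem hTm).mono fun q hq => hB q hq)
  rw [integral_inner hi, hy]
  by_cases hyK : y ∈ K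
  · simp [hyK]
  · simp [hyK]

/-- For fixed `(τ, z)` the substitution `x = y + τ (y - z)` turns `a(y + τ (y - z))` into `a x`.
Fubini's theorem then collects the coefficient of `a x`, which is a density independent of `a`. -/
theorem exists_integral_inner_transportField_left {K : Set E} (hK : IsCompact K)
    (hKc : Convex ℝ K) {b : E → ℝ} (hb : ContDiff ℝ ∞ b) (hg : IntegrableOn g K) :
    ∃ V : E → ℝ, ∀ a, IsTest K a → Integrable (fun x => a x * V x) ∧
      ∫ x in K, inner ℝ (g x) (transportField K a b x) = ∫ x, a x * V x := by
  have hgi : Integrable (K.indicator g) := hg.integrable_indicator hK.measurableSet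
  -- The gradient will be composed with the map `Y`, which requires a genuinely measurable
  -- representative.
  set g' := hgi.1.mk
  have hg'm : StronglyMeasurable g' := hgi.1.stronglyMeasurable_mk
  have hg'i : Integrable g' := hgi.congr hgi.1.ae_eq_mk
  set S : Set (ℝ × E) := Icc (0 : ℝ) 1 ×ˢ K
  have hS : IsCompact S := isCompact_Icc.prod hK
  let Y : (ℝ × E) × E → E := fun p => (1 + p.1.1)⁻¹ • p.2 + ((1 + p.1.1)⁻¹ * p.1.1) • p.1.2
  have hY : Measurable Y := by fun_prop
  let v : (ℝ × E) × E → ℝ := fun p => ((1 + p.1.1) ^ finrank ℝ E)⁻¹ *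
    (b p.1.2 * (1 + p.1.1) ^ (finrank ℝ E - 1)) * inner ℝ (g' (Y p)) (Y p - p.1.2)
  have hbc := hb.continuous
  have hvm : StronglyMeasurable v := by
    refine StronglyMeasurable.mul ?_ ((hg'm.comp_measurable hY).inner ?_)
    · exact Measurable.stronglyMeasurable (by fun_prop)
    · exact Measurable.stronglyMeasurable (by fun_prop)
  refine ⟨fun x => ∫ q in S, v (q, x), fun a ha => ?_⟩
  have hΩ := (contDiff_transportField_integrand ha.1 hb).continuous
  set Ω : E × (ℝ × E) → E := fun p =>
      (b p.2.2 * (1 + p.2.1) ^ (finrank ℝ E - 1) * a (p.1 + p.2.1 • (p.1 - p.2.2))) •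
        (p.1 - p.2.2) with hΩdef
  have h0 : ∀ y ∉ K, ∀ q ∈ S, Ω (y, q) = 0 := fun y hy q hq =>
    transportField_integrand_eq_zero hKc ha.3 hy hq
  have hF := (integrable_inner_prod hK hS hS.measurableSet (hS.measure_lt_top (μ := volume)).ne hg'i hΩ
    h0).swap
  have hpt : ∀ q ∈ S, ∀ x, a x * v (q, x) = ((1 + q.1) ^ finrank ℝ E)⁻¹ *
      inner ℝ (g' ((1 + q.1)⁻¹ • x + ((1 + q.1)⁻¹ * q.1) • q.2))
        (Ω ((1 + q.1)⁻¹ • x + ((1 + q.1)⁻¹ * q.1) • q.2, q)) := fun q hq x => by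
    have h1 : 0 < 1 + q.1 := by linarith [hq.1.1]
    have h2 : (1 + q.1)⁻¹ • x + ((1 + q.1)⁻¹ * q.1) • q.2 +
        q.1 • ((1 + q.1)⁻¹ • x + ((1 + q.1)⁻¹ * q.1) • q.2 - q.2) = x := by
      have h3 : (1 + q.1)⁻¹ • x + ((1 + q.1)⁻¹ * q.1) • q.2 +
        q.1 • ((1 + q.1)⁻¹ • x + ((1 + q.1)⁻¹ * q.1) • q.2 - q.2) =
        ((1 + q.1) * (1 + q.1)⁻¹) • x + ((1 + q.1) * (1 + q.1)⁻¹ * q.1 - q.1) • q.2 := by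
        module
      rw [h3, mul_inv_cancel₀ h1.ne']
      simp
    simp only [v, Y, hΩdef, h2, inner_smul_right]
    ring
  have hcv (q : ℝ × E) (hq : q ∈ S) (f : E → ℝ) :
      ∫ x, ((1 + q.1) ^ finrank ℝ E)⁻¹ * f ((1 + q.1)⁻¹ • x + ((1 + q.1)⁻¹ * q.1) • q.2) =
        ∫ y, f y := by
    have h1 : 0 < 1 + q.1 := by linarith [hq.1.1]
    rw [integral_const_mul, Measure.integral_comp_smul volume
      (fun x => f (x + ((1 + q.1)⁻¹ * q.1) • q.2)), integral_add_right_eq_self f, inv_pow, inv_inv,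
      abs_of_pos (by positivity), smul_eq_mul, inv_mul_cancel_left₀ (by positivity)]
  have hvi : Integrable (fun p : (ℝ × E) × E => a p.2 * v p)
      ((volume.restrict S).prod volume) := by
    have hm : AEStronglyMeasurable (fun p : (ℝ × E) × E => a p.2 * v p)
        ((volume.restrict S).prod volume) :=
      ((ha.continuous.comp continuous_snd).aestronglyMeasurable).mul hvm.aestronglyMeasurable
    rw [integrable_prod_iff hm]
    rw [integrable_prod_iff hF.1] at hF
    refine ⟨?_, hF.2.congr ?_⟩
    · filter_upwards [hF.1, ae_restrict_mem hS.measurableSet] with q hq1 hq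
      have h1 : 0 < 1 + q.1 := by linarith [hq.1.1]
      simp_rw [hpt q hq]
      refine Integrable.const_mul ?_ _
      exact (hq1.comp_add_right (((1 + q.1)⁻¹ * q.1) • q.2)).comp_smul (inv_ne_zero h1.ne')
    · filter_upwards [ae_restrict_mem hS.measurableSet] with q hq
      have h1 : 0 < 1 + q.1 := by linarith [hq.1.1]
      simp_rw [hpt q hq, norm_mul]
      rw [Real.norm_of_nonneg (by positivity : 0 ≤ ((1 + q.1) ^ finrank ℝ E)⁻¹)]
      exact (hcv q hq fun y => ‖inner ℝ (g' y) (Ω (y, q))‖).symm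
  constructor
  · refine hvi.integral_prod_right.congr (Eventually.of_forall fun x => ?_)
    simp only
    rw [integral_const_mul]
  · rw [show (∫ x in K, inner ℝ (g x) (transportField K a b x)) =
        ∫ y in K, inner ℝ (g y) (∫ q in S, Ω (y, q)) from rfl,
      setIntegral_inner_integral hK hS hS.measurableSet (hS.measure_lt_top (μ := volume)).ne hg'i
        hgi.1.ae_eq_mk.symm hΩ h0]
    simp_rw [← integral_const_mul]
    rw [← integral_integral_swap (f := fun q x => a x * v (q, x)) hvi]
    refine setIntegral_congr_fun hS.measurableSet fun q hq => ?_
    simp_rw [hpt q hq]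
    exact (hcv q hq fun y => inner ℝ (g' y) (Ω (y, q))).symm

/-- Here `a` is evaluated at the integration variable `z` itself, so interchanging the integrals is
enough and no change of variables occurs. -/
theorem exists_integral_inner_transportField_right {K : Set E} (hK : IsCompact K)
    (hKc : Convex ℝ K) {b : E → ℝ} (hb : IsTest K b) (hg : IntegrableOn g K) :
    ∃ V : E → ℝ, ∀ a, IsTest K a → Integrable (fun x => a x * V x) ∧
      ∫ x in K, inner ℝ (g x) (transportField K b a x) = ∫ x, a x * V x := by
  have hgi : Integrable (K.indicator g) := hg.integrable_indicator hK.measurableSet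
  set S : Set (ℝ × E) := Icc (0 : ℝ) 1 ×ˢ K with hSdef
  have hS : IsCompact S := isCompact_Icc.prod hK
  let m : ℝ × E → ℝ := fun q => ∫ y, inner ℝ (K.indicator g y)
    (((1 + q.1) ^ (finrank ℝ E - 1) * b (y + q.1 • (y - q.2))) • (y - q.2))
  refine ⟨fun x => ∫ τ in Icc (0 : ℝ) 1, m (τ, x), fun a ha => ?_⟩
  have hΩ := (contDiff_transportField_integrand hb.1 ha.1).continuous
  set Ω : E × (ℝ × E) → E := fun p =>
      (a p.2.2 * (1 + p.2.1) ^ (finrank ℝ E - 1) * b (p.1 + p.2.1 • (p.1 - p.2.2))) •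
        (p.1 - p.2.2) with hΩdef
  have h0 : ∀ y ∉ K, ∀ q ∈ S, Ω (y, q) = 0 := fun y hy q hq =>
    transportField_integrand_eq_zero hKc hb.3 hy hq
  have hF := integrable_inner_prod hK hS hS.measurableSet (hS.measure_lt_top (μ := volume)).ne hgi hΩ h0
  have hm (q : ℝ × E) : ∫ y, inner ℝ (K.indicator g y) (Ω (y, q)) = a q.2 * m q := by
    simp only [m, hΩdef]
    rw [← integral_const_mul]
    refine integral_congr_ae (Eventually.of_forall fun y => ?_)
    simp only [inner_smul_right]
    ring
  have hmi := hF.integral_prod_right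
  simp_rw [hm] at hmi
  have hvol : (volume : Measure (ℝ × E)).restrict S =
      ((volume : Measure ℝ).restrict (Icc 0 1)).prod (volume.restrict K) := by
    rw [Measure.prod_restrict]; rfl
  constructor
  · rw [← integrableOn_iff_integrable_of_support_subset (s := K)]
    · rw [hvol] at hmi
      refine hmi.integral_prod_right.congr (Eventually.of_forall fun x => ?_)
      simp only
      rw [integral_const_mul]
    · exact (Function.support_mul_subset_left _ _).trans ((subset_tsupport a).trans ha.3)
  · rw [show (∫ x in K, inner ℝ (g x) (transportField K b a x)) =
        ∫ y in K, inner ℝ (g y) (∫ q in S, Ω (y, q)) from rfl,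
      setIntegral_inner_integral hK hS hS.measurableSet (hS.measure_lt_top (μ := volume)).ne hgi
        (EventuallyEq.refl _ _) hΩ h0]
    simp_rw [hm]
    rw [hvol] at hmi ⊢
    rw [integral_prod_symm _ hmi]
    simp only
    simp_rw [integral_const_mul]
    refine setIntegral_eq_integral_of_forall_compl_eq_zero fun x hx => ?_
    rw [image_eq_zero_of_notMem_tsupport fun h => hx (ha.3 h), zero_mul]

/-- The identity of `integral_mul_sub` with a fixed unit bump `b` reads `Λ a = (∫ a) Λ b + ∫ g · W`,
and the last term has a density by the two preceding lemmas. -/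
theorem IsGradFunctional.exists_integral_eq (h : IsGradFunctional D Λ g)
    (hg : LocallyIntegrableOn g D) (hn : 0 < finrank ℝ E) {c : E} {R : ℝ} (hR : 0 < R)
    (hD : closedBall c R ⊆ D) :
    ∃ V : E → ℝ, IntegrableOn V (closedBall c (R / 2)) ∧
      ∀ a, IsTest (closedBall c R) a → Λ a = ∫ x, V x * a x := by
  set K := closedBall c R
  have hK : IsCompact K := isCompact_closedBall c R
  have hKc : Convex ℝ K := convex_closedBall c R
  have hgK : IntegrableOn g K := hg.integrableOn_compact_subset hD hK
  have hb : IsTest K fun x : E => mollifier R (x - c) := isTest_mollifier_sub Subset.rfl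
  set b := fun x : E => mollifier R (x - c)
  obtain ⟨V₁, hV₁⟩ := exists_integral_inner_transportField_left hK hKc hb.1 hgK
  obtain ⟨V₂, hV₂⟩ := exists_integral_inner_transportField_right hK hKc hb hgK
  have hint (a) (ha : IsTest K a) :
      Integrable fun x => (Λ b + V₁ x - V₂ x) * a x := by
    have := ((ha.integrable.mul_const (Λ b)).add (hV₁ a ha).1).sub (hV₂ a ha).1
    refine this.congr (Eventually.of_forall fun x => ?_)
    simp only [Pi.add_apply, Pi.sub_apply]
    ring
  refine ⟨fun x => Λ b + V₁ x - V₂ x, ?_, fun a ha => ?_⟩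
  -- Only the products of the density with test functions are known to be integrable. A bump equal
  -- to `1` on the half ball yields integrability of the density there.
  · let f : ContDiffBump c := ⟨R / 2, R, half_pos hR, half_lt_self hR⟩
    have hf : IsTest K f := ⟨f.contDiff, f.hasCompactSupport, f.tsupport_eq.subset⟩
    refine ((hint f hf).integrableOn (s := closedBall c (R / 2))).congr_fun (fun x hx => ?_)
      measurableSet_closedBall
    simp only [f.one_of_mem_closedBall hx, mul_one]
  · have h1 := h.integral_mul_sub hg hn hK hKc hD ha hb
    have hWa := contDiff_transportField hK ha.1 hb.1
    have hWb := contDiff_transportField hK hb.1 ha.1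
    have hi {W : E → E} (hW : ContDiff ℝ ∞ W) : Integrable (fun x => inner ℝ (g x) (W x))
        (volume.restrict K) := by
      obtain ⟨B, hB⟩ := hK.exists_bound_of_continuousOn hW.continuous.continuousOn
      refine (hgK.norm.mul_const B).mono'
        (hgK.aestronglyMeasurable.inner hW.continuous.aestronglyMeasurable) ?_
      filter_upwards [ae_restrict_mem hK.measurableSet] with x hx
      exact (norm_inner_le_norm _ _).trans (by gcongr; exact hB x hx)
    simp_rw [inner_sub_right] at h1
    rw [integral_sub (hi hWa) (hi hWb), (hV₁ a ha).2, (hV₂ a ha).2,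
      integral_mollifier_sub hR c, one_mul] at h1
    have h2 : ∫ x, (Λ b + V₁ x - V₂ x) * a x =
        (∫ x, a x * Λ b) + (∫ x, a x * V₁ x) - ∫ x, a x * V₂ x := by
      have h3 := integral_add (ha.integrable.mul_const (Λ b)) (hV₁ a ha).1
      have h4 := integral_sub ((ha.integrable.mul_const (Λ b)).add (hV₁ a ha).1) (hV₂ a ha).1
      simp only [Pi.add_apply] at h4
      rw [← h3, ← h4]
      exact integral_congr_ae (Eventually.of_forall fun x => by ring)
    rw [h2, integral_mul_const]
    linarith

end Means

/-! ### Global representation by functions -/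

section Representation

variable {D : Set E} {Λ : (E → ℝ) → ℝ} {g : E → E}

theorem tendsto_half_pow : Tendsto (fun k : ℕ => (1 / 2 : ℝ) ^ k) atTop (𝓝 0) :=
  tendsto_pow_atTop_nhds_zero_of_lt_one (by norm_num) (by norm_num)

/-- By Lebesgue differentiation, a local density is recovered almost everywhere from `Λ` alone. The
formula does not mention the ball, so the densities of different balls need not be glued by hand. -/
theorem ae_eq_limUnder_of_integral_eq {V : E → ℝ} {c : E} {ρ : ℝ}
    (hV : IntegrableOn V (closedBall c ρ))
    (hΛ : ∀ a, IsTest (closedBall c ρ) a → Λ a = ∫ x, V x * a x) :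
    ∀ᵐ x, x ∈ ball c ρ →
      limUnder atTop (fun k : ℕ => Λ fun y => mollifier ((1 / 2 : ℝ) ^ k) (y - x)) = V x := by
  have hVi : Integrable ((closedBall c ρ).indicator V) :=
    hV.integrable_indicator measurableSet_closedBall
  filter_upwards [ae_tendsto_integral_mul_mollifier hVi.locallyIntegrable
    (fun k => by positivity : ∀ k : ℕ, 0 < (1 / 2 : ℝ) ^ k) tendsto_half_pow] with x hx hxc
  rw [indicator_of_mem (ball_subset_closedBall hxc)] at hx
  refine (hx.congr' ?_).limUnder_eq
  have h1 : ∀ᶠ k : ℕ in atTop, (1 / 2 : ℝ) ^ k < ρ - dist x c :=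
    tendsto_half_pow.eventually (gt_mem_nhds (by linarith [mem_ball.1 hxc]))
  filter_upwards [h1] with k hk
  have h2 : closedBall x ((1 / 2 : ℝ) ^ k) ⊆ closedBall c ρ :=
    closedBall_subset_closedBall' (by linarith)
  have h3 := isTest_mollifier_sub h2
  rw [hΛ _ h3]
  refine integral_congr_ae (Eventually.of_forall fun y => ?_)
  by_cases hy : y ∈ closedBall c ρ
  · simp [hy]
  · have h4 : mollifier ((1 / 2 : ℝ) ^ k) (y - x) = 0 :=
      image_eq_zero_of_notMem_tsupport (f := fun y => mollifier ((1 / 2 : ℝ) ^ k) (y - x))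
        fun h => hy (h3.3 h)
    simp only [h4, mul_zero]

theorem IsTest.exists_sum {ι : Type} {U : ι → Set E} (hU : ∀ i, IsOpen (U i)) {ψ : E → ℝ}
    (hψ : IsTest (⋃ i, U i) ψ) :
    ∃ (s : Finset ι) (f : ι → E → ℝ), (∀ i, IsTest (U i) (f i)) ∧ ψ = fun x => ∑ i ∈ s, f i x := by
  obtain ⟨f, hf⟩ := SmoothPartitionOfUnity.exists_isSubordinate (modelWithCornersSelf ℝ E)
    (isClosed_tsupport ψ) U hU hψ.3
  have hfin := f.locallyFinite.finite_nonempty_inter_compact hψ.2.isCompact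
  refine ⟨hfin.toFinset, fun i x => f i x * ψ x, fun i => ?_, ?_⟩
  · have hc : IsCompact (tsupport (f i) ∩ tsupport ψ) :=
      hψ.2.isCompact.inter_left (isClosed_tsupport _)
    refine IsTest.of_subset_compact hc (inter_subset_left.trans (hf i))
      ((f i).contMDiff.contDiff.mul hψ.1) fun x hx => ?_
    beta_reduce
    by_cases h1 : x ∈ tsupport (f i)
    · rw [image_eq_zero_of_notMem_tsupport (f := ψ) fun h => hx ⟨h1, h⟩, mul_zero]
    · rw [image_eq_zero_of_notMem_tsupport h1, zero_mul]
  · funext x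
    by_cases hx : x ∈ tsupport ψ
    · rw [← Finset.sum_mul]
      have h1 := f.sum_eq_one hx
      rw [finsum_eq_sum_of_support_subset (s := hfin.toFinset)] at h1
      · rw [h1, one_mul]
      · intro i hi
        simp only [Finite.coe_toFinset, mem_ofPred_eq]
        exact ⟨x, hi, hx⟩
    · simp [image_eq_zero_of_notMem_tsupport hx]

theorem IsGradFunctional.exists_locallyIntegrableOn (h : IsGradFunctional D Λ g)
    (hg : LocallyIntegrableOn g D) (hn : 0 < finrank ℝ E) (hD : IsOpen D) :
    ∃ u : E → ℝ, LocallyIntegrableOn u D ∧ ∀ a, IsTest D a → Λ a = ∫ x, u x * a x := by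
  have hR : ∀ c : D, ∃ R, 0 < R ∧ closedBall (c : E) R ⊆ D := fun c =>
    nhds_basis_closedBall.mem_iff.1 (hD.mem_nhds c.2)
  choose R hR0 hRD using hR
  choose V hV hΛV using fun c : D => h.exists_integral_eq hg hn (hR0 c) (hRD c)
  set u : E → ℝ := fun x =>
    limUnder atTop (fun k : ℕ => Λ fun y => mollifier ((1 / 2 : ℝ) ^ k) (y - x)) with hu
  have hle (c : D) : R c / 2 ≤ R c := (half_lt_self (hR0 c)).le
  have hae (c : D) : ∀ᵐ x, x ∈ ball (c : E) (R c / 2) → u x = V c x :=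
    ae_eq_limUnder_of_integral_eq (hV c) fun a ha =>
      hΛV c a (ha.mono (closedBall_subset_closedBall (hle c)))
  refine ⟨u, fun c hc => ?_, fun a ha => ?_⟩
  · refine ⟨ball c (R ⟨c, hc⟩ / 2), mem_nhdsWithin_of_mem_nhds
      (ball_mem_nhds c (half_pos (hR0 _))), ?_⟩
    refine ((hV ⟨c, hc⟩).mono_set ball_subset_closedBall).congr ?_
    rw [EventuallyEq, ae_restrict_iff' measurableSet_ball]
    filter_upwards [hae ⟨c, hc⟩] with x hx hxc using (hx hxc).symm
  · have hcov : D ⊆ ⋃ c : D, ball (c : E) (R c / 2) := fun c hc =>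
      mem_iUnion.2 ⟨⟨c, hc⟩, mem_ball_self (half_pos (hR0 _))⟩
    obtain ⟨s, f, hf, rfl⟩ := (ha.mono hcov).exists_sum fun c => isOpen_ball
    have hfD (c : D) : IsTest D (f c) := (hf c).mono ((ball_subset_closedBall.trans
      (closedBall_subset_closedBall (hle c))).trans (hRD c))
    have heq (c : D) : (fun x => V c x * f c x) =ᵐ[volume] fun x => u x * f c x := by
      filter_upwards [hae c] with x hx
      by_cases hxc : x ∈ ball (c : E) (R c / 2)
      · rw [hx hxc]
      · rw [image_eq_zero_of_notMem_tsupport fun h => hxc ((hf c).3 h), mul_zero, mul_zero]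
    have hint (c : D) : Integrable fun x => u x * f c x := by
      refine Integrable.congr ?_ (heq c)
      rw [← integrableOn_iff_integrable_of_support_subset (s := closedBall (c : E) (R c / 2))]
      · exact (hV c).mul_continuousOn (hf c).continuous.continuousOn (isCompact_closedBall _ _)
      · exact (Function.support_mul_subset_right _ _).trans
          ((subset_tsupport _).trans ((hf c).3.trans ball_subset_closedBall))
    rw [h.map_sum fun c _ => hfD c]
    simp_rw [Finset.mul_sum]
    rw [integral_finsetSum _ fun c _ => hint c]
    refine Finset.sum_congr rfl fun c _ => ?_
    rw [hΛV c _ ((hf c).mono (ball_subset_closedBall.trans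
      (closedBall_subset_closedBall (hle c)))), integral_congr_ae (heq c)]

end Representation

/-! ### Weak gradients -/

/-- `g` is the weak gradient of `u` on `D`. -/
structure IsWeakGradient (D : Set E) (u : E → ℝ) (g : E → E) : Prop where
  locallyIntegrableOn : LocallyIntegrableOn u D
  locallyIntegrableOn_gradient : LocallyIntegrableOn g D
  integral_fderiv : ∀ (v : E) ψ, IsTest D ψ →
    ∫ x, u x * fderiv ℝ ψ x v = -∫ x, inner ℝ (g x) v * ψ x

theorem MeasureTheory.LocallyIntegrableOn.integrable_mul_isTest {D : Set E} {u : E → ℝ}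
    (hu : LocallyIntegrableOn u D) {ψ : E → ℝ} (hψ : IsTest D ψ) :
    Integrable fun x => u x * ψ x := by
  rw [← integrableOn_iff_integrable_of_support_subset (s := tsupport ψ)]
  · exact (hu.integrableOn_compact_subset hψ.3 hψ.2.isCompact).mul_continuousOn
      hψ.continuous.continuousOn hψ.2.isCompact
  · exact (Function.support_mul_subset_right _ _).trans (subset_tsupport _)

theorem IsWeakGradient.isGradFunctional {D : Set E} {u : E → ℝ} {g : E → E}
    (h : IsWeakGradient D u g) : IsGradFunctional D (fun ψ => ∫ x, u x * ψ x) g where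
  map_add ψ χ hψ hχ := by
    simp_rw [mul_add]
    exact integral_add (h.1.integrable_mul_isTest hψ) (h.1.integrable_mul_isTest hχ)
  map_smul c ψ _ := by
    simp_rw [mul_left_comm]
    exact integral_const_mul _ _
  map_fderiv := h.3

/-! ### Mollification in `L¹` -/

section Mollification

/-- Scheffé's lemma. Write `|F - f| = (F - f) + 2 (f - F)⁺`: the first term integrates to zero and
the second is dominated by `2 f`. -/
theorem tendsto_integral_abs_sub_of_integral_eq {X : Type*} [MeasurableSpace X] {μ : Measure X}
    {F : ℕ → X → ℝ} {f : X → ℝ} (hF : ∀ k, Integrable (F k) μ) (hf : Integrable f μ)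
    (hF0 : ∀ k x, 0 ≤ F k x) (hf0 : ∀ x, 0 ≤ f x)
    (hlim : ∀ᵐ x ∂μ, Tendsto (fun k => F k x) atTop (𝓝 (f x)))
    (hint : ∀ k, ∫ x, F k x ∂μ = ∫ x, f x ∂μ) :
    Tendsto (fun k => ∫ x, |F k x - f x| ∂μ) atTop (𝓝 0) := by
  have h1 : Tendsto (fun k => ∫ x, max (f x - F k x) 0 ∂μ) atTop (𝓝 (∫ _, (0 : ℝ) ∂μ)) := by
    refine tendsto_integral_of_dominated_convergence f
      (fun k => ((hf.sub (hF k)).pos_part).aestronglyMeasurable) hf (fun k => ?_) ?_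
    · refine Eventually.of_forall fun x => ?_
      rw [Real.norm_of_nonneg (le_max_right _ _)]
      exact max_le (by linarith [hF0 k x]) (hf0 x)
    · filter_upwards [hlim] with x hx
      have : Tendsto (fun k => max (f x - F k x) 0) atTop (𝓝 (max (f x - f x) 0)) :=
        (tendsto_const_nhds.sub hx).max tendsto_const_nhds
      simpa using this
  have h2 (k) : ∫ x, |F k x - f x| ∂μ = 2 * ∫ x, max (f x - F k x) 0 ∂μ := by
    have h3 : ∫ x, |F k x - f x| ∂μ = ∫ x, ((F k x - f x) + 2 * max (f x - F k x) 0) ∂μ := by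
      refine integral_congr_ae (Eventually.of_forall fun x => ?_)
      simp only
      rcases le_total (f x) (F k x) with h | h
      · rw [max_eq_right (by linarith), abs_of_nonneg (by linarith)]; ring
      · rw [max_eq_left (by linarith), abs_of_nonpos (by linarith)]; ring
    have h4 := integral_add ((hF k).sub hf) (((hf.sub (hF k)).pos_part).const_mul 2)
    have h5 := integral_sub (hF k) hf
    simp only [Pi.sub_apply] at h4
    rw [h3, h4, h5, hint, sub_self, zero_add, integral_const_mul]
  simp_rw [h2]
  simpa using h1.const_mul 2

open ContinuousLinearMap (mul)

theorem hasCompactSupport_mollifier (r : ℝ) : HasCompactSupport (mollifier r : E → ℝ) :=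
  HasCompactSupport.intro (isCompact_closedBall 0 r) fun x hx => mollifier_eq_zero (by
    simpa using hx)

theorem integrable_mollifier (r : ℝ) : Integrable (mollifier r : E → ℝ) :=
  (contDiff_mollifier r).continuous.integrable_of_hasCompactSupport (hasCompactSupport_mollifier r)

theorem convolution_mollifier_apply (u : E → ℝ) (r : ℝ) (x : E) :
    convolution u (mollifier r) (mul ℝ ℝ) volume x = ∫ y, u y * mollifier r (y - x) := by
  refine integral_congr_ae (Eventually.of_forall fun y => ?_)
  simp only [ContinuousLinearMap.mul_apply']
  rw [← mollifier_neg, neg_sub]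

theorem tendsto_integral_abs_convolution_sub {u : E → ℝ} (hu : Integrable u) {r : ℕ → ℝ}
    (hr : ∀ k, 0 < r k) (hr0 : Tendsto r atTop (𝓝 0)) :
    Tendsto (fun k => ∫ x, |convolution u (mollifier (r k)) (mul ℝ ℝ) volume x - u x|)
      atTop (𝓝 0) := by
  -- Mollification preserves the integral, so Scheffé's lemma applies to nonnegative functions. The
  -- general case follows by splitting into positive and negative parts.
  have key {w : E → ℝ} (hw : Integrable w) (hw0 : ∀ x, 0 ≤ w x) :
      Tendsto (fun k => ∫ x, |convolution w (mollifier (r k)) (mul ℝ ℝ) volume x - w x|)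
        atTop (𝓝 0) := by
    refine tendsto_integral_abs_sub_of_integral_eq
      (fun k => hw.integrable_convolution _ (integrable_mollifier _)) hw (fun k x => ?_) hw0 ?_ ?_
    · exact integral_nonneg fun y => mul_nonneg (hw0 _) (mollifier_nonneg _ _)
    · simp_rw [convolution_mollifier_apply]
      exact ae_tendsto_integral_mul_mollifier hw.locallyIntegrable hr hr0
    · intro k
      rw [integral_convolution _ hw (integrable_mollifier _), integral_mollifier (hr k)]
      simp
  have hp := key hu.pos_part fun x => le_max_right _ _
  have hm := key hu.neg_part fun x => le_max_right _ _
  have hsum := hp.add hm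
  rw [add_zero] at hsum
  refine squeeze_zero (fun k => integral_nonneg fun x => abs_nonneg _) (fun k => ?_) hsum
  have hpi := hu.pos_part.integrable_convolution (mul ℝ ℝ) (integrable_mollifier (E := E) (r k))
  have hmi := hu.neg_part.integrable_convolution (mul ℝ ℝ) (integrable_mollifier (E := E) (r k))
  have hadd := integral_add (hpi.sub hu.pos_part).abs (hmi.sub hu.neg_part).abs
  simp only [Pi.sub_apply] at hadd
  rw [← hadd]
  refine integral_mono
    ((hu.integrable_convolution _ (integrable_mollifier _)).sub hu).abs
    ((hpi.sub hu.pos_part).abs.add (hmi.sub hu.neg_part).abs) fun x => ?_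
  have h1 : convolution u (mollifier (r k)) (mul ℝ ℝ) volume x =
      convolution (fun x => max (u x) 0) (mollifier (r k)) (mul ℝ ℝ) volume x -
      convolution (fun x => max (-u x) 0) (mollifier (r k)) (mul ℝ ℝ) volume x := by
    have hb (w : E → ℝ) (hw : Integrable w) :
        Integrable fun t => w t * mollifier (r k) (x - t) := by
      obtain ⟨B, hB⟩ := (contDiff_mollifier (E := E) (r k)).continuous.bounded_above_of_compact_support
        (hasCompactSupport_mollifier (r k))
      exact hw.mul_bdd ((contDiff_mollifier (r k)).continuous.comp
        (by fun_prop)).aestronglyMeasurable (Eventually.of_forall fun t => hB _)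
    simp only [convolution, ContinuousLinearMap.mul_apply']
    rw [← integral_sub (hb _ hu.pos_part) (hb _ hu.neg_part)]
    refine integral_congr_ae (Eventually.of_forall fun t => ?_)
    simp only
    rw [← sub_mul]
    congr 1
    rcases le_total (u t) 0 with h | h
    · rw [max_eq_right h, max_eq_left (by linarith)]; ring
    · rw [max_eq_left h, max_eq_right (by linarith)]; ring
  have h2 : u x = max (u x) 0 - max (-u x) 0 := by
    rcases le_total (u x) 0 with h | h
    · rw [max_eq_right h, max_eq_left (by linarith)]; ring
    · rw [max_eq_left h, max_eq_right (by linarith)]; ring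
  simp only
  rw [h1]
  conv_lhs => rw [h2]
  refine le_trans (le_of_eq ?_) (abs_sub _ _)
  congr 1
  ring

theorem fderiv_convolution_mollifier {u : E → ℝ} (hu : Integrable u) (r : ℝ) (x v : E) :
    fderiv ℝ (convolution u (mollifier r) (mul ℝ ℝ) volume) x v =
      ∫ y, u y * fderiv ℝ (mollifier r) (x - y) v := by
  have h := (hasCompactSupport_mollifier (E := E) r).hasFDerivAt_convolution_right (mul ℝ ℝ)
    hu.locallyIntegrable ((contDiff_mollifier r).of_le (by simp)) x
  rw [h.fderiv, convolution_precompR_apply (mul ℝ ℝ) hu.locallyIntegrable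
    ((hasCompactSupport_mollifier r).fderiv ℝ)
    ((contDiff_mollifier r).continuous_fderiv (by simp))]
  rfl

end Mollification

/-! ### The chain rule -/

section ChainRule

open ContinuousLinearMap (mul)

variable {D : Set E} {u : E → ℝ} {g : E → E}

/-- The mollified value at `x` only involves the ball of radius `r` around `x`. As that ball lies in
`K`, cutting off outside `K` changes nothing. -/
theorem IsWeakGradient.fderiv_convolution (h : IsWeakGradient D u g) {K : Set E}
    (hK : IsCompact K) (hKD : K ⊆ D) {r : ℝ} {x : E} (hx : closedBall x r ⊆ K) (v : E) :
    fderiv ℝ (convolution (K.indicator u) (mollifier r) (mul ℝ ℝ) volume) x v =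
      convolution (fun y => inner ℝ (K.indicator g y) v) (mollifier r) (mul ℝ ℝ) volume x := by
  have hui : Integrable (K.indicator u) :=
    (h.1.integrableOn_compact_subset hKD hK).integrable_indicator hK.measurableSet
  have ht := isTest_mollifier_sub (hx)
  rw [fderiv_convolution_mollifier hui, convolution_mollifier_apply]
  have hd (y : E) : fderiv ℝ (fun y => mollifier r (y - x)) y v =
      -fderiv ℝ (mollifier r) (x - y) v := by
    have h1 : (fun y : E => mollifier r (y - x)) = fun y => mollifier r (x - y) := by
      funext y; rw [← mollifier_neg, neg_sub]
    rw [h1]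
    have h2 : HasFDerivAt (mollifier r) (fderiv ℝ (mollifier r) (x - y)) (x - y) :=
      ((contDiff_mollifier r).differentiable (by simp)).differentiableAt.hasFDerivAt
    have h3 : HasFDerivAt (fun y => x - y) (-ContinuousLinearMap.id ℝ E) y :=
      (hasFDerivAt_id y).const_sub x
    have h4 : HasFDerivAt (fun y => mollifier r (x - y)) _ y := h2.comp y h3
    rw [h4.fderiv]
    simp
  have h4 := h.3 v _ (ht.mono hKD)
  simp_rw [hd, mul_neg] at h4
  rw [integral_neg, neg_inj] at h4
  have hz (y : E) (hy : y ∉ K) : mollifier r (y - x) = 0 :=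
    image_eq_zero_of_notMem_tsupport (f := fun y => mollifier r (y - x)) fun h => hy (ht.3 h)
  have hz' (y : E) (hy : y ∉ K) : fderiv ℝ (mollifier r) (x - y) v = 0 := by
    have := image_eq_zero_of_notMem_tsupport (f := fun y => fderiv ℝ (fun y => mollifier r (y - x)) y v)
      (x := y) fun h => hy ((ht.fderiv_apply v).3 h)
    simpa [hd] using this
  calc ∫ y, K.indicator u y * fderiv ℝ (mollifier r) (x - y) v
      = ∫ y, u y * fderiv ℝ (mollifier r) (x - y) v := by
        refine integral_congr_ae (Eventually.of_forall fun y => ?_)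
        by_cases hy : y ∈ K
        · simp [hy]
        · simp [hz' y hy]
    _ = ∫ y, inner ℝ (g y) v * mollifier r (y - x) := h4
    _ = _ := by
        refine integral_congr_ae (Eventually.of_forall fun y => ?_)
        by_cases hy : y ∈ K
        · simp [hy]
        · simp [hz y hy]

theorem IsWeakGradient.integral_comp_mul_fderiv (h : IsWeakGradient D u g) (hD : IsOpen D)
    {F : ℝ → ℝ} (hF : ContDiff ℝ 1 F) {B : ℝ} (hFB : ∀ t, |F t| ≤ B) (hdB : ∀ t, |deriv F t| ≤ B)
    (v : E) {ψ : E → ℝ} (hψ : IsTest D ψ) :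
    ∫ x, F (u x) * fderiv ℝ ψ x v = -∫ x, deriv F (u x) * inner ℝ (g x) v * ψ x := by
  obtain ⟨ε, hε, hεD⟩ := hψ.2.isCompact.exists_cthickening_subset_open hD hψ.3
  -- Thickening the support by `ε` makes all mollifications of radius at most `ε` compatible with
  -- the cutoff on the support of `ψ`.
  set K := cthickening ε (tsupport ψ) with hKdef
  have hK : IsCompact K := hψ.2.isCompact.cthickening
  have hψK : tsupport ψ ⊆ K := self_subset_cthickening _
  have hB0 : 0 ≤ B := (abs_nonneg _).trans (hFB 0)
  have hui : Integrable (K.indicator u) :=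
    (h.1.integrableOn_compact_subset hεD hK).integrable_indicator hK.measurableSet
  have hgi : Integrable fun y => inner ℝ (K.indicator g y) v :=
    ((h.2.integrableOn_compact_subset hεD hK).integrable_indicator hK.measurableSet).inner_const v
  set r : ℕ → ℝ := fun k => ε * (1 / 2 : ℝ) ^ k with hrdef
  have hr (k) : 0 < r k := by positivity
  have hrε (k) : r k ≤ ε :=
    mul_le_of_le_one_right hε.le (pow_le_one₀ (by norm_num) (by norm_num))
  have hr0 : Tendsto r atTop (𝓝 0) := by
    have := tendsto_half_pow.const_mul ε
    rwa [mul_zero] at this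
  set U : ℕ → E → ℝ := fun k => convolution (K.indicator u) (mollifier (r k)) (mul ℝ ℝ) volume
  set G : ℕ → E → ℝ := fun k =>
    convolution (fun y => inner ℝ (K.indicator g y) v) (mollifier (r k)) (mul ℝ ℝ) volume
  have hUc (k) : ContDiff ℝ 1 (U k) :=
    (hasCompactSupport_mollifier (r k)).contDiff_convolution_right (n := 1) (mul ℝ ℝ)
      hui.locallyIntegrable ((contDiff_mollifier (r k)).of_le (by simp))
  have hGi (k) : Integrable (G k) := hgi.integrable_convolution _ (integrable_mollifier _)
  have hGd (k) (x) (hx : x ∈ tsupport ψ) : fderiv ℝ (U k) x v = G k x :=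
    h.fderiv_convolution hK hεD ((closedBall_subset_closedBall (hrε k)).trans
      (closedBall_subset_cthickening hx ε)) v
  have hUae : ∀ᵐ x, Tendsto (fun k => U k x) atTop (𝓝 (K.indicator u x)) := by
    simp only [U, convolution_mollifier_apply]
    exact ae_tendsto_integral_mul_mollifier hui.locallyIntegrable hr hr0
  have hFd : Continuous (deriv F) := hF.continuous_deriv_one
  have hdψ := hψ.fderiv_apply v
  obtain ⟨M, hM⟩ := hψ.continuous.bounded_above_of_compact_support hψ.2
  have hM0 : 0 ≤ M := (norm_nonneg _).trans (hM 0)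
  have hstep (k) : ∫ x, F (U k x) * fderiv ℝ ψ x v = -∫ x, deriv F (U k x) * G k x * ψ x := by
    have hFU : ContDiff ℝ 1 fun x => F (U k x) := hF.comp (hUc k)
    have hd (x) : fderiv ℝ (fun x => F (U k x)) x v = deriv F (U k x) * fderiv ℝ (U k) x v := by
      have h1 : HasFDerivAt (U k) (fderiv ℝ (U k) x) x :=
        ((hUc k).differentiable one_ne_zero).differentiableAt.hasFDerivAt
      have h2 : HasDerivAt F (deriv F (U k x)) (U k x) :=
        (hF.differentiable one_ne_zero).differentiableAt.hasDerivAt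
      have h3 : HasFDerivAt (fun x => F (U k x)) _ x := h2.comp_hasFDerivAt x h1
      rw [h3.fderiv]
      simp
    have h1 := integral_mul_fderiv_eq_neg_fderiv_mul_of_integrable (μ := (volume : Measure E))
      (f := fun x => F (U k x)) (g := ψ) (v := v) ?_ ?_ ?_ ?_ ?_
    · rw [h1]
      congr 1
      refine integral_congr_ae (Eventually.of_forall fun x => ?_)
      by_cases hx : x ∈ tsupport ψ
      · simp only [hd, hGd k x hx]
      · simp [image_eq_zero_of_notMem_tsupport hx]
    · exact Continuous.integrable_of_hasCompactSupport
        (((hFU.continuous_fderiv one_ne_zero).clm_apply continuous_const).mul hψ.continuous)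
        hψ.2.mul_left
    · exact Continuous.integrable_of_hasCompactSupport
        (hFU.continuous.mul hdψ.continuous) hdψ.2.mul_left
    · exact Continuous.integrable_of_hasCompactSupport
        (hFU.continuous.mul hψ.continuous) hψ.2.mul_left
    · exact fun x _ => (hFU.differentiable one_ne_zero).differentiableAt
    · exact fun x _ => (hψ.1.differentiable (by simp)).differentiableAt
  have hL : Tendsto (fun k => ∫ x, F (U k x) * fderiv ℝ ψ x v) atTop
      (𝓝 (∫ x, F (K.indicator u x) * fderiv ℝ ψ x v)) := by
    refine tendsto_integral_of_dominated_convergence (fun x => B * ‖fderiv ℝ ψ x v‖)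
      (fun k => ((hF.continuous.comp (hUc k).continuous).mul
        hdψ.continuous).aestronglyMeasurable) (hdψ.integrable.norm.const_mul B) (fun k => ?_) ?_
    · refine Eventually.of_forall fun x => ?_
      rw [norm_mul]
      gcongr
      exact hFB _
    · filter_upwards [hUae] with x hx
      exact ((hF.continuous.tendsto _).comp hx).mul_const _
  have hR : Tendsto (fun k => ∫ x, deriv F (U k x) * G k x * ψ x) atTop
      (𝓝 (∫ x, deriv F (K.indicator u x) * inner ℝ (K.indicator g x) v * ψ x)) := by
    have hA : Tendsto (fun k => ∫ x, deriv F (U k x) * inner ℝ (K.indicator g x) v * ψ x) atTop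
        (𝓝 (∫ x, deriv F (K.indicator u x) * inner ℝ (K.indicator g x) v * ψ x)) := by
      refine tendsto_integral_of_dominated_convergence
        (fun x => B * ‖inner ℝ (K.indicator g x) v‖ * M) (fun k => ?_)
        ((hgi.norm.const_mul B).mul_const M) (fun k => ?_) ?_
      · exact (((hFd.comp (hUc k).continuous).aestronglyMeasurable).mul
          hgi.aestronglyMeasurable).mul hψ.continuous.aestronglyMeasurable
      · refine Eventually.of_forall fun x => ?_
        rw [norm_mul, norm_mul]
        gcongr
        · exact hdB _
        · exact hM _
      · filter_upwards [hUae] with x hx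
        exact (((hFd.tendsto _).comp hx).mul_const _).mul_const _
    have hbd (k) : AEStronglyMeasurable (fun x => deriv F (U k x) * ψ x) volume :=
      ((hFd.comp (hUc k).continuous).mul hψ.continuous).aestronglyMeasurable
    have hbd' (k) (x) : ‖deriv F (U k x) * ψ x‖ ≤ B * M := by
      rw [norm_mul]
      gcongr
      · exact hdB _
      · exact hM _
    have hi (k) (w : E → ℝ) (hw : Integrable w) :
        Integrable fun x => deriv F (U k x) * w x * ψ x := by
      refine (hw.bdd_mul (hbd k) (Eventually.of_forall (hbd' k))).congr
        (Eventually.of_forall fun x => ?_)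
      simp only
      ring
    -- Both `U k` and `G k` vary with `k`. Replacing `G k` by its limit costs at most `B M` times an
    -- `L¹` norm that tends to zero; the remaining integrals were treated by dominated convergence
    -- in `hA`.
    have hB : Tendsto (fun k => (∫ x, deriv F (U k x) * G k x * ψ x) -
        ∫ x, deriv F (U k x) * inner ℝ (K.indicator g x) v * ψ x) atTop (𝓝 0) := by
      have h1 := (tendsto_integral_abs_convolution_sub hgi hr hr0).const_mul (B * M)
      rw [mul_zero] at h1
      refine squeeze_zero_norm (fun k => ?_) h1
      rw [← integral_sub (hi k _ (hGi k)) (hi k _ hgi), ← integral_const_mul]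
      refine norm_integral_le_of_norm_le (((hGi k).sub hgi).abs.const_mul _)
        (Eventually.of_forall fun x => ?_)
      have h2 : deriv F (U k x) * G k x * ψ x -
          deriv F (U k x) * inner ℝ (K.indicator g x) v * ψ x =
          deriv F (U k x) * ψ x * (G k x - inner ℝ (K.indicator g x) v) := by ring
      rw [h2, norm_mul]
      exact mul_le_mul_of_nonneg_right (hbd' k x) (norm_nonneg _)
    simpa using hB.add hA
  have hlim := tendsto_nhds_unique hL ((hR.neg).congr fun k => (hstep k).symm)
  calc ∫ x, F (u x) * fderiv ℝ ψ x v = ∫ x, F (K.indicator u x) * fderiv ℝ ψ x v := by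
        refine integral_congr_ae (Eventually.of_forall fun x => ?_)
        by_cases hx : x ∈ K
        · simp [hx]
        · simp [image_eq_zero_of_notMem_tsupport (f := fun x => fderiv ℝ ψ x v)
            fun h => hx (hψK (tsupport_fderiv_apply_subset ℝ v h))]
    _ = _ := hlim
    _ = _ := by
        congr 1
        refine integral_congr_ae (Eventually.of_forall fun x => ?_)
        by_cases hx : x ∈ K
        · simp [hx]
        · simp [image_eq_zero_of_notMem_tsupport fun h => hx (hψK h)]

/-- A continuous function which is positive on `Ioo a b`, zero elsewhere and tends to the indicator
of `Ioo a b`. -/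
noncomputable def tent (a b : ℝ) (k : ℕ) (t : ℝ) : ℝ := max 0 (min 1 (k * min (t - a) (b - t)))

theorem continuous_tent (a b : ℝ) (k : ℕ) : Continuous (tent a b k) := by
  unfold tent; fun_prop

theorem tent_nonneg (a b : ℝ) (k : ℕ) (t : ℝ) : 0 ≤ tent a b k t := le_max_left _ _

theorem tent_le_one (a b : ℝ) (k : ℕ) (t : ℝ) : tent a b k t ≤ 1 :=
  max_le zero_le_one (min_le_left _ _)

theorem tent_eq_zero {a b t : ℝ} (k : ℕ) (ht : t ∉ Ioo a b) : tent a b k t = 0 := by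
  have h : min (t - a) (b - t) ≤ 0 := by
    by_contra! h
    exact ht ⟨by linarith [(lt_min_iff.1 h).1], by linarith [(lt_min_iff.1 h).2]⟩
  exact max_eq_left ((min_le_right _ _).trans
    (mul_nonpos_of_nonneg_of_nonpos (Nat.cast_nonneg k) h))

theorem tendsto_tent (a b t : ℝ) :
    Tendsto (fun k => tent a b k t) atTop (𝓝 ((Ioo a b).indicator 1 t)) := by
  by_cases ht : t ∈ Ioo a b
  · rw [indicator_of_mem ht, Pi.one_apply]
    have h : 0 < min (t - a) (b - t) := lt_min (by linarith [ht.1]) (by linarith [ht.2])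
    have h1 : ∀ᶠ k : ℕ in atTop, 1 ≤ k * min (t - a) (b - t) :=
      (tendsto_natCast_atTop_atTop.atTop_mul_const h).eventually_ge_atTop 1
    refine tendsto_const_nhds.congr' ?_
    filter_upwards [h1] with k hk
    simp [tent, min_eq_left hk]
  · simp [tent_eq_zero _ ht, indicator_of_notMem ht]

/-- A `C¹` approximation of the truncation at levels `a` and `b`. -/
noncomputable def smoothTruncation (a b : ℝ) (k : ℕ) (t : ℝ) : ℝ := a + ∫ s in a..t, tent a b k s

theorem hasDerivAt_smoothTruncation (a b : ℝ) (k : ℕ) (t : ℝ) :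
    HasDerivAt (smoothTruncation a b k) (tent a b k t) t :=
  ((continuous_tent a b k).integral_hasStrictDerivAt a t).hasDerivAt.const_add a

theorem deriv_smoothTruncation (a b : ℝ) (k : ℕ) : deriv (smoothTruncation a b k) = tent a b k :=
  funext fun t => (hasDerivAt_smoothTruncation a b k t).deriv

theorem contDiff_smoothTruncation (a b : ℝ) (k : ℕ) : ContDiff ℝ 1 (smoothTruncation a b k) := by
  rw [contDiff_one_iff_deriv, deriv_smoothTruncation]
  exact ⟨fun t => (hasDerivAt_smoothTruncation a b k t).differentiableAt, continuous_tent a b k⟩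

theorem smoothTruncation_eq_clamp {a b : ℝ} (hab : a ≤ b) (k : ℕ) (t : ℝ) :
    smoothTruncation a b k t = smoothTruncation a b k (max a (min t b)) := by
  have hi (c d : ℝ) : IntervalIntegrable (tent a b k) volume c d :=
    (continuous_tent a b k).intervalIntegrable _ _
  unfold smoothTruncation
  rcases le_total t a with h | h
  · have h0 : ∫ s in a..t, tent a b k s = 0 := by
      rw [intervalIntegral.integral_symm, intervalIntegral.integral_congr (g := fun _ => 0)]
      · simp
      · intro s hs
        rw [uIcc_of_le h] at hs
        exact tent_eq_zero k fun h' => absurd hs.2 h'.1.not_ge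
    rw [h0, max_eq_left ((min_le_left _ _).trans h)]
    simp
  · rcases le_total t b with h' | h'
    · rw [min_eq_left h', max_eq_right h]
    · rw [min_eq_right h', max_eq_right hab,
        ← intervalIntegral.integral_add_adjacent_intervals (hi a b) (hi b t)]
      have h0 : ∫ s in b..t, tent a b k s = 0 := by
        rw [intervalIntegral.integral_congr (g := fun _ => 0)]
        · simp
        · intro s hs
          rw [uIcc_of_le h'] at hs
          exact tent_eq_zero k fun h'' => absurd hs.1 h''.2.not_ge
      rw [h0, add_zero]

theorem tendsto_smoothTruncation {a b : ℝ} (hab : a ≤ b) (t : ℝ) :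
    Tendsto (fun k => smoothTruncation a b k t) atTop (𝓝 (max a (min t b))) := by
  simp_rw [smoothTruncation_eq_clamp hab _ t]
  have hc : max a (min t b) ∈ Icc a b := ⟨le_max_left _ _, max_le hab (min_le_right _ _)⟩
  generalize max a (min t b) = c at hc
  have h1 : Tendsto (fun k => ∫ s in a..c, tent a b k s) atTop (𝓝 (∫ _ in a..c, (1 : ℝ))) := by
    refine intervalIntegral.tendsto_integral_filter_of_dominated_convergence (fun _ => 1)
      (Eventually.of_forall fun k => (continuous_tent a b k).aestronglyMeasurable)
      (Eventually.of_forall fun k => Eventually.of_forall fun s _ => ?_)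
      intervalIntegrable_const ?_
    · rw [Real.norm_of_nonneg (tent_nonneg _ _ _ _)]
      exact tent_le_one _ _ _ _
    · have h2 : ∀ᵐ s : ℝ, s ≠ b := by simp [ae_iff]
      filter_upwards [h2] with s hs hsc
      rw [uIoc_of_le hc.1] at hsc
      have h3 := tendsto_tent a b s
      rwa [indicator_of_mem (show s ∈ Ioo a b from
        ⟨hsc.1, lt_of_le_of_ne (hsc.2.trans hc.2) hs⟩)] at h3
  have h2 := h1.const_add a
  simpa [smoothTruncation] using h2

theorem abs_smoothTruncation_le {a b : ℝ} (hab : a ≤ b) (k : ℕ) (t : ℝ) :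
    |smoothTruncation a b k t| ≤ |a| + (b - a) := by
  rw [smoothTruncation_eq_clamp hab]
  have hc : max a (min t b) ∈ Icc a b := ⟨le_max_left _ _, max_le hab (min_le_right _ _)⟩
  generalize max a (min t b) = c at hc
  refine (abs_add_le _ _).trans ?_
  gcongr
  have := intervalIntegral.norm_integral_le_of_norm_le_const (a := a) (b := c) (C := 1)
    (f := tent a b k) fun s _ => by
      rw [Real.norm_of_nonneg (tent_nonneg _ _ _ _)]
      exact tent_le_one _ _ _ _
  rw [one_mul, abs_of_nonneg (by linarith [hc.1])] at this
  exact this.trans (by linarith [hc.2])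

/-- The derivatives of the smooth truncations vanish off `(a, b)` and tend to the indicator of the
open interval. The level sets `{u = a}` and `{u = b}` thus drop out of the gradient without a
separate argument. -/
theorem IsWeakGradient.truncate (h : IsWeakGradient D u g) (hD : IsOpen D) (hu : Measurable u)
    {a b : ℝ} (hab : a ≤ b) :
    IsWeakGradient D (fun x => max a (min (u x) b)) ((u ⁻¹' Ioo a b).indicator g) := by
  have hS : MeasurableSet (u ⁻¹' Ioo a b) := hu measurableSet_Ioo
  refine ⟨?_, ?_, fun v ψ hψ => ?_⟩
  · refine (locallyIntegrableOn_const (max |a| |b|)).mono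
      (measurable_const.max (hu.min measurable_const)).aestronglyMeasurable ?_
    refine Eventually.of_forall fun x => ?_
    rw [Real.norm_eq_abs, Real.norm_of_nonneg ((abs_nonneg a).trans (le_max_left _ _))]
    exact abs_le_max_abs_abs (le_max_left _ _) (max_le hab (min_le_right _ _))
  · intro x hx
    obtain ⟨s, hs, hi⟩ := h.2 x hx
    exact ⟨s, hs, hi.indicator hS⟩
  · have hdψ := hψ.fderiv_apply v
    set B := max (|a| + (b - a)) 1
    have hkey (k) := h.integral_comp_mul_fderiv hD (contDiff_smoothTruncation a b k) (B := B)
      (fun t => (abs_smoothTruncation_le hab k t).trans (le_max_left _ _)) (fun t => by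
        rw [deriv_smoothTruncation, abs_of_nonneg (tent_nonneg _ _ _ _)]
        exact (tent_le_one _ _ _ _).trans (le_max_right _ _)) v hψ
    simp_rw [deriv_smoothTruncation] at hkey
    have hL : Tendsto (fun k => ∫ x, smoothTruncation a b k (u x) * fderiv ℝ ψ x v) atTop
        (𝓝 (∫ x, max a (min (u x) b) * fderiv ℝ ψ x v)) := by
      refine tendsto_integral_of_dominated_convergence (fun x => B * ‖fderiv ℝ ψ x v‖)
        (fun k => ?_) (hdψ.integrable.norm.const_mul B) (fun k => ?_) ?_
      · exact (((contDiff_smoothTruncation a b k).continuous.measurable.comp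
          hu).aestronglyMeasurable).mul hdψ.continuous.aestronglyMeasurable
      · refine Eventually.of_forall fun x => ?_
        rw [norm_mul]
        gcongr
        exact (abs_smoothTruncation_le hab k _).trans (le_max_left _ _)
      · exact Eventually.of_forall fun x => (tendsto_smoothTruncation hab _).mul_const _
    have hgi : Integrable fun x => inner ℝ (g x) v * ψ x := by
      have h1 : LocallyIntegrableOn (fun x => inner ℝ (g x) v) D := fun x hx => by
        obtain ⟨s, hs, hi⟩ := h.2 x hx
        exact ⟨s, hs, hi.inner_const v⟩
      exact h1.integrable_mul_isTest hψ
    have hR : Tendsto (fun k => ∫ x, tent a b k (u x) * inner ℝ (g x) v * ψ x) atTop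
        (𝓝 (∫ x, (Ioo a b).indicator 1 (u x) * inner ℝ (g x) v * ψ x)) := by
      refine tendsto_integral_of_dominated_convergence (fun x => ‖inner ℝ (g x) v * ψ x‖)
        (fun k => ?_) hgi.norm (fun k => ?_) ?_
      · simp_rw [mul_assoc]
        exact (((continuous_tent a b k).measurable.comp hu).aestronglyMeasurable).mul
          hgi.aestronglyMeasurable
      · refine Eventually.of_forall fun x => ?_
        rw [mul_assoc, norm_mul, Real.norm_of_nonneg (tent_nonneg _ _ _ _)]
        exact mul_le_of_le_one_left (norm_nonneg _) (tent_le_one _ _ _ _)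
      · exact Eventually.of_forall fun x => ((tendsto_tent a b _).mul_const _).mul_const _
    rw [tendsto_nhds_unique hL (hR.neg.congr fun k => (hkey k).symm)]
    congr 1
    refine integral_congr_ae (Eventually.of_forall fun x => ?_)
    by_cases hx : u x ∈ Ioo a b
    · have hx' : x ∈ u ⁻¹' Ioo a b := hx
      simp [indicator_of_mem hx, indicator_of_mem hx']
    · have hx' : x ∉ u ⁻¹' Ioo a b := hx
      simp [indicator_of_notMem hx, indicator_of_notMem hx']

end ChainRule

/-! ### Chains of balls along curves -/

section Chain

/-- A greedy choice along the curve. In the application, `f` is the mean over the ball centered at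
the curve point and `c` bounds the change within one step. Separation is what later bounds the
overlap of the balls. -/
theorem exists_separated_chain {X : Type*} [PseudoMetricSpace X] {γ : ℝ → X} {l : ℝ}
    (hγ : ∀ s ∈ Icc 0 l, ∀ t ∈ Icc 0 l, dist (γ s) (γ t) ≤ |s - t|) {ρ : ℝ → ℝ} {ρ₀ : ℝ}
    (hρ₀ : 0 < ρ₀) (hρ : ∀ t ∈ Icc 0 l, ρ₀ ≤ ρ t) {f c : ℝ → ℝ}
    (hf : ∀ s ∈ Icc 0 l, ∀ t ∈ Icc 0 l, dist (γ s) (γ t) ≤ ρ s → |f s - f t| ≤ c s)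
    {s : ℝ} (hs : s ∈ Icc 0 l) :
    ∃ S : Finset ℝ, (∀ t ∈ S, t ∈ Icc s l) ∧ |f s - f l| ≤ ∑ t ∈ S, c t ∧
      ∀ t ∈ S, ∀ t' ∈ S, t < t' → ρ t ≤ dist (γ t) (γ t') := by
  classical
  have main : ∀ m : ℕ, ∀ s ∈ Icc 0 l, l - s ≤ m * ρ₀ →
      ∃ S : Finset ℝ, (∀ t ∈ S, t ∈ Icc s l) ∧ |f s - f l| ≤ ∑ t ∈ S, c t ∧
        ∀ t ∈ S, ∀ t' ∈ S, t < t' → ρ t ≤ dist (γ t) (γ t') := by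
    intro m
    induction m with
    | zero =>
      intro s hs hm
      have : s = l := le_antisymm hs.2 (by simpa using hm)
      exact ⟨∅, by simp, by simp [this], by simp⟩
    | succ m ih =>
      intro s hs hm
      have hll : l ∈ Icc 0 l := ⟨hs.1.trans hs.2, le_rfl⟩
      have hsub : Icc s l ⊆ Icc 0 l := Icc_subset_Icc_left hs.1
      have hcont : ContinuousOn (fun t => dist (γ s) (γ t)) (Icc s l) := by
        refine (LipschitzOnWith.of_dist_le_mul (K := 1) fun t ht t' ht' => ?_).continuousOn
        rw [NNReal.coe_one, one_mul, Real.dist_eq, Real.dist_eq]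
        exact (by simpa [dist_comm] using abs_dist_sub_le (γ t) (γ t') (γ s) :
          |dist (γ s) (γ t) - dist (γ s) (γ t')| ≤ dist (γ t) (γ t')).trans (hγ t (hsub ht) t' (hsub ht'))
      have hA : IsCompact (Icc s l ∩ (fun t => dist (γ s) (γ t)) ⁻¹' Iic (ρ s)) :=
        isCompact_Icc.of_isClosed_subset
          (hcont.preimage_isClosed_of_isClosed isClosed_Icc isClosed_Iic) inter_subset_left
      have hρs : 0 < ρ s := hρ₀.trans_le (hρ s hs)
      -- The next parameter is the last one at which the curve is within `ρ s` of `γ s`. All later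
      -- points are then at distance at least `ρ s`, even if the curve comes back close to itself
      -- before `s'`.
      obtain ⟨s', ⟨hs'1, hs'2⟩, hmax⟩ := hA.exists_isGreatest
        ⟨s, ⟨le_rfl, hs.2⟩, by simpa using hρs.le⟩
      have hs'0 := hsub hs'1
      rcases hs'1.2.eq_or_lt with rfl | hlt
      · exact ⟨{s}, by simpa using hs.2, by simpa using hf s hs s' hll hs'2,
          by simp +contextual⟩
      have hfar : ∀ t ∈ Ioc s' l, ρ s < dist (γ s) (γ t) := fun t ht => by
        by_contra! h
        exact absurd (hmax ⟨⟨hs'1.1.trans ht.1.le, ht.2⟩, h⟩) ht.1.not_ge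
      have hfar' : ρ s ≤ dist (γ s) (γ s') := by
        refine le_of_forall_pos_le_add fun ε hε => ?_
        have ht : min l (s' + ε) ∈ Ioc s' l := ⟨lt_min hlt (by linarith), min_le_left _ _⟩
        have h1 := hγ s' hs'0 _ ⟨hs'0.1.trans ht.1.le, ht.2⟩
        have h2 : |s' - min l (s' + ε)| ≤ ε := by
          rw [abs_sub_comm, abs_of_pos (by linarith [ht.1])]
          linarith [min_le_right l (s' + ε)]
        linarith [hfar _ ht, dist_triangle (γ s) (γ s') (γ (min l (s' + ε)))]
      -- Every step consumes at least `ρ₀` of the remaining parameter length, so the induction on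
      -- `m` terminates.
      have h3 : ρ₀ ≤ s' - s := by
        have := hγ s hs s' hs'0
        rw [abs_sub_comm, abs_of_nonneg (by linarith [hs'1.1])] at this
        linarith [hρ s hs]
      obtain ⟨S, hS1, hS2, hS3⟩ := ih s' hs'0 (by push_cast at hm; linarith)
      have hsS : s ∉ S := fun h => by linarith [(hS1 s h).1]
      refine ⟨insert s S, ?_, ?_, ?_⟩
      · intro t ht
        rcases Finset.mem_insert.1 ht with rfl | ht
        · exact ⟨le_rfl, hs.2⟩
        · exact ⟨hs'1.1.trans (hS1 t ht).1, (hS1 t ht).2⟩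
      · rw [Finset.sum_insert hsS]
        exact (abs_sub_le _ (f s') _).trans (add_le_add (hf s hs s' hs'0 hs'2) hS2)
      · intro t ht t' ht' htt'
        rcases Finset.mem_insert.1 ht with h1 | h1 <;> rcases Finset.mem_insert.1 ht' with h2 | h2
        · exact absurd htt' (by rw [h1, h2]; exact lt_irrefl _)
        · rw [h1]
          rcases (hS1 t' h2).1.eq_or_lt with h | h
          · rwa [← h]
          · exact (hfar t' ⟨h, (hS1 t' h2).2⟩).le
        · linarith [(hS1 t h1).1, hs'1.1]
        · exact hS3 t h1 t' h2 htt'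
  obtain ⟨m, hm⟩ := exists_nat_ge ((l - s) / ρ₀)
  exact main m s hs ((div_le_iff₀ hρ₀).1 hm)

/-- The balls of radius `R / 8` around the points are disjoint and lie in the ball of radius `7 R`
around `y`. The ratio of the radii is `56`. -/
theorem card_le_of_dist_ge {ι : Type*} {S : Finset ι} {z : ι → E} {y : E} {R : ℝ} (hR : 0 < R)
    (hy : ∀ i ∈ S, dist (z i) y ≤ 4 * R)
    (hz : ∀ i ∈ S, ∀ j ∈ S, i ≠ j → R / 2 ≤ dist (z i) (z j)) :
    (S.card : ENNReal) ≤ 56 ^ finrank ℝ E := by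
  have hdisj : (S : Set ι).PairwiseDisjoint fun i => ball (z i) (R / 8) := fun i hi j hj hij =>
    ball_disjoint_ball (by linarith [hz i hi j hj hij])
  have h1 : volume (⋃ i ∈ S, ball (z i) (R / 8)) ≤ volume (ball y (7 * R)) := by
    refine measure_mono (iUnion₂_subset fun i hi => ball_subset_ball' ?_)
    linarith [hy i hi]
  rw [measure_biUnion_finset hdisj fun _ _ => measurableSet_ball] at h1
  simp_rw [Measure.addHaar_ball_of_pos volume _ (by positivity : 0 < R / 8)] at h1
  rw [Measure.addHaar_ball_of_pos volume _ (by positivity : 0 < 7 * R), Finset.sum_const,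
    nsmul_eq_mul, show 7 * R = 56 * (R / 8) by ring, mul_pow, ENNReal.ofReal_mul (by positivity),
    mul_assoc] at h1
  have h2 : ENNReal.ofReal ((R / 8) ^ finrank ℝ E) * volume (ball (0 : E) 1) ≠ 0 :=
    mul_ne_zero (by simp; positivity) (measure_ball_pos _ _ one_pos).ne'
  have h3 : ENNReal.ofReal ((R / 8) ^ finrank ℝ E) * volume (ball (0 : E) 1) ≠ ⊤ :=
    ENNReal.mul_ne_top ENNReal.ofReal_ne_top measure_ball_lt_top.ne
  have h4 := (ENNReal.mul_le_mul_iff_left h2 h3).1 h1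
  refine h4.trans_eq ?_
  rw [ENNReal.ofReal_pow (by norm_num)]
  norm_num

end Chain

theorem ae_tendsto_integral_mul_mollifier_of_locallyIntegrableOn {D : Set E} (hD : IsOpen D)
    {u : E → ℝ} (hu : LocallyIntegrableOn u D) {r : ℕ → ℝ}
    (hr : ∀ k, 0 < r k) (hr0 : Tendsto r atTop (𝓝 0)) :
    ∀ᵐ x, x ∈ D → Tendsto (fun k => ∫ y, u y * mollifier (r k) (y - x)) atTop (𝓝 (u x)) := by
  rw [ae_iff]
  refine measure_null_of_locally_null _ fun c hc => ?_
  simp only [Classical.not_imp, mem_ofPred_eq] at hc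
  obtain ⟨ρ, hρ, hρD⟩ := nhds_basis_closedBall.mem_iff.1 (hD.mem_nhds hc.1)
  have hi : Integrable ((closedBall c ρ).indicator u) :=
    (hu.integrableOn_compact_subset hρD (isCompact_closedBall c ρ)).integrable_indicator
      measurableSet_closedBall
  refine ⟨ball c ρ ∩ {x | ¬ (x ∈ D → Tendsto (fun k => ∫ y, u y * mollifier (r k) (y - x)) atTop
    (𝓝 (u x)))}, inter_mem (mem_nhdsWithin_of_mem_nhds (ball_mem_nhds c hρ))
    self_mem_nhdsWithin, ?_⟩
  have h := ae_tendsto_integral_mul_mollifier hi.locallyIntegrable hr hr0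
  rw [ae_iff] at h
  refine measure_mono_null (fun x hx => ?_) h
  obtain ⟨hxc, hx⟩ := hx
  simp only [mem_ofPred_eq] at hx ⊢
  refine fun hlim => hx fun _ => ?_
  rw [indicator_of_mem (ball_subset_closedBall hxc)] at hlim
  refine hlim.congr' ?_
  have h1 : ∀ᶠ k : ℕ in atTop, r k < ρ - dist x c :=
    hr0.eventually (gt_mem_nhds (by linarith [mem_ball.1 hxc]))
  filter_upwards [h1] with k hk
  refine integral_congr_ae (Eventually.of_forall fun y => ?_)
  by_cases hy : y ∈ closedBall c ρ
  · simp [hy]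
  · have h4 : mollifier (r k) (y - x) = 0 := mollifier_eq_zero (by
      rw [← dist_eq_norm]
      rw [mem_closedBall, not_le] at hy
      linarith [dist_triangle y x c])
    simp only [h4, mul_zero]

/-- The terms at least double and `P` holds on an initial segment, so the sum is at most twice its
last term. The first conjunct is the invariant that drives the induction. -/
theorem sum_ite_le_two_mul {a : ℕ → ENNReal} {P : ℕ → Prop} [DecidablePred P] {T : ENNReal}
    (hP : ∀ j, P (j + 1) → P j) (ha : ∀ j, 2 * a j ≤ a (j + 1)) (hT : ∀ j, P j → a j ≤ T) (k : ℕ) :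
    (P k → ∑ j ∈ Finset.range k, (if P j then a j else 0) ≤ a k) ∧
      ∑ j ∈ Finset.range k, (if P j then a j else 0) ≤ 2 * T := by
  induction k with
  | zero => simp
  | succ k ih =>
    rw [Finset.sum_range_succ]
    have h1 (h : P k) : ∑ j ∈ Finset.range k, (if P j then a j else 0) + a k ≤ 2 * a k := by
      rw [two_mul]
      gcongr
      exact ih.1 h
    refine ⟨fun h => ?_, ?_⟩
    · rw [if_pos (hP k h)]
      exact (h1 (hP k h)).trans (ha k)
    · by_cases h : P k
      · rw [if_pos h]
        exact (h1 h).trans (by gcongr; exact hT k h)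
      · rw [if_neg h, add_zero]
        exact ih.2

theorem ENNReal.inv_pow_le_of_le_mul {a b A : ENNReal} (hA0 : A ≠ 0) (hA : A ≠ ⊤) (h : a ≤ A * b)
    (m : ℕ) : (b ^ m)⁻¹ ≤ A ^ m * (a ^ m)⁻¹ := by
  have h1 : a ^ m ≤ A ^ m * b ^ m := by rw [← mul_pow]; gcongr
  have hAm0 : A ^ m ≠ 0 := pow_ne_zero _ hA0
  have hAm : A ^ m ≠ ⊤ := ENNReal.pow_ne_top hA
  calc (b ^ m)⁻¹ = A ^ m * (A ^ m * b ^ m)⁻¹ := by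
        rw [ENNReal.mul_inv (Or.inl hAm0) (Or.inl hAm), ← mul_assoc,
          ENNReal.mul_inv_cancel hAm0 hAm, one_mul]
    _ ≤ A ^ m * (a ^ m)⁻¹ := by gcongr

/-! ### The pointwise estimate by a modified Riesz potential -/

section Potential

variable (E) in
/-- The constant in the comparison of means of a function over nearby balls. -/
noncomputable def stepConst : ENNReal := ENNReal.ofReal (meanConst E * 3 * 2 ^ finrank ℝ E)

/-- A bound for the difference of the means over nearby balls. -/
noncomputable def stepCost (G : E → E) (z : E) (r : ℝ) : ℝ :=
  meanConst E * (3 * r / (r / 2) ^ finrank ℝ E) * ∫ y in closedBall z (3 * r), ‖G y‖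

/-- The kernel of `stepCost`. -/
noncomputable def stepKernel (z : E) (r : ℝ) (y : E) : ENNReal :=
  (closedBall z (3 * r)).indicator
    (fun _ => stepConst E * (ENNReal.ofReal r ^ (finrank ℝ E - 1))⁻¹) y

/-- The modified Riesz potential of `‖G‖` on `D`. -/
noncomputable def modifiedRiesz (φ : ℝ → ℝ) (D : Set E) (G : E → E) (x : E) : ENNReal :=
  ∫⁻ y in D, ‖G y‖ₑ * (ENNReal.ofReal (φ (dist x y)) ^ (finrank ℝ E - 1))⁻¹

theorem stepCost_nonneg (G : E → E) (z : E) {r : ℝ} (hr : 0 < r) : 0 ≤ stepCost G z r := by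
  have : 0 ≤ ∫ y in closedBall z (3 * r), ‖G y‖ := integral_nonneg fun _ => norm_nonneg _
  have := meanConst_nonneg (E := E)
  unfold stepCost
  positivity

theorem measurable_stepKernel (z : E) (r : ℝ) : Measurable (stepKernel z r) :=
  measurable_const.indicator measurableSet_closedBall

variable {D : Set E} {w : E → ℝ} {G : E → E}

theorem ofReal_stepCost (hn : 0 < finrank ℝ E) (hG : LocallyIntegrableOn G D) {z : E} {r : ℝ}
    (hr : 0 < r) (hD : closedBall z (3 * r) ⊆ D) :
    ENNReal.ofReal (stepCost G z r) = ∫⁻ y in D, ‖G y‖ₑ * stepKernel z r y := by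
  have hi := hG.integrableOn_compact_subset hD (isCompact_closedBall z (3 * r))
  have h1 (y : E) : ‖G y‖ₑ * stepKernel z r y = (closedBall z (3 * r)).indicator
      (fun y => ‖G y‖ₑ * (stepConst E * (ENNReal.ofReal r ^ (finrank ℝ E - 1))⁻¹)) y := by
    unfold stepKernel
    by_cases hy : y ∈ closedBall z (3 * r)
    · simp [hy]
    · simp [hy]
  have hconst : stepConst E * (ENNReal.ofReal r ^ (finrank ℝ E - 1))⁻¹ ≠ ⊤ :=
    ENNReal.mul_ne_top ENNReal.ofReal_ne_top (ENNReal.inv_ne_top.2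
      (pow_ne_zero _ (by simpa using hr)))
  simp_rw [h1]
  rw [setLIntegral_indicator measurableSet_closedBall, inter_eq_left.2 hD,
    lintegral_mul_const' _ _ hconst, stepCost,
    ENNReal.ofReal_mul (by have := meanConst_nonneg (E := E); positivity),
    ofReal_integral_norm_eq_lintegral_enorm hi, mul_comm]
  congr 1
  rw [stepConst, ← ENNReal.ofReal_pow hr.le, ← ENNReal.ofReal_inv_of_pos (by positivity),
    ← ENNReal.ofReal_mul (by have := meanConst_nonneg (E := E); positivity)]
  congr 1
  have h2 : r ^ finrank ℝ E = r ^ (finrank ℝ E - 1) * r := by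
    rw [← pow_succ, Nat.sub_add_cancel hn]
  rw [div_pow, h2]
  field_simp

theorem IsWeakGradient.abs_mean_sub_le_stepCost (h : IsWeakGradient D w G) (hn : 0 < finrank ℝ E)
    {z z' : E} {r r' : ℝ} (hr : 0 < r) (hr' : r / 2 ≤ r') (hz : dist z z' + r' ≤ 3 * r)
    (hD : closedBall z (3 * r) ⊆ D) :
    |(∫ y, w y * mollifier r (y - z)) - ∫ y, w y * mollifier r' (y - z')| ≤ stepCost G z r :=
  h.isGradFunctional.abs_mean_sub_le h.2 hn (half_pos hr) (by linarith) hr' hD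
    (closedBall_subset_closedBall (by linarith))
    (closedBall_subset_closedBall' (by rw [dist_comm]; linarith))

theorem lintegral_stepKernel_le {φ : ℝ → ℝ} {k : E → ENNReal} {B : ENNReal} (hB : B ≠ ⊤) {x : E}
    (hk : ∀ y, k y ≤ B * (ENNReal.ofReal (φ (dist x y)) ^ (finrank ℝ E - 1))⁻¹) :
    ∫⁻ y in D, ‖G y‖ₑ * k y ≤ B * modifiedRiesz φ D G x := by
  rw [modifiedRiesz, ← lintegral_const_mul' _ _ hB]
  refine lintegral_mono fun y => ?_
  rw [mul_left_comm]
  gcongr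
  exact hk y

/-- The total cost of a chain is the integral of `‖G‖` against the sum of the step kernels, so a
pointwise bound for that sum suffices. -/
theorem sum_ofReal_stepCost_le (hn : 0 < finrank ℝ E) (hG : LocallyIntegrableOn G D)
    {ι : Type*} {S : Finset ι} {z : ι → E} {r : ι → ℝ} (hr : ∀ i ∈ S, 0 < r i)
    (hD : ∀ i ∈ S, closedBall (z i) (3 * r i) ⊆ D) {φ : ℝ → ℝ} {B : ENNReal} (hB : B ≠ ⊤) {x : E}
    (hk : ∀ y, ∑ i ∈ S, stepKernel (z i) (r i) y ≤
      B * (ENNReal.ofReal (φ (dist x y)) ^ (finrank ℝ E - 1))⁻¹) :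
    ENNReal.ofReal (∑ i ∈ S, stepCost G (z i) (r i)) ≤ B * modifiedRiesz φ D G x := by
  have hGm : AEMeasurable (fun y => ‖G y‖ₑ) (volume.restrict D) := hG.aestronglyMeasurable.enorm
  rw [ENNReal.ofReal_sum_of_nonneg fun i hi => stepCost_nonneg G (z i) (hr i hi),
    Finset.sum_congr rfl fun i hi => ofReal_stepCost hn hG (hr i hi) (hD i hi),
    ← lintegral_finsetSum' S (f := fun i y => ‖G y‖ₑ * stepKernel (z i) (r i) y) fun i _ => hGm.mul (measurable_stepKernel _ _).aemeasurable]
  simp_rw [← Finset.mul_sum]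
  exact lintegral_stepKernel_le hB hk

end Potential

/-! ### Chains of balls in a John domain -/

section PointwiseEstimate

variable {D : Set E}

/-- The curve condition in the definition of a John domain, with center `x₀`. -/
structure IsJohnWith (φ : ℝ → ℝ) (D : Set E) (c : ℝ) (x₀ : E) : Prop where
  center_mem : x₀ ∈ D
  exists_curve : ∀ x ∈ D, ∃ (l : ℝ) (γ : ℝ → E), 0 ≤ l ∧
    (∀ s ∈ Icc 0 l, ∀ t ∈ Icc 0 l, dist (γ s) (γ t) ≤ |s - t|) ∧ γ 0 = x ∧ γ l = x₀ ∧
    (∀ t ∈ Icc 0 l, γ t ∈ D) ∧ ∀ t ∈ Icc 0 l, φ t ≤ c * infDist (γ t) Dᶜ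

/-- The radius of the chain balls. -/
noncomputable def chainRadius (D : Set E) (x : E) : ℝ := infDist x Dᶜ / 16

theorem chainRadius_pos (hD : IsOpen D) (hDc : Dᶜ.Nonempty) {x : E} (hx : x ∈ D) :
    0 < chainRadius D x := by
  have := (hD.isClosed_compl.notMem_iff_infDist_pos hDc).1 (show x ∉ Dᶜ by simpa using hx)
  unfold chainRadius
  positivity

/-- The factor `1/16` keeps the threefold balls inside the domain and makes the radii at nearby
points comparable, as the means over consecutive balls require. -/
theorem chainRadius_sub_le (x y : E) : |chainRadius D x - chainRadius D y| ≤ dist x y / 16 := by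
  unfold chainRadius
  rw [← sub_div, abs_div, abs_of_pos (by norm_num : (0 : ℝ) < 16)]
  have h1 := infDist_le_infDist_add_dist (s := Dᶜ) (x := x) (y := y)
  have h2 := infDist_le_infDist_add_dist (s := Dᶜ) (x := y) (y := x)
  rw [dist_comm y x] at h2
  gcongr
  rw [abs_le]
  constructor <;> linarith

theorem closedBall_chainRadius_subset {x : E} (hx : 0 < chainRadius D x) :
    closedBall x (3 * chainRadius D x) ⊆ D := by
  refine (closedBall_subset_ball ?_).trans ball_infDist_compl_subset
  unfold chainRadius at *
  linarith

/-- The kernel of a chain of separated balls along a curve is bounded by the kernel of the modified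
Riesz potential. -/
theorem sum_stepKernel_chain_le (hD : IsOpen D) (hDc : Dᶜ.Nonempty)
    {φ : ℝ → ℝ} {A : ENNReal} (hA0 : A ≠ 0) (hA : A ≠ ⊤) {S : Finset ℝ} {γ : ℝ → E} {x : E}
    (hγD : ∀ t ∈ S, γ t ∈ D)
    (hsep : ∀ t ∈ S, ∀ t' ∈ S, t < t' → chainRadius D (γ t) ≤ dist (γ t) (γ t'))
    (hφ : ∀ t ∈ S, ∀ y ∈ closedBall (γ t) (3 * chainRadius D (γ t)),
      ENNReal.ofReal (φ (dist x y)) ≤ A * ENNReal.ofReal (chainRadius D (γ t))) (y : E) :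
    ∑ t ∈ S, stepKernel (γ t) (chainRadius D (γ t)) y ≤
      (56 ^ finrank ℝ E * stepConst E * A ^ (finrank ℝ E - 1)) *
        (ENNReal.ofReal (φ (dist x y)) ^ (finrank ℝ E - 1))⁻¹ := by
  classical
  set S' := S.filter fun t => y ∈ closedBall (γ t) (3 * chainRadius D (γ t)) with hS'
  -- If `y` is within `3 r` of `γ t`, where `r` is the radius there, the radius at `y` lies between
  -- `13 r / 16` and `19 r / 16`. The balls that contain `y` can thus all be measured by the radius
  -- at `y`.
  have hrad {t : ℝ} (ht : t ∈ S') :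
      dist (γ t) y ≤ 4 * chainRadius D y ∧ chainRadius D y / 2 ≤ chainRadius D (γ t) ∧
        0 < chainRadius D y := by
    obtain ⟨ht1, ht2⟩ := Finset.mem_filter.1 ht
    rw [mem_closedBall, dist_comm] at ht2
    have h1 := abs_le.1 (chainRadius_sub_le (D := D) (γ t) y)
    have h2 := chainRadius_pos hD hDc (hγD t ht1)
    refine ⟨?_, ?_, ?_⟩ <;> linarith [h1.1, h1.2]
  have hcard : (S'.card : ENNReal) ≤ 56 ^ finrank ℝ E := by
    rcases S'.eq_empty_or_nonempty with h | ⟨t₀, ht₀⟩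
    · simp [h]
    refine card_le_of_dist_ge (z := γ) (y := y) (hrad ht₀).2.2 (fun t ht => (hrad ht).1) ?_
    intro t ht t' ht' hne
    rcases lt_or_gt_of_ne hne with hlt | hlt
    · exact (hrad ht).2.1.trans
        (hsep t (Finset.mem_filter.1 ht).1 t' (Finset.mem_filter.1 ht').1 hlt)
    · rw [dist_comm]
      exact (hrad ht').2.1.trans
        (hsep t' (Finset.mem_filter.1 ht').1 t (Finset.mem_filter.1 ht).1 hlt)
  have hsum : ∑ t ∈ S, stepKernel (γ t) (chainRadius D (γ t)) y =
      ∑ t ∈ S', stepKernel (γ t) (chainRadius D (γ t)) y := by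
    rw [hS', Finset.sum_filter]
    refine Finset.sum_congr rfl fun t _ => ?_
    split_ifs with h
    · rfl
    · exact indicator_of_notMem h _
  rw [hsum]
  calc ∑ t ∈ S', stepKernel (γ t) (chainRadius D (γ t)) y
      ≤ ∑ t ∈ S', stepConst E * (A ^ (finrank ℝ E - 1) *
          (ENNReal.ofReal (φ (dist x y)) ^ (finrank ℝ E - 1))⁻¹) := by
        refine Finset.sum_le_sum fun t ht => ?_
        obtain ⟨ht1, ht2⟩ := Finset.mem_filter.1 ht
        rw [stepKernel, indicator_of_mem ht2]
        gcongr
        exact ENNReal.inv_pow_le_of_le_mul hA0 hA (hφ t ht1 y ht2) _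
    _ ≤ _ := by
        rw [Finset.sum_const, nsmul_eq_mul, ← mul_assoc, ← mul_assoc]
        gcongr

/-- The kernel of a sequence of concentric balls with geometrically decreasing radii. -/
theorem sum_stepKernel_geometric_le (hn : 2 ≤ finrank ℝ E) {φ : ℝ → ℝ} {A M : ℝ} (hA : 1 ≤ A)
    (hφ : ∀ s ∈ Icc 0 M, φ s ≤ A * s) {ρ : ℝ} (hρ : 0 < ρ) (hρM : 3 * ρ ≤ M) (x : E) (k : ℕ)
    (y : E) :
    ∑ j ∈ Finset.range k, stepKernel x (ρ * (1 / 2) ^ j) y ≤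
      (2 * stepConst E * ENNReal.ofReal (3 * A) ^ (finrank ℝ E - 1)) *
        (ENNReal.ofReal (φ (dist x y)) ^ (finrank ℝ E - 1))⁻¹ := by
  classical
  set m := finrank ℝ E - 1 with hm
  set a : ℕ → ENNReal := fun j => (ENNReal.ofReal (ρ * (1 / 2) ^ j) ^ m)⁻¹ with ha
  have h1 := (sum_ite_le_two_mul (a := a) (P := fun j => y ∈ closedBall x (3 * (ρ * (1 / 2) ^ j)))
    (T := ENNReal.ofReal (3 * A) ^ m * (ENNReal.ofReal (φ (dist x y)) ^ m)⁻¹) ?_ ?_ ?_ k).2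
  · calc ∑ j ∈ Finset.range k, stepKernel x (ρ * (1 / 2) ^ j) y
        = stepConst E * ∑ j ∈ Finset.range k,
            (if y ∈ closedBall x (3 * (ρ * (1 / 2) ^ j)) then a j else 0) := by
          rw [Finset.mul_sum]
          refine Finset.sum_congr rfl fun j _ => ?_
          rw [stepKernel]
          split_ifs with h
          · rw [indicator_of_mem h]
          · rw [indicator_of_notMem h, mul_zero]
      _ ≤ stepConst E * (2 * (ENNReal.ofReal (3 * A) ^ m *
            (ENNReal.ofReal (φ (dist x y)) ^ m)⁻¹)) := by gcongr
      _ = _ := by ring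
  · intro j hj
    refine closedBall_subset_closedBall ?_ hj
    gcongr 3 * (ρ * ?_)
    exact pow_le_pow_of_le_one (by norm_num) (by norm_num) (Nat.le_succ j)
  · intro j
    have h2 : ENNReal.ofReal (ρ * (1 / 2) ^ j) = 2 * ENNReal.ofReal (ρ * (1 / 2) ^ (j + 1)) := by
      rw [show (2 : ENNReal) = ENNReal.ofReal 2 by simp, ← ENNReal.ofReal_mul (by norm_num)]
      congr 1
      rw [pow_succ]
      ring
    simp only [ha]
    rw [h2, mul_pow, ENNReal.mul_inv (Or.inl (by simp)) (Or.inl (by simp)), ← mul_assoc]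
    refine mul_le_of_le_one_left zero_le ?_
    -- In dimension at least two the exponent `m` is positive, so halving the radius at least
    -- doubles the kernel.
    have h3 : (2 : ENNReal) ^ 1 ≤ 2 ^ m := pow_le_pow_right₀ (by norm_num) (by omega)
    calc 2 * (2 ^ m : ENNReal)⁻¹ ≤ 2 ^ m * (2 ^ m : ENNReal)⁻¹ := by gcongr; simpa using h3
      _ ≤ 1 := ENNReal.mul_inv_le_one _
  · intro j hj
    rw [mem_closedBall, dist_comm] at hj
    have h4 : (1 / 2 : ℝ) ^ j ≤ 1 := pow_le_one₀ (by norm_num) (by norm_num)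
    refine ENNReal.inv_pow_le_of_le_mul (by simp; linarith) ENNReal.ofReal_ne_top ?_ m
    rw [← ENNReal.ofReal_mul (by linarith)]
    refine ENNReal.ofReal_le_ofReal ?_
    have h5 : dist x y ≤ M := by nlinarith
    calc φ (dist x y) ≤ A * dist x y := hφ _ ⟨dist_nonneg, h5⟩
      _ ≤ A * (3 * (ρ * (1 / 2) ^ j)) := by gcongr
      _ = _ := by ring

/-- The difference is split into three pieces: concentric balls shrinking to the Lebesgue point `x`,
one change of radius at `x`, and the chain along the John curve. -/
theorem exists_abs_sub_mean_le_modifiedRiesz (hD : IsOpen D) (hDc : Dᶜ.Nonempty)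
    (hn : 2 ≤ finrank ℝ E) {φ : ℝ → ℝ} {A c M : ℝ}
    (hφm : MonotoneOn φ (Ici 0)) (hA : 1 ≤ A) (hc : 0 < c)
    (hφ4 : ∀ t, 0 ≤ t → φ (4 * t) ≤ A * φ t) (hφ : ∀ s ∈ Icc 0 M, φ s ≤ A * s)
    (hM : ∀ x ∈ D, infDist x Dᶜ ≤ M) {x₀ : E} (hJ : IsJohnWith φ D c x₀) :
    ∃ C : ENNReal, C ≠ ⊤ ∧ ∀ w G, IsWeakGradient D w G → ∀ᵐ x, x ∈ D →
      ENNReal.ofReal |w x - ∫ y, w y * mollifier (chainRadius D x₀) (y - x₀)| ≤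
        C * modifiedRiesz φ D G x := by
  have hn0 : 0 < finrank ℝ E := by omega
  have hM0 : 0 < M := by
    have h1 := chainRadius_pos hD hDc hJ.1
    unfold chainRadius at h1
    linarith [hM x₀ hJ.1]
  set A₁ : ℝ := 16 * A * c + 4 * A with hA₁
  have hA₁0 : 0 < A₁ := by positivity
  set B₁ : ENNReal := 2 * stepConst E * ENNReal.ofReal (3 * A) ^ (finrank ℝ E - 1) with hB₁
  set B₂ : ENNReal :=
    56 ^ finrank ℝ E * stepConst E * ENNReal.ofReal A₁ ^ (finrank ℝ E - 1) with hB₂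
  have hB₁t : B₁ ≠ ⊤ := ENNReal.mul_ne_top (ENNReal.mul_ne_top (by simp) ENNReal.ofReal_ne_top)
    (ENNReal.pow_ne_top ENNReal.ofReal_ne_top)
  have hB₂t : B₂ ≠ ⊤ := ENNReal.mul_ne_top (ENNReal.mul_ne_top (by simp) ENNReal.ofReal_ne_top)
    (ENNReal.pow_ne_top ENNReal.ofReal_ne_top)
  refine ⟨B₁ + B₂ + B₂, by simp [hB₁t, hB₂t], fun w G h => ?_⟩
  have hae := ae_tendsto_integral_mul_mollifier_of_locallyIntegrableOn hD h.1
    (r := fun k => M * (1 / 2) ^ k) (fun k => by positivity) (by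
      have := tendsto_half_pow.const_mul M
      rwa [mul_zero] at this)
  filter_upwards [hae] with x hx hxD
  replace hx := hx hxD
  set m : E → ℝ → ℝ := fun z r => ∫ y, w y * mollifier r (y - z) with hm
  have hrx := chainRadius_pos hD hDc hxD
  -- Lebesgue differentiation is applied along the single sequence `M 2^(-k)`, chosen independently
  -- of `x`. The descent starts at its first radius below the chain radius of `x`.
  obtain ⟨k₀, hk₀, hk₀'⟩ : ∃ k₀ : ℕ, M * (1 / 2) ^ (k₀ + 1) < chainRadius D x ∧
      chainRadius D x ≤ M * (1 / 2) ^ k₀ := by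
    have h1 : chainRadius D x / M ≤ 1 := by
      rw [div_le_one hM0]
      have := hM x hxD
      unfold chainRadius
      linarith
    obtain ⟨k, hk, hk'⟩ := exists_nat_pow_near_of_lt_one (div_pos hrx hM0) h1
      (by norm_num : (0 : ℝ) < 1 / 2) (by norm_num)
    rw [lt_div_iff₀ hM0, mul_comm] at hk
    rw [div_le_iff₀ hM0, mul_comm] at hk'
    exact ⟨k, hk, hk'⟩
  set ρ := M * (1 / 2) ^ (k₀ + 1) with hρ
  have hρ0 : 0 < ρ := by positivity
  have hρ2 : chainRadius D x / 2 ≤ ρ := by rw [hρ, pow_succ]; linarith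
  have hρx : 3 * ρ ≤ 3 * chainRadius D x := by linarith
  have hballx := closedBall_chainRadius_subset hrx
  -- descent to `x`
  have hdesc : ENNReal.ofReal |w x - m x ρ| ≤ B₁ * modifiedRiesz φ D G x := by
    have hstep (j : ℕ) : |m x (ρ * (1 / 2) ^ j) - m x (ρ * (1 / 2) ^ (j + 1))| ≤
        stepCost G x (ρ * (1 / 2) ^ j) := by
      refine h.abs_mean_sub_le_stepCost hn0 (by positivity) ?_ ?_ ?_
      · rw [pow_succ]; linarith
      · rw [dist_self, pow_succ]
        have : 0 < ρ * (1 / 2) ^ j := by positivity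
        linarith
      · refine (closedBall_subset_closedBall ?_).trans hballx
        refine le_trans ?_ hρx
        gcongr
        exact mul_le_of_le_one_right hρ0.le (pow_le_one₀ (by norm_num) (by norm_num))
    have hk (k : ℕ) : ENNReal.ofReal |m x (ρ * (1 / 2) ^ k) - m x ρ| ≤
        B₁ * modifiedRiesz φ D G x := by
      have h1 : |m x (ρ * (1 / 2) ^ k) - m x ρ| ≤
          ∑ j ∈ Finset.range k, stepCost G x (ρ * (1 / 2) ^ j) := by
        have h2 := dist_le_range_sum_of_dist_le (f := fun j => m x (ρ * (1 / 2) ^ j)) k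
          (d := fun j => stepCost G x (ρ * (1 / 2) ^ j)) fun {j} _ => by
            rw [Real.dist_eq]; exact hstep j
        rw [dist_comm, Real.dist_eq] at h2
        simpa using h2
      refine (ENNReal.ofReal_le_ofReal h1).trans ?_
      refine sum_ofReal_stepCost_le (z := fun _ => x) hn0 h.2 (fun j _ => by positivity)
        (fun j _ => ?_) hB₁t ?_
      · refine (closedBall_subset_closedBall (le_trans ?_ hρx)).trans hballx
        gcongr
        exact mul_le_of_le_one_right hρ0.le (pow_le_one₀ (by norm_num) (by norm_num))
      · refine sum_stepKernel_geometric_le hn hA hφ hρ0 ?_ x k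
        have := hM x hxD
        unfold chainRadius at hρx hrx
        linarith
    have hlim : Tendsto (fun k : ℕ => m x (ρ * (1 / 2) ^ k)) atTop (𝓝 (w x)) := by
      refine ((tendsto_add_atTop_iff_nat (k₀ + 1)).2 hx).congr fun k => ?_
      simp only [hm, hρ]
      rw [mul_assoc, ← pow_add, add_comm (k₀ + 1)]
    exact le_of_tendsto ((ENNReal.continuous_ofReal.tendsto _).comp
      ((hlim.sub_const _).abs)) (Eventually.of_forall hk)
  obtain ⟨l, γ, hl, hγ, hγ0, hγl, hγD, hγφ⟩ := hJ.2 x hxD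
  have hball {t : ℝ} (ht : t ∈ Icc 0 l) {y : E}
      (hy : y ∈ closedBall (γ t) (3 * chainRadius D (γ t))) :
      ENNReal.ofReal (φ (dist x y)) ≤
        ENNReal.ofReal A₁ * ENNReal.ofReal (chainRadius D (γ t)) := by
    rw [← ENNReal.ofReal_mul hA₁0.le]
    refine ENNReal.ofReal_le_ofReal ?_
    have hr := chainRadius_pos hD hDc (hγD t ht)
    have h1 : dist x (γ t) ≤ t := by
      have := hγ 0 ⟨le_rfl, hl⟩ t ht
      rwa [hγ0, zero_sub, abs_neg, abs_of_nonneg ht.1] at this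
    rw [mem_closedBall, dist_comm] at hy
    have h2 : dist x y ≤ t + 3 * chainRadius D (γ t) := by linarith [dist_triangle x (γ t) y]
    have h3 : infDist (γ t) Dᶜ = 16 * chainRadius D (γ t) := by unfold chainRadius; ring
    -- Far along the curve, `dist x y ≤ 4 t` and the John condition bounds `φ t` by the distance to
    -- the complement. Near `x`, `dist x y` is at most four radii and `φ` is at most linear there.
    -- The two cases give the two summands of `A₁`.
    rcases le_total (chainRadius D (γ t)) t with hle | hle
    · calc φ (dist x y) ≤ φ (4 * t) := by
            refine hφm dist_nonneg (by simpa using ht.1) (by linarith)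
        _ ≤ A * φ t := hφ4 t ht.1
        _ ≤ A * (c * (16 * chainRadius D (γ t))) := by
            rw [← h3]; gcongr; exact hγφ t ht
        _ ≤ A₁ * chainRadius D (γ t) := by
            rw [hA₁]
            have : 0 ≤ A * chainRadius D (γ t) := by positivity
            linarith
    · have h5 : 4 * chainRadius D (γ t) ≤ M := by
        have := hM _ (hγD t ht)
        linarith
      calc φ (dist x y) ≤ φ (4 * chainRadius D (γ t)) := by
            refine hφm dist_nonneg (by simp only [mem_Ici]; positivity) (by linarith)
        _ ≤ A * (4 * chainRadius D (γ t)) := hφ _ ⟨by positivity, h5⟩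
        _ ≤ A₁ * chainRadius D (γ t) := by
            rw [hA₁]
            have : 0 ≤ A * c * chainRadius D (γ t) := by positivity
            linarith
  have h0l : (0 : ℝ) ∈ Icc 0 l := ⟨le_rfl, hl⟩
  have hA₁' : ENNReal.ofReal A₁ ≠ 0 := by simpa using hA₁0
  -- The change of radius at `x` is treated as a chain with the single parameter `0`.
  have hmid : ENNReal.ofReal |m x ρ - m x (chainRadius D x)| ≤ B₂ * modifiedRiesz φ D G x := by
    have h1 : |m x (chainRadius D x) - m x ρ| ≤ stepCost G x (chainRadius D x) :=
      h.abs_mean_sub_le_stepCost hn0 hrx hρ2 (by rw [dist_self]; linarith) hballx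
    rw [abs_sub_comm]
    refine (ENNReal.ofReal_le_ofReal h1).trans ?_
    have h2 := sum_ofReal_stepCost_le (φ := φ) (x := x) (S := {(0 : ℝ)}) (z := γ)
      (r := fun t => chainRadius D (γ t)) hn0 h.2
      (by simpa [hγ0] using hrx) (by simpa [hγ0] using hballx) hB₂t
      (sum_stepKernel_chain_le hD hDc hA₁' ENNReal.ofReal_ne_top (by simpa [hγ0] using hxD)
        (by simp +contextual) fun t ht y hy => by
          rw [Finset.mem_singleton] at ht
          subst ht
          exact hball h0l hy)
    simpa [hγ0] using h2
  have hchain : ENNReal.ofReal |m x (chainRadius D x) - m x₀ (chainRadius D x₀)| ≤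
      B₂ * modifiedRiesz φ D G x := by
    have hcont : ContinuousOn γ (Icc 0 l) :=
      (LipschitzOnWith.of_dist_le_mul (K := 1) fun t ht t' ht' => by
        rw [NNReal.coe_one, one_mul, Real.dist_eq]
        exact hγ t ht t' ht').continuousOn
    have hrc : ContinuousOn (fun t => chainRadius D (γ t)) (Icc 0 l) :=
      ((continuous_infDist_pt Dᶜ).comp_continuousOn hcont).div_const 16
    obtain ⟨t₀, ht₀, hmin⟩ := isCompact_Icc.exists_isMinOn ⟨0, h0l⟩ hrc
    obtain ⟨S, hS1, hS2, hS3⟩ := exists_separated_chain (ρ := fun t => chainRadius D (γ t))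
      (f := fun t => m (γ t) (chainRadius D (γ t)))
      (c := fun t => stepCost G (γ t) (chainRadius D (γ t))) hγ
      (chainRadius_pos hD hDc (hγD t₀ ht₀)) (fun t ht => hmin ht) (fun s hs t ht hst => by
        have hr := chainRadius_pos hD hDc (hγD s hs)
        have h1 := abs_le.1 (chainRadius_sub_le (D := D) (γ s) (γ t))
        exact h.abs_mean_sub_le_stepCost hn0 hr (by linarith [h1.2]) (by linarith [h1.1])
          (closedBall_chainRadius_subset hr)) h0l
    rw [hγ0, hγl] at hS2
    refine (ENNReal.ofReal_le_ofReal hS2).trans ?_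
    exact sum_ofReal_stepCost_le hn0 h.2
      (fun t ht => chainRadius_pos hD hDc (hγD t (hS1 t ht)))
      (fun t ht => closedBall_chainRadius_subset (chainRadius_pos hD hDc (hγD t (hS1 t ht)))) hB₂t
      (sum_stepKernel_chain_le hD hDc hA₁' ENNReal.ofReal_ne_top (fun t ht => hγD t (hS1 t ht)) hS3
        fun t ht y hy => hball (hS1 t ht) hy)
  have htri : |w x - m x₀ (chainRadius D x₀)| ≤ |w x - m x ρ| + |m x ρ - m x (chainRadius D x)| +
      |m x (chainRadius D x) - m x₀ (chainRadius D x₀)| := by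
    refine (abs_sub_le _ (m x (chainRadius D x)) _).trans ?_
    gcongr
    exact abs_sub_le _ _ _
  refine (ENNReal.ofReal_le_ofReal htri).trans ?_
  rw [ENNReal.ofReal_add (by positivity) (by positivity),
    ENNReal.ofReal_add (by positivity) (by positivity), add_mul, add_mul]
  gcongr

end PointwiseEstimate

/-! ### The weak type estimate for the maximal function -/

section WeakType

/-- The weak type inequality for the maximal function of a measure: Vitali's covering lemma selects
disjoint balls whose fourfold enlargements cover the set. -/
theorem volume_setOf_lt_measure_ball_le (hn : 0 < finrank ℝ E) (m : Measure E) {t : ENNReal}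
    (ht0 : t ≠ 0) (ht : t ≠ ⊤) :
    volume {x : E | ∃ r, 0 < r ∧ t * volume (ball x r) < m (ball x r)} ≤
      4 ^ finrank ℝ E * (t⁻¹ * m univ) := by
  by_cases hm : m univ = ⊤
  · rw [hm, ENNReal.mul_top (ENNReal.inv_ne_zero.2 ht), ENNReal.mul_top (by simp)]
    exact le_top
  set A := {x : E | ∃ r, 0 < r ∧ t * volume (ball x r) < m (ball x r)} with hA
  set V := volume (ball (0 : E) 1) with hV
  have hV0 : V ≠ 0 := (measure_ball_pos _ _ one_pos).ne'
  have hVt : V ≠ ⊤ := measure_ball_lt_top.ne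
  have hchoice : ∀ x : E, ∃ r, x ∈ A → 0 < r ∧ t * volume (ball x r) < m (ball x r) := fun x => by
    by_cases hx : x ∈ A
    · obtain ⟨r, hr⟩ := hx
      exact ⟨r, fun _ => hr⟩
    · exact ⟨0, fun h => absurd h hx⟩
  choose r hr using hchoice
  -- Vitali's lemma needs bounded radii. Here `t |B_r| < m univ < ∞` bounds `r^n`, hence `r`, since
  -- `r ≤ r^n` for `r ≥ 1`.
  have hbound : ∀ x ∈ A, r x ≤ max 1 (m univ / (t * V)).toReal := fun x hx => by
    by_contra! h
    obtain ⟨h1, h2⟩ := max_lt_iff.1 h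
    obtain ⟨h3, h4⟩ := hr x hx
    have h5 : t * (ENNReal.ofReal (r x ^ finrank ℝ E) * V) < m univ := by
      rw [← Measure.addHaar_ball_of_pos volume x h3]
      exact h4.trans_le (measure_mono (subset_univ _))
    have hfin : m univ / (t * V) ≠ ⊤ := ENNReal.div_ne_top hm (mul_ne_zero ht0 hV0)
    have h6 : m univ / (t * V) ≤ ENNReal.ofReal (r x ^ finrank ℝ E) := by
      rw [← ENNReal.ofReal_toReal hfin]
      exact ENNReal.ofReal_le_ofReal (h2.le.trans (le_self_pow₀ h1.le hn.ne'))
    rw [ENNReal.div_le_iff (mul_ne_zero ht0 hV0) (ENNReal.mul_ne_top ht hVt)] at h6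
    refine absurd h5 (not_lt.2 (h6.trans_eq ?_))
    ring
  obtain ⟨u, huA, hdisj, hcov⟩ := Vitali.exists_disjoint_subfamily_covering_enlargement_ball A id r
    _ hbound 4 (by norm_num)
  simp only [id] at hdisj hcov
  have hucount : u.Countable := hdisj.countable_of_isOpen (fun _ _ => isOpen_ball) fun x hx =>
    ⟨x, mem_ball_self (hr x (huA hx)).1⟩
  have hsub : A ⊆ ⋃ x ∈ u, ball x (4 * r x) := fun x hx => by
    obtain ⟨b, hb, hxb⟩ := hcov x hx
    exact mem_iUnion₂.2 ⟨b, hb, hxb (mem_ball_self (hr x hx).1)⟩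
  have hball (x : E) (hx : x ∈ u) :
      volume (ball x (4 * r x)) ≤ 4 ^ finrank ℝ E * (t⁻¹ * m (ball x (r x))) := by
    obtain ⟨h1, h2⟩ := hr x (huA hx)
    rw [Measure.addHaar_ball_of_pos volume x (by positivity), mul_pow,
      ENNReal.ofReal_mul (by positivity), mul_assoc,
      ← Measure.addHaar_ball_of_pos volume x h1, ENNReal.ofReal_pow (by norm_num),
      show ENNReal.ofReal 4 = 4 by norm_num]
    gcongr
    rw [← ENNReal.div_eq_inv_mul, ENNReal.le_div_iff_mul_le (Or.inl ht0) (Or.inl ht), mul_comm]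
    exact h2.le
  have : Countable u := hucount.to_subtype
  calc volume A ≤ volume (⋃ x ∈ u, ball x (4 * r x)) := measure_mono hsub
    _ ≤ ∑' x : u, volume (ball (x : E) (4 * r x)) := measure_biUnion_le volume hucount _
    _ ≤ ∑' x : u, 4 ^ finrank ℝ E * (t⁻¹ * m (ball (x : E) (r x))) :=
        ENNReal.tsum_le_tsum fun x => hball x x.2
    _ = 4 ^ finrank ℝ E * (t⁻¹ * m (⋃ x ∈ u, ball x (r x))) := by
        rw [ENNReal.tsum_mul_left, ENNReal.tsum_mul_left,
          measure_biUnion hucount hdisj fun _ _ => measurableSet_ball]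
    _ ≤ _ := by gcongr; exact subset_univ _

end WeakType

/-! ### Splitting the modified Riesz potential -/

section Splitting

theorem lintegral_enorm_le_rpow_mul {X F : Type*} [MeasurableSpace X] [NormedAddCommGroup F]
    {μ : Measure X} {G : X → F} (hG : AEStronglyMeasurable G μ) {p : ℝ} (hp : 1 ≤ p) (S : Set X) :
    ∫⁻ y in S, ‖G y‖ₑ ∂μ ≤ (∫⁻ y in S, ‖G y‖ₑ ^ p ∂μ) ^ (1 / p) * μ S ^ (1 - 1 / p) := by
  have := eLpNorm'_le_eLpNorm'_mul_rpow_measure_univ one_pos hp (hG.mono_measure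
    (Measure.restrict_le_self (s := S)))
  simpa [eLpNorm'] using this

variable {D : Set E} {φ : ℝ → ℝ}

theorem lintegral_mul_kernel_le {ν : Measure E} {G : E → E} {x : E} {T : Set E} {s : ℝ}
    (hs : 0 < φ s) (hφm : MonotoneOn φ (Ici 0)) (hs0 : 0 ≤ s) (hT : MeasurableSet T)
    (hTs : ∀ y ∈ T, s ≤ dist x y) :
    ∫⁻ y in T, ‖G y‖ₑ * (ENNReal.ofReal (φ (dist x y)) ^ (finrank ℝ E - 1))⁻¹ ∂ν ≤
      ENNReal.ofReal ((φ s ^ (finrank ℝ E - 1))⁻¹) * ∫⁻ y in T, ‖G y‖ₑ ∂ν := by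
  rw [← lintegral_const_mul' _ _ ENNReal.ofReal_ne_top]
  refine setLIntegral_mono' hT fun y hy => ?_
  rw [mul_comm]
  gcongr
  rw [ENNReal.ofReal_inv_of_pos (by positivity), ENNReal.ofReal_pow hs.le, ENNReal.inv_le_inv]
  gcongr
  exact hφm hs0 dist_nonneg (hTs y hy)

/-- On the annulus between `δ / 2^(k+1)` and `δ / 2^k` the kernel is largest at the inner radius,
while the mass of `‖G‖` is controlled by the outer ball. This mismatch costs the factor `2^n`. The
annuli miss the center, which has to be a null set. -/
theorem lintegral_near_le {ν : Measure E} (hφm : MonotoneOn φ (Ici 0))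
    (hφ0 : ∀ t, 0 < t → 0 < φ t) {G : E → E} {x : E} {τ δ : ℝ} (hτ : 0 ≤ τ) (hδ : 0 < δ)
    (hν : ν {x} = 0)
    (hG : ∀ r, 0 < r → ∫⁻ y in ball x r, ‖G y‖ₑ ∂ν ≤ ENNReal.ofReal τ * volume (ball x r))
    {H : ℝ}
    (hs : Summable fun k : ℕ => (δ / 2 ^ (k + 1)) ^ finrank ℝ E /
      φ (δ / 2 ^ (k + 1)) ^ (finrank ℝ E - 1))
    (hH : ∑' k : ℕ, (δ / 2 ^ (k + 1)) ^ finrank ℝ E /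
      φ (δ / 2 ^ (k + 1)) ^ (finrank ℝ E - 1) ≤ H) :
    ∫⁻ y in ball x δ, ‖G y‖ₑ * (ENNReal.ofReal (φ (dist x y)) ^ (finrank ℝ E - 1))⁻¹ ∂ν ≤
      ENNReal.ofReal (2 ^ finrank ℝ E * volume.real (ball (0 : E) 1) * (H * τ)) := by
  set S : ℕ → Set E := fun k => ball x (δ / 2 ^ k) \ ball x (δ / 2 ^ (k + 1)) with hS
  have hcov : (ball x δ \ {x} : Set E) ⊆ ⋃ k, S k := by
    rintro y ⟨hy, hyx⟩
    have hd : 0 < dist y x := dist_pos.2 hyx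
    rw [mem_ball] at hy
    have hex : ∃ k : ℕ, δ / 2 ^ (k + 1) ≤ dist y x := by
      obtain ⟨k, hk⟩ := exists_pow_lt_of_lt_one (div_pos hd hδ) (by norm_num : (1 / 2 : ℝ) < 1)
      refine ⟨k, ?_⟩
      rw [lt_div_iff₀ hδ, one_div, inv_pow, ← div_eq_inv_mul] at hk
      refine le_trans ?_ hk.le
      gcongr
      · norm_num
      · exact k.le_succ
    classical
    refine mem_iUnion.2 ⟨Nat.find hex, ?_, fun h => not_lt.2 (Nat.find_spec hex) (mem_ball.1 h)⟩
    rw [mem_ball]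
    rcases Nat.eq_zero_or_pos (Nat.find hex) with h0 | h0
    · rw [h0, pow_zero, div_one]
      exact hy
    · have := Nat.find_min hex (Nat.sub_lt h0 one_pos)
      rwa [Nat.sub_add_cancel (Nat.one_le_iff_ne_zero.2 h0.ne'), not_le] at this
  have hterm (k : ℕ) :
      ∫⁻ y in S k, ‖G y‖ₑ * (ENNReal.ofReal (φ (dist x y)) ^ (finrank ℝ E - 1))⁻¹ ∂ν ≤
        ENNReal.ofReal (2 ^ finrank ℝ E * volume.real (ball (0 : E) 1) * τ *
          ((δ / 2 ^ (k + 1)) ^ finrank ℝ E / φ (δ / 2 ^ (k + 1)) ^ (finrank ℝ E - 1))) := by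
    have hpos : 0 < φ (δ / 2 ^ (k + 1)) := hφ0 _ (by positivity)
    refine (lintegral_mul_kernel_le hpos hφm (by positivity)
      (measurableSet_ball.diff measurableSet_ball) fun y hy => ?_).trans ?_
    · have := hy.2
      rwa [mem_ball, not_lt, dist_comm] at this
    · have h1 : ∫⁻ y in S k, ‖G y‖ₑ ∂ν ≤ ENNReal.ofReal τ * volume (ball x (δ / 2 ^ k)) :=
        (lintegral_mono_set sdiff_subset).trans (hG _ (by positivity))
      have h2 : volume (ball x (δ / 2 ^ k)) =
          ENNReal.ofReal ((δ / 2 ^ k) ^ finrank ℝ E * volume.real (ball (0 : E) 1)) := by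
        rw [Measure.addHaar_ball_of_pos volume x (by positivity),
          ENNReal.ofReal_mul (by positivity), Measure.real,
          ENNReal.ofReal_toReal measure_ball_lt_top.ne]
      refine (mul_le_mul_right h1 _).trans_eq ?_
      rw [h2, ← ENNReal.ofReal_mul hτ, ← ENNReal.ofReal_mul (by positivity)]
      congr 1
      have h3 : δ / 2 ^ k = 2 * (δ / 2 ^ (k + 1)) := by rw [pow_succ]; field_simp
      rw [h3, mul_pow]
      field_simp
  have hae : (ball x δ : Set E) =ᵐ[ν] (ball x δ \ {x} : Set E) :=
    (sdiff_null_ae_eq_self hν).symm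
  rw [Measure.restrict_congr_set hae]
  calc _ ≤ ∫⁻ y in ⋃ k, S k,
          ‖G y‖ₑ * (ENNReal.ofReal (φ (dist x y)) ^ (finrank ℝ E - 1))⁻¹ ∂ν :=
        lintegral_mono_set hcov
    _ ≤ _ := lintegral_iUnion_le _ _
    _ ≤ _ := ENNReal.tsum_le_tsum hterm
    _ = ENNReal.ofReal (∑' k : ℕ, 2 ^ finrank ℝ E * volume.real (ball (0 : E) 1) * τ *
          ((δ / 2 ^ (k + 1)) ^ finrank ℝ E / φ (δ / 2 ^ (k + 1)) ^ (finrank ℝ E - 1))) := by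
        refine (ENNReal.ofReal_tsum_of_nonneg (fun k => ?_) (hs.mul_left _)).symm
        have hpos : 0 < φ (δ / 2 ^ (k + 1)) := hφ0 _ (by positivity)
        positivity
    _ ≤ _ := by
        refine ENNReal.ofReal_le_ofReal ?_
        rw [tsum_mul_left]
        have : 0 ≤ 2 ^ finrank ℝ E * volume.real (ball (0 : E) 1) * τ := by positivity
        nlinarith

/-- Hölder's inequality on the annulus at distance `2^k δ` gives a power of its volume, and `φ(2^k
δ) ≥ 2^k φ(δ) / Q`. The resulting series is geometric with ratio `2^(1 - n/p)`, which is less than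
one exactly because `p < n`. -/
theorem lintegral_far_le {ν : Measure E} (hνv : ν ≤ volume) (hφm : MonotoneOn φ (Ici 0))
    (hφ0 : ∀ t, 0 < t → 0 < φ t) {Q : ℝ}
    (hφq : ∀ t₁ t₂, 0 < t₁ → t₁ ≤ t₂ → φ t₁ / t₁ ≤ Q * (φ t₂ / t₂)) {p : ℝ} (hp : 1 ≤ p)
    (hpn : p < finrank ℝ E) (hn : 0 < finrank ℝ E) :
    ∃ C : ℝ, 0 < C ∧ ∀ (G : E → E) (x : E) (δ : ℝ), AEStronglyMeasurable G ν → 0 < δ →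
      ∫⁻ y, ‖G y‖ₑ ^ p ∂ν ≤ 1 →
      ∫⁻ y in (ball x δ)ᶜ, ‖G y‖ₑ * (ENNReal.ofReal (φ (dist x y)) ^ (finrank ℝ E - 1))⁻¹ ∂ν ≤
        ENNReal.ofReal (C * ((φ δ ^ (finrank ℝ E - 1))⁻¹ * δ ^ ((finrank ℝ E : ℝ) * (1 - 1 / p)))) := by
  set n := finrank ℝ E with hndef
  set V := volume.real (ball (0 : E) 1) with hV
  have hV0 : 0 < V := ENNReal.toReal_pos (measure_ball_pos _ _ one_pos).ne' measure_ball_lt_top.ne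
  set q := 1 - 1 / p with hq
  have hp0 : 0 < p := by linarith
  have hq0 : 0 ≤ q := by
    rw [hq, sub_nonneg, div_le_one hp0]
    exact hp
  have hQ : 0 < Q := by
    have h1 := hφq 1 1 one_pos le_rfl
    have h2 := hφ0 1 one_pos
    by_contra! h
    rw [div_one] at h1
    nlinarith
  set ρ : ℝ := 2 ^ ((n : ℝ) * q) / 2 ^ (n - 1) with hρ
  have hρ0 : 0 < ρ := by positivity
  have hρ1 : ρ < 1 := by
    rw [hρ, div_lt_one (by positivity), ← Real.rpow_natCast, Nat.cast_sub hn]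
    refine Real.rpow_lt_rpow_of_exponent_lt (by norm_num) ?_
    rw [hq]
    have : 1 < (n : ℝ) * (1 / p) := by
      rw [mul_one_div, one_lt_div hp0]
      exact hpn
    push_cast
    linarith
  set K := Q ^ (n - 1) * (V ^ q * 2 ^ ((n : ℝ) * q)) with hK
  have hK0 : 0 < K := by positivity
  refine ⟨K * (1 - ρ)⁻¹, mul_pos hK0 (inv_pos.2 (by linarith)), fun G x δ hG hδ hG1 => ?_⟩
  set X := (φ δ ^ (n - 1))⁻¹ * δ ^ ((n : ℝ) * q) with hX
  have hδφ := hφ0 δ hδ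
  have hX0 : 0 < X := by positivity
  set S : ℕ → Set E := fun k => ball x (2 ^ (k + 1) * δ) \ ball x (2 ^ k * δ) with hS
  have hcov : (ball x δ)ᶜ ⊆ ⋃ k, S k := by
    intro y hy
    rw [mem_compl_iff, mem_ball, not_lt] at hy
    obtain ⟨k, hk, hk'⟩ := exists_nat_pow_near ((one_le_div hδ).2 hy) one_lt_two
    rw [le_div_iff₀ hδ] at hk
    rw [div_lt_iff₀ hδ] at hk'
    exact mem_iUnion.2 ⟨k, mem_ball.2 hk', fun h => not_lt.2 hk (mem_ball.1 h)⟩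
  have hterm (k : ℕ) :
      ∫⁻ y in S k, ‖G y‖ₑ * (ENNReal.ofReal (φ (dist x y)) ^ (n - 1))⁻¹ ∂ν ≤
        ENNReal.ofReal (K * X * ρ ^ k) := by
    have hpos : 0 < φ (2 ^ k * δ) := hφ0 _ (by positivity)
    refine (lintegral_mul_kernel_le hpos hφm (by positivity)
      (measurableSet_ball.diff measurableSet_ball) fun y hy => ?_).trans ?_
    · have := hy.2
      rwa [mem_ball, not_lt, dist_comm] at this
    have h1 : ∫⁻ y in S k, ‖G y‖ₑ ∂ν ≤ ENNReal.ofReal (((2 ^ (k + 1) * δ) ^ n * V) ^ q) := by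
      refine (lintegral_mono_set sdiff_subset).trans
        ((lintegral_enorm_le_rpow_mul hG hp _).trans ?_)
      rw [← one_mul (ENNReal.ofReal _)]
      refine mul_le_mul' ?_ ?_
      · exact ENNReal.rpow_le_one ((setLIntegral_le_lintegral _ _).trans hG1) (by positivity)
      · rw [← ENNReal.ofReal_rpow_of_nonneg (by positivity) hq0]
        refine ENNReal.rpow_le_rpow ((hνv _).trans_eq ?_) hq0
        rw [Measure.addHaar_ball_of_pos volume x (by positivity),
          ENNReal.ofReal_mul (by positivity), hV, Measure.real,
          ENNReal.ofReal_toReal measure_ball_lt_top.ne]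
    have h2 : (φ (2 ^ k * δ) ^ (n - 1))⁻¹ ≤ Q ^ (n - 1) * (φ δ ^ (n - 1))⁻¹ / (2 ^ (n - 1)) ^ k := by
      have h3 : 2 ^ k * φ δ ≤ Q * φ (2 ^ k * δ) := by
        have h4 := hφq δ (2 ^ k * δ) hδ (le_mul_of_one_le_left hδ.le (one_le_pow₀ one_le_two))
        rw [div_le_iff₀ hδ] at h4
        have h5 : Q * (φ (2 ^ k * δ) / (2 ^ k * δ)) * δ = Q * φ (2 ^ k * δ) / 2 ^ k := by
          field_simp
        rw [h5, le_div_iff₀ (by positivity)] at h4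
        linarith
      have h6 := pow_le_pow_left₀ (by positivity) h3 (n - 1)
      rw [mul_pow, mul_pow, pow_right_comm] at h6
      rw [le_div_iff₀ (by positivity), inv_mul_le_iff₀ (by positivity), ← mul_assoc,
        ← div_eq_mul_inv, le_div_iff₀ (by positivity)]
      linarith
    refine (mul_le_mul_right h1 _).trans ?_
    rw [← ENNReal.ofReal_mul (by positivity)]
    refine ENNReal.ofReal_le_ofReal ((mul_le_mul_of_nonneg_right h2 (by positivity)).trans_eq ?_)
    have h7 : ((2 ^ (k + 1) * δ) ^ n * V) ^ q =
        V ^ q * 2 ^ ((n : ℝ) * q) * (2 ^ ((n : ℝ) * q)) ^ k * δ ^ ((n : ℝ) * q) := by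
      rw [Real.mul_rpow (by positivity) (by positivity), ← Real.rpow_natCast_mul (by positivity),
        Real.mul_rpow (by positivity) hδ.le, ← Real.rpow_pow_comm (by norm_num), pow_succ]
      ring
    rw [h7, hK, hX, hρ, div_pow]
    field_simp
  calc _ ≤ ∫⁻ y in ⋃ k, S k, ‖G y‖ₑ * (ENNReal.ofReal (φ (dist x y)) ^ (n - 1))⁻¹ ∂ν :=
        lintegral_mono_set hcov
    _ ≤ _ := lintegral_iUnion_le _ _
    _ ≤ _ := ENNReal.tsum_le_tsum hterm
    _ = ENNReal.ofReal (∑' k : ℕ, K * X * ρ ^ k) :=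
        (ENNReal.ofReal_tsum_of_nonneg (fun k => by positivity)
          ((summable_geometric_of_lt_one hρ0.le hρ1).mul_left _)).symm
    _ = _ := by
        rw [tsum_mul_left, tsum_geometric_of_lt_one hρ0.le hρ1]
        ring_nf

/-- A Hedberg-type splitting at radius `δ`. By Hölder's inequality, the maximal bound `τ^p` for
`‖G‖^p` becomes the bound `τ` for `‖G‖` on balls around `x`. -/
theorem exists_modifiedRiesz_le (hφm : MonotoneOn φ (Ici 0))
    (hφ0 : ∀ t, 0 < t → 0 < φ t) {Q : ℝ}
    (hφq : ∀ t₁ t₂, 0 < t₁ → t₁ ≤ t₂ → φ t₁ / t₁ ≤ Q * (φ t₂ / t₂)) {p : ℝ} (hp : 1 ≤ p)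
    (hpn : p < finrank ℝ E) (hn : 0 < finrank ℝ E) :
    ∃ C : ℝ, 0 < C ∧ ∀ (G : E → E) (x : E) (τ δ H : ℝ),
      AEStronglyMeasurable G (volume.restrict D) → 0 ≤ τ → 0 < δ →
      (Summable fun k : ℕ => (δ / 2 ^ (k + 1)) ^ finrank ℝ E /
        φ (δ / 2 ^ (k + 1)) ^ (finrank ℝ E - 1)) →
      ∑' k : ℕ, (δ / 2 ^ (k + 1)) ^ finrank ℝ E / φ (δ / 2 ^ (k + 1)) ^ (finrank ℝ E - 1) ≤ H →
      ∫⁻ y in D, ‖G y‖ₑ ^ p ≤ 1 →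
      (∀ r, 0 < r → ∫⁻ y in ball x r, ‖G y‖ₑ ^ p ∂(volume.restrict D) ≤
        ENNReal.ofReal (τ ^ p) * volume (ball x r)) →
      modifiedRiesz φ D G x ≤ ENNReal.ofReal (C * (H * τ +
        (φ δ ^ (finrank ℝ E - 1))⁻¹ * δ ^ ((finrank ℝ E : ℝ) * (1 - 1 / p)))) := by
  have : Nontrivial E := Module.nontrivial_of_finrank_pos hn
  obtain ⟨C, hC, hfar⟩ := lintegral_far_le (Measure.restrict_le_self (μ := volume) (s := D)) hφm
    hφ0 hφq hp hpn hn
  set V := 2 ^ finrank ℝ E * volume.real (ball (0 : E) 1) with hV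
  have hV0 : 0 ≤ V := by positivity
  refine ⟨V + C, by positivity, fun G x τ δ H hG hτ hδ hs hH hG1 hball => ?_⟩
  have hp0 : 0 < p := by linarith
  have hq0 : 0 ≤ 1 - 1 / p := by
    rw [sub_nonneg, div_le_one hp0]
    exact hp
  have hball' : ∀ r, 0 < r → ∫⁻ y in ball x r, ‖G y‖ₑ ∂(volume.restrict D) ≤
      ENNReal.ofReal τ * volume (ball x r) := fun r hr => by
    refine (lintegral_enorm_le_rpow_mul hG hp _).trans ?_
    calc _ ≤ (ENNReal.ofReal (τ ^ p) * volume (ball x r)) ^ (1 / p) *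
          volume (ball x r) ^ (1 - 1 / p) := by
          gcongr
          · exact hball r hr
          · exact Measure.restrict_le_self
      _ = _ := by
          rw [ENNReal.mul_rpow_of_nonneg _ _ (by positivity), mul_assoc,
            ← ENNReal.rpow_add _ _ (measure_ball_pos _ _ hr).ne' measure_ball_lt_top.ne,
            ← ENNReal.ofReal_rpow_of_nonneg hτ hp0.le, ← ENNReal.rpow_mul, mul_one_div_cancel hp0.ne',
            ENNReal.rpow_one, add_sub_cancel, ENNReal.rpow_one]
  have hH0 : 0 ≤ H := hH.trans' (tsum_nonneg fun k => by
    have := hφ0 (δ / 2 ^ (k + 1)) (by positivity)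
    positivity)
  have hφδ := hφ0 δ hδ
  have hnear := lintegral_near_le hφm hφ0 hτ hδ (ν := volume.restrict D)
    (le_antisymm ((Measure.restrict_apply_le _ _).trans_eq (measure_singleton _)) zero_le) hball' hs hH
  rw [modifiedRiesz, ← lintegral_add_compl _ (measurableSet_ball (x := x) (ε := δ))]
  refine (add_le_add hnear (hfar G x δ hG hδ hG1)).trans ?_
  rw [← ENNReal.ofReal_add (by positivity) (by positivity)]
  refine ENNReal.ofReal_le_ofReal ?_
  have h1 : 0 ≤ V * ((φ δ ^ (finrank ℝ E - 1))⁻¹ * δ ^ ((finrank ℝ E : ℝ) * (1 - 1 / p))) := by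
    positivity
  have h2 : 0 ≤ C * (H * τ) := by positivity
  linarith

end Splitting

/-! ### Orlicz functions and medians -/

section Orlicz

theorem IsNFunction.map_zero {H : ℝ → ℝ} (hH : IsNFunction H) : H 0 = 0 := by
  have h1 : Tendsto H (𝓝[>] 0) (𝓝 (H 0)) :=
    (hH.continuousOn 0 self_mem_Ici).mono_left (nhdsWithin_mono _ Ioi_subset_Ici_self)
  have h2 : Tendsto (fun t => H t / t * t) (𝓝[>] 0) (𝓝 (0 * 0)) :=
    hH.tendsto_zero.mul (tendsto_id.mono_left nhdsWithin_le_nhds)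
  rw [zero_mul] at h2
  refine tendsto_nhds_unique h1 (h2.congr' ?_)
  filter_upwards [self_mem_nhdsWithin] with t ht
  rw [div_mul_cancel₀ _ (ne_of_gt ht)]

theorem IsNFunction.pos {H : ℝ → ℝ} (hH : IsNFunction H) {t : ℝ} (ht : 0 < t) : 0 < H t := by
  rw [← hH.map_zero]
  exact hH.strictMonoOn self_mem_Ici ht.le ht

theorem IsNFunction.map_div_le {H : ℝ → ℝ} (hH : IsNFunction H) {t A : ℝ} (ht : 0 ≤ t)
    (hA : 1 ≤ A) : H (t / A) ≤ H t / A := by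
  have hA0 : 0 < A := by linarith
  have h := hH.convexOn.2 (mem_Ici.2 ht) (self_mem_Ici (a := (0 : ℝ)))
    (by positivity : 0 ≤ 1 / A) (by rw [sub_nonneg, div_le_one hA0]; exact hA : 0 ≤ 1 - 1 / A) (by ring)
  simp only [smul_eq_mul, mul_zero, add_zero, hH.map_zero] at h
  rwa [one_div_mul_eq_div, one_div_mul_eq_div] at h

theorem IsNFunction.mul_le_map {H : ℝ → ℝ} (hH : IsNFunction H) {t : ℝ} (ht : 1 ≤ t) :
    t * H 1 ≤ H t := by
  have := hH.map_div_le (t := t) (A := t) (by linarith) ht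
  rw [div_self (by linarith : t ≠ 0), le_div_iff₀ (by linarith)] at this
  linarith

theorem IsNFunction.measurable_comp {X : Type*} [MeasurableSpace X] {H : ℝ → ℝ}
    (hH : IsNFunction H) {f : X → ℝ} (hf : Measurable f) (hf0 : ∀ x, 0 ≤ f x) :
    Measurable fun x => H (f x) := by
  have h1 : Continuous fun t : ℝ => H (max t 0) :=
    hH.continuousOn.comp_continuous (by fun_prop) fun t => mem_Ici.2 (le_max_right _ _)
  simpa only [Function.comp_def, max_eq_left (hf0 _)] using h1.measurable.comp hf

/-- The median is the infimum of the levels `t` with `μ {t < u}` at most half the mass. Continuity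
of the measure makes this set of levels nonempty and bounded below, and transfers the estimates to
the infimum. -/
theorem exists_median {X : Type*} [MeasurableSpace X] (μ : Measure X) [IsFiniteMeasure μ]
    {u : X → ℝ} (hu : Measurable u) :
    ∃ m, μ {x | m < u x} ≤ μ univ / 2 ∧ μ {x | u x < m} ≤ μ univ / 2 := by
  rcases eq_or_ne (μ univ) 0 with h0 | h0
  · exact ⟨0, (measure_mono (subset_univ _)).trans (by simp [h0]),
      (measure_mono (subset_univ _)).trans (by simp [h0])⟩
  have hfin : μ univ ≠ ⊤ := measure_ne_top _ _
  have hhalf0 : 0 < μ univ / 2 := ENNReal.half_pos h0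
  have hhalf : μ univ / 2 < μ univ := ENNReal.half_lt_self h0 hfin
  set T := {t : ℝ | μ {x | t < u x} ≤ μ univ / 2} with hT
  have hTup : ∀ s t, s ∈ T → s ≤ t → t ∈ T := fun s t hs hst =>
    (measure_mono fun x (hx : t < u x) => hst.trans_lt hx).trans hs
  have hTne : T.Nonempty := by
    have h1 : Tendsto (fun k : ℕ => μ {x | (k : ℝ) < u x}) atTop (𝓝 (μ (⋂ k : ℕ, {x | (k : ℝ) < u x}))) :=
      tendsto_measure_iInter_atTop (fun k => (measurableSet_lt measurable_const hu).nullMeasurableSet)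
        (fun i j hij x (hx : (j : ℝ) < u x) => lt_of_le_of_lt (by exact_mod_cast hij) hx)
        ⟨0, measure_ne_top _ _⟩
    have h2 : (⋂ k : ℕ, {x | (k : ℝ) < u x}) = ∅ := by
      ext x
      obtain ⟨k, hk⟩ := exists_nat_ge (u x)
      simp only [mem_iInter, mem_ofPred_eq, mem_empty_iff_false, iff_false, not_forall, not_lt]
      exact ⟨k, hk⟩
    rw [h2, measure_empty] at h1
    obtain ⟨k, hk⟩ := (h1.eventually (gt_mem_nhds hhalf0)).exists
    exact ⟨k, hk.le⟩
  have hTbdd : BddBelow T := by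
    have h1 : Tendsto (fun k : ℕ => μ {x | -(k : ℝ) < u x}) atTop
        (𝓝 (μ (⋃ k : ℕ, {x | -(k : ℝ) < u x}))) :=
      tendsto_measure_iUnion_atTop fun i j hij x (hx : -(i : ℝ) < u x) =>
        lt_of_le_of_lt (neg_le_neg (by exact_mod_cast hij)) hx
    have h2 : (⋃ k : ℕ, {x | -(k : ℝ) < u x}) = univ := by
      refine eq_univ_of_forall fun x => ?_
      obtain ⟨k, hk⟩ := exists_nat_gt (-u x)
      exact mem_iUnion.2 ⟨k, neg_lt.1 hk⟩
    rw [h2] at h1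
    obtain ⟨k, hk⟩ := (h1.eventually (lt_mem_nhds hhalf)).exists
    refine ⟨-k, fun t ht => ?_⟩
    by_contra! h
    exact absurd (hTup t _ ht h.le) (not_le.2 hk)
  have hseq : Tendsto (fun k : ℕ => 1 / ((k : ℝ) + 1)) atTop (𝓝 0) :=
    tendsto_one_div_add_atTop_nhds_zero_nat
  refine ⟨sInf T, ?_, ?_⟩
  · have h1 : {x | sInf T < u x} = ⋃ k : ℕ, {x | sInf T + 1 / ((k : ℝ) + 1) < u x} := by
      ext x
      simp only [mem_ofPred_eq, mem_iUnion]
      refine ⟨fun hx => ?_, fun ⟨k, hk⟩ => lt_trans (lt_add_of_pos_right _ (by positivity)) hk⟩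
      obtain ⟨k, hk⟩ := (hseq.eventually (gt_mem_nhds (sub_pos.2 hx))).exists
      exact ⟨k, by linarith⟩
    rw [h1, Monotone.measure_iUnion]
    · refine iSup_le fun k => ?_
      obtain ⟨t, ht, htk⟩ := exists_lt_of_csInf_lt hTne
        (lt_add_of_pos_right (sInf T) (by positivity : 0 < 1 / ((k : ℝ) + 1)))
      exact hTup t _ ht htk.le
    · intro i j hij x hx
      refine lt_of_le_of_lt ?_ (show sInf T + 1 / ((i : ℝ) + 1) < u x from hx)
      gcongr
  · have h1 : {x | u x < sInf T} = ⋃ k : ℕ, {x | u x ≤ sInf T - 1 / ((k : ℝ) + 1)} := by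
      ext x
      simp only [mem_ofPred_eq, mem_iUnion]
      refine ⟨fun hx => ?_, fun ⟨k, hk⟩ => lt_of_le_of_lt hk (sub_lt_self _ (by positivity))⟩
      obtain ⟨k, hk⟩ := (hseq.eventually (gt_mem_nhds (sub_pos.2 hx))).exists
      exact ⟨k, by linarith⟩
    rw [h1, Monotone.measure_iUnion]
    · refine iSup_le fun k => ?_
      set t := sInf T - 1 / ((k : ℝ) + 1) with ht
      have h2 : t ∉ T := fun h => absurd (csInf_le hTbdd h)
        (not_le.2 (sub_lt_self _ (by positivity)))
      rw [hT, mem_ofPred_eq, not_le] at h2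
      have h3 : {x | u x ≤ t} = {x | t < u x}ᶜ := by ext; simp
      rw [h3, measure_compl (measurableSet_lt measurable_const hu) (measure_ne_top _ _),
        tsub_le_iff_right]
      calc μ univ = μ univ / 2 + μ univ / 2 := (ENNReal.add_halves _).symm
        _ ≤ _ := by gcongr
    · intro i j hij x hx
      refine (show u x ≤ sInf T - 1 / ((i : ℝ) + 1) from hx).trans ?_
      gcongr

/-- The weak type estimate involves an unknown constant `c`. If `c` is below the midpoint of `[a,
b]`, the truncation is far from `c` on `{u > b}`. Otherwise it is far from `c` on `{u ≤ a}`, which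
carries at least half the mass and hence at least as much as `{u > b}`. -/
theorem measure_le_measure_abs_sub_ge {X : Type*} [MeasurableSpace X] {μ : Measure X}
    [IsFiniteMeasure μ] {u : X → ℝ} (hu : Measurable u) {a b : ℝ} (hab : a ≤ b)
    (ha : μ {x | a < u x} ≤ μ univ / 2) (c : ℝ) :
    μ {x | b < u x} ≤ μ {x | (b - a) / 2 ≤ |max a (min (u x) b) - c|} := by
  rcases le_total c ((a + b) / 2) with hc | hc
  · refine measure_mono fun x (hx : b < u x) => ?_
    rw [mem_ofPred_eq, min_eq_right hx.le, max_eq_right hab]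
    exact le_trans (by linarith) (le_abs_self _)
  · have h1 : {x | u x ≤ a} ⊆ {x | (b - a) / 2 ≤ |max a (min (u x) b) - c|} := by
      intro x (hx : u x ≤ a)
      rw [mem_ofPred_eq, max_eq_left ((min_le_left _ _).trans hx), abs_sub_comm]
      exact le_trans (by linarith) (le_abs_self _)
    refine le_trans ?_ (measure_mono h1)
    have h2 : {x | u x ≤ a} = {x | a < u x}ᶜ := by ext; simp
    rw [h2, measure_compl (measurableSet_lt measurable_const hu) (measure_ne_top _ _)]
    refine ENNReal.le_sub_of_add_le_right (measure_ne_top _ _) ?_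
    calc _ ≤ μ univ / 2 + μ univ / 2 :=
          add_le_add ((measure_mono fun x (hx : b < u x) => hab.trans_lt hx).trans ha) ha
      _ = _ := ENNReal.add_halves _

/-- If the mean deviation of `u` from some constant is controlled in `L^H`, then so is the deviation
from the average. -/
theorem IsNFunction.lintegral_sub_average_le {X : Type*} [MeasurableSpace X] {μ : Measure X}
    [IsFiniteMeasure μ] {H : ℝ → ℝ} (hH : IsNFunction H) {u : X → ℝ} (hu : Measurable u)
    {m Λ A : ℝ} (hΛ : 0 < Λ) (hA : 1 ≤ A)
    (h : ∫⁻ x, ENNReal.ofReal (H (|u x - m| / Λ)) ∂μ ≤ ENNReal.ofReal A) :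
    Integrable u μ ∧
      ∫⁻ x, ENNReal.ofReal (H (|u x - ⨍ y, u y ∂μ| / (2 * Λ * A))) ∂μ ≤ 1 := by
  have hA0 : 0 < A := by linarith
  set f : X → ℝ := fun x => |u x - m| / Λ with hf
  have hfm : Measurable f := by fun_prop
  have hf0 (x : X) : 0 ≤ f x := by positivity
  have hHf0 (x : X) : 0 ≤ H (f x) := hH.nonneg _ (hf0 x)
  have hHf : Integrable (fun x => H (f x)) μ :=
    ⟨(hH.measurable_comp hfm hf0).aestronglyMeasurable, by
      rw [hasFiniteIntegral_iff_ofReal (ae_of_all _ hHf0)]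
      exact h.trans_lt ENNReal.ofReal_lt_top⟩
  have hHfA : ∫ x, H (f x) ∂μ ≤ A := by
    rw [integral_eq_lintegral_of_nonneg_ae (ae_of_all _ hHf0) hHf.1]
    exact ENNReal.toReal_le_of_le_ofReal hA0.le h
  have hfi : Integrable f μ := by
    refine ((hHf.const_mul (H 1)⁻¹).add (integrable_const 1)).mono' hfm.aestronglyMeasurable
      (ae_of_all _ fun x => ?_)
    have h1 := hH.pos one_pos
    rw [Real.norm_of_nonneg (hf0 x)]
    simp only [Pi.add_apply]
    rcases le_total (f x) 1 with h2 | h2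
    · have : 0 ≤ (H 1)⁻¹ * H (f x) := mul_nonneg (by positivity) (hHf0 x)
      linarith
    · have := hH.mul_le_map h2
      rw [← le_div_iff₀ h1, div_eq_inv_mul] at this
      linarith
  have hui : Integrable u μ := by
    have h1 : Integrable (fun x => |u x - m|) μ := by
      refine (hfi.mul_const Λ).congr (ae_of_all _ fun x => ?_)
      exact div_mul_cancel₀ _ hΛ.ne'
    have h2 : Integrable (fun x => u x - m) μ :=
      (integrable_norm_iff (by fun_prop)).1 h1
    exact (h2.add (integrable_const m)).congr (ae_of_all _ fun x => sub_add_cancel _ _)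
  refine ⟨hui, ?_⟩
  rcases eq_or_ne μ 0 with h0 | h0
  · simp [h0]
  have : NeZero μ := ⟨h0⟩
  set ū := ⨍ y, u y ∂μ with hū
  have hM : 0 < μ.real univ := measureReal_univ_pos
  have hdev : |ū - m| / Λ ≤ ⨍ x, f x ∂μ := by
    have h1 : ū - m = ⨍ x, (u x - m) ∂μ := by
      rw [hū, average_eq, average_eq, integral_sub hui (integrable_const _), integral_const,
        smul_sub, smul_smul, inv_mul_cancel₀ hM.ne', one_smul]
    rw [h1, hf, average_eq, average_eq, integral_div, smul_eq_mul, smul_eq_mul, abs_mul,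
      abs_of_pos (inv_pos.2 hM), mul_div_assoc]
    gcongr
    exact abs_integral_le_integral_abs
  have hjen : H (|ū - m| / Λ) ≤ (μ.real univ)⁻¹ * A := by
    have h1 : 0 ≤ ⨍ x, f x ∂μ := le_trans (by positivity) hdev
    refine (hH.strictMonoOn.monotoneOn (mem_Ici.2 (by positivity)) h1 hdev).trans ?_
    refine (hH.convexOn.map_average_le hH.continuousOn isClosed_Ici (ae_of_all _ hf0) hfi
      hHf).trans ?_
    rw [average_eq, smul_eq_mul]
    gcongr
  -- Convexity halves the two contributions `|u - m|` and `|ū - m|`, and `H(t/A) ≤ H(t)/A` extracts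
  -- the factor `1/A`. Each contribution then integrates to at most `1/2`.
  have hpt (x : X) : H (|u x - ū| / (2 * Λ * A)) ≤
      (H (f x) / 2 + (μ.real univ)⁻¹ * A / 2) / A := by
    have h1 : |u x - ū| / (2 * Λ) ≤ 1 / 2 * f x + 1 / 2 * (|ū - m| / Λ) := by
      have := abs_sub_le (u x) m ū
      rw [abs_sub_comm m ū] at this
      rw [hf]
      field_simp
      linarith
    have h2 := hH.convexOn.2 (mem_Ici.2 (hf0 x)) (mem_Ici.2 (by positivity : 0 ≤ |ū - m| / Λ))
      (by norm_num : (0 : ℝ) ≤ 1 / 2) (by norm_num : (0 : ℝ) ≤ 1 / 2) (by norm_num)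
    simp only [smul_eq_mul] at h2
    rw [← div_div]
    refine (hH.map_div_le (by positivity) hA).trans ?_
    gcongr
    refine (hH.strictMonoOn.monotoneOn (mem_Ici.2 (by positivity))
      (mem_Ici.2 (by have := hf0 x; positivity)) h1).trans (h2.trans ?_)
    linarith
  have hint : Integrable (fun x => (H (f x) / 2 + (μ.real univ)⁻¹ * A / 2) / A) μ :=
    ((hHf.div_const 2).add (integrable_const _)).div_const A
  calc _ ≤ ∫⁻ x, ENNReal.ofReal ((H (f x) / 2 + (μ.real univ)⁻¹ * A / 2) / A) ∂μ :=
        lintegral_mono fun x => ENNReal.ofReal_le_ofReal (hpt x)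
    _ = ENNReal.ofReal (∫ x, (H (f x) / 2 + (μ.real univ)⁻¹ * A / 2) / A ∂μ) := by
        refine (ofReal_integral_eq_lintegral_ofReal hint (ae_of_all _ fun x => ?_)).symm
        have := hHf0 x
        positivity
    _ ≤ ENNReal.ofReal 1 := by
        refine ENNReal.ofReal_le_ofReal ?_
        rw [integral_div, integral_add (hHf.div_const 2) (integrable_const _), integral_div,
          integral_const, smul_eq_mul, div_le_one hA0]
        have : μ.real univ * ((μ.real univ)⁻¹ * A / 2) = A / 2 := by field_simp
        linarith
    _ = 1 := ENNReal.ofReal_one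

end Orlicz

/-! ### The Orlicz estimate for functions with a weak gradient in `L^p` -/

section OrliczEstimate

theorem IsStrictGauge.pos {φ : ℝ → ℝ} (hφ : IsStrictGauge φ) {t : ℝ} (ht : 0 < t) : 0 < φ t :=
  (hφ.nonneg 0 le_rfl).trans_lt (hφ.strictMonoOn self_mem_Ici ht.le ht)

/-- Comparison with the endpoint `M` handles positive `s`. At `s = 0` a limit is taken, which forces
`φ 0 = 0`. -/
theorem HasAlmostIncreasingQuotient.exists_le_mul {φ : ℝ → ℝ} (hφ : IsStrictGauge φ)
    (hφq : HasAlmostIncreasingQuotient φ) {M : ℝ} (hM : 0 < M) :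
    ∃ A, ∀ s ∈ Icc 0 M, φ s ≤ A * s := by
  obtain ⟨Q, hQ⟩ := hφq
  have h1 : ∀ s, 0 < s → s ≤ M → φ s ≤ Q * (φ M / M) * s := fun s hs hsM =>
    (div_le_iff₀ hs).1 (hQ s M hs hsM)
  refine ⟨Q * (φ M / M), fun s hs => ?_⟩
  rcases hs.1.eq_or_lt with rfl | h0
  · rw [mul_zero]
    have h2 : Tendsto (fun s => Q * (φ M / M) * s) (𝓝[>] 0) (𝓝 (Q * (φ M / M) * 0)) :=
      (tendsto_id.mono_left nhdsWithin_le_nhds).const_mul _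
    rw [mul_zero] at h2
    refine ge_of_tendsto h2 ?_
    filter_upwards [Ioc_mem_nhdsGT hM] with s hs
    exact (hφ.strictMonoOn self_mem_Ici hs.1.le hs.1).le.trans (h1 s hs.1 hs.2)
  · exact h1 s h0 hs.2

variable {D : Set E}

theorem exists_abs_sub_le_modifiedRiesz (hD : IsOpen D) (hDb : Bornology.IsBounded D)
    (hn : 2 ≤ finrank ℝ E) {φ : ℝ → ℝ} (hφ : IsStrictGauge φ) (hφ2 : IsDeltaTwo φ)
    (hφq : HasAlmostIncreasingQuotient φ) {c : ℝ} (hc : 0 < c) {x₀ : E}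
    (hJ : IsJohnWith φ D c x₀) :
    ∃ C : ℝ, 0 < C ∧ ∀ w G, IsWeakGradient D w G → ∃ d : ℝ, ∀ᵐ x, x ∈ D →
      ENNReal.ofReal |w x - d| ≤ ENNReal.ofReal C * modifiedRiesz φ D G x := by
  have : Nontrivial E := Module.nontrivial_of_finrank_pos (R := ℝ) (by omega)
  have hDc : Dᶜ.Nonempty := by
    rw [nonempty_compl]
    rintro rfl
    exact NormedSpace.unbounded_univ ℝ E hDb
  obtain ⟨z, hz⟩ := hDc
  obtain ⟨M, hM⟩ := hDb.subset_closedBall z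
  have hM' : ∀ x ∈ D, infDist x Dᶜ ≤ max M 1 := fun x hx =>
    (infDist_le_dist_of_mem hz).trans ((mem_closedBall.1 (hM hx)).trans (le_max_left _ _))
  obtain ⟨A, hA⟩ := hφq.exists_le_mul hφ (lt_max_of_lt_right one_pos : 0 < max M 1)
  obtain ⟨K, hK⟩ := hφ2
  have hφ0 : φ 0 = 0 := by
    have := hA 0 ⟨le_rfl, by positivity⟩
    rw [mul_zero] at this
    exact le_antisymm this (hφ.nonneg 0 le_rfl)
  have hK0 : 0 < K := by
    have h1 := hK 1 one_pos
    have h2 := hφ.pos (by norm_num : (0 : ℝ) < 2 * 1)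
    have h3 := hφ.pos one_pos
    by_contra! h
    nlinarith
  obtain ⟨C, hC, h⟩ := exists_abs_sub_mean_le_modifiedRiesz hD ⟨z, hz⟩ hn (φ := φ)
    (A := max 1 (max A (K * K))) (c := c) (M := max M 1) hφ.strictMonoOn.monotoneOn
    (le_max_left _ _) hc (fun t ht => by
      rcases ht.eq_or_lt with rfl | ht
      · simp [hφ0]
      · have h1 := hK t ht
        have h2 := hK (2 * t) (by positivity)
        rw [show 4 * t = 2 * (2 * t) by ring]
        calc _ ≤ K * (K * φ t) := h2.trans (by gcongr)
          _ = K * K * φ t := by ring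
          _ ≤ _ := by
            have := (hφ.pos ht).le
            gcongr
            exact (le_max_right _ _).trans (le_max_right _ _))
    (fun s hs => (hA s hs).trans (by
      have := hs.1
      gcongr
      exact (le_max_left _ _).trans (le_max_right _ _)))
    hM' hJ
  refine ⟨C.toReal + 1, by positivity, fun w G hw =>
    ⟨∫ y, w y * mollifier (chainRadius D x₀) (y - x₀), ?_⟩⟩
  filter_upwards [h w G hw] with x hx hxD
  refine (hx hxD).trans ?_
  gcongr
  rw [ENNReal.le_ofReal_iff_toReal_le hC (by positivity)]
  linarith

/-- A weak type estimate: the superlevel sets of `|w - d|` are controlled by the energy of `w`. -/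
theorem exists_mul_measure_abs_sub_ge_le (hD : IsOpen D) (hDb : Bornology.IsBounded D)
    (hn : 2 ≤ finrank ℝ E) {p : ℝ} (hp : 1 ≤ p) (hpn : p < finrank ℝ E) {φ h H : ℝ → ℝ}
    (hφ : IsStrictGauge φ) (hφ2 : IsDeltaTwo φ) (hφq : HasAlmostIncreasingQuotient φ)
    (hh : DominatesDyadicSum (finrank ℝ E) φ h) (hH : IsNFunction H)
    (hgrowth : SatisfiesGrowthCondition (finrank ℝ E) p φ h H) {c : ℝ} (hc : 0 < c) {x₀ : E}
    (hJ : IsJohnWith φ D c x₀) :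
    ∃ K B : ℝ, 0 < K ∧ 0 < B ∧ ∀ w G, IsWeakGradient D w G →
      AEStronglyMeasurable G (volume.restrict D) → ∫⁻ y in D, ‖G y‖ₑ ^ p ≤ 1 →
      ∃ d : ℝ, ∀ s, 0 < s → ENNReal.ofReal (H (s / K)) *
        (volume.restrict D) {x | s ≤ |w x - d|} ≤ ENNReal.ofReal B * ∫⁻ y in D, ‖G y‖ₑ ^ p := by
  obtain ⟨C₁, hC₁, h1⟩ := exists_abs_sub_le_modifiedRiesz hD hDb hn hφ hφ2 hφq hc hJ
  obtain ⟨Q, hQ⟩ := hφq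
  obtain ⟨C₂, hC₂, h2⟩ := exists_modifiedRiesz_le (E := E) (D := D) hφ.strictMonoOn.monotoneOn
    (fun t ht => hφ.pos ht) hQ hp hpn (by omega)
  obtain ⟨δ, hδ, -, C₃, h3⟩ := hgrowth
  have hp0 : 0 < p := by linarith
  set L := max C₃ 1 with hL
  have hL0 : 0 < L := lt_max_of_lt_right one_pos
  set B : ℝ := 4 ^ finrank ℝ E * (2 * L) with hB
  refine ⟨C₁ * C₂, B, by positivity, by positivity, fun w G hw hGm hG1 => ?_⟩
  obtain ⟨d, hd⟩ := h1 w G hw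
  refine ⟨d, fun s hs => ?_⟩
  set K := C₁ * C₂ with hK
  have hK0 : 0 < K := by positivity
  have hHs : 0 < H (s / K) := hH.pos (by positivity)
  -- The threshold for the maximal function of `‖G‖^p`. The factor `2` makes the growth condition
  -- give `H S ≤ H (s / K) / 2`, hence the strict inequality `S < s / K`.
  set σ := H (s / K) / (2 * L) with hσ
  have hσ0 : 0 < σ := by positivity
  set τ := σ ^ (1 / p) with hτ
  have hτ0 : 0 < τ := by positivity
  have hτp : τ ^ p = σ := by
    rw [hτ, ← Real.rpow_mul hσ0.le, one_div_mul_cancel hp0.ne', Real.rpow_one]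
  set S := h (δ τ) * τ + (φ (δ τ) ^ (finrank ℝ E - 1))⁻¹ *
    δ τ ^ ((finrank ℝ E : ℝ) * (1 - 1 / p)) with hS
  have hδτ := hδ τ hτ0
  have hS0 : 0 ≤ S := by
    have h4 := hh.nonneg (δ τ) hδτ.le
    have h5 := hφ.pos hδτ
    positivity
  have hSlt : S < s / K := by
    by_contra! hle
    have h4 := hH.strictMonoOn.monotoneOn (mem_Ici.2 (by positivity)) hS0 hle
    have h5 : H S ≤ L * σ := (h3 τ hτ0).trans (by rw [hτp]; gcongr; exact le_max_left _ _)
    have h6 : L * σ = H (s / K) / 2 := by rw [hσ]; field_simp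
    linarith
  set m := (volume.restrict D).withDensity fun y => ‖G y‖ₑ ^ p with hm
  have hmS (T : Set E) (hT : MeasurableSet T) : m T = ∫⁻ y in T, ‖G y‖ₑ ^ p ∂volume.restrict D :=
    withDensity_apply _ hT
  -- If every ball around `x` had mean of `‖G‖^p` at most `σ`, the pointwise bound and the splitting
  -- would give `|w x - d| ≤ K S < s`. So the superlevel set lies in the set where the maximal
  -- function exceeds `σ`.
  have hsub : ∀ᵐ x, x ∈ D → s ≤ |w x - d| →
      ∃ r, 0 < r ∧ ENNReal.ofReal σ * volume (ball x r) < m (ball x r) := by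
    filter_upwards [hd] with x hx hxD hsx
    by_contra! hno
    have h4 := h2 G x τ (δ τ) (h (δ τ)) hGm hτ0.le hδτ (hh.summable _ hδτ) (hh.tsum_le _ hδτ) hG1
      fun r hr => by
        rw [← hmS _ measurableSet_ball, hτp]
        exact hno r hr
    have h5 := (hx hxD).trans (mul_le_mul_right h4 _)
    rw [← ENNReal.ofReal_mul hC₁.le, ← mul_assoc, ENNReal.ofReal_le_ofReal_iff (by positivity)] at h5
    rw [lt_div_iff₀ hK0] at hSlt
    linarith
  have hσ0' : ENNReal.ofReal σ ≠ 0 := (ENNReal.ofReal_pos.2 hσ0).ne'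
  have hmeas : (volume.restrict D) {x | s ≤ |w x - d|} ≤
      4 ^ finrank ℝ E * ((ENNReal.ofReal σ)⁻¹ * m univ) := by
    refine le_trans ?_ (volume_setOf_lt_measure_ball_le (by omega) m hσ0' ENNReal.ofReal_ne_top)
    refine le_trans (measure_mono_ae ?_) (Measure.restrict_apply_le D _)
    exact (ae_restrict_iff' hD.measurableSet).2 hsub
  calc _ ≤ ENNReal.ofReal (H (s / K)) * (4 ^ finrank ℝ E * ((ENNReal.ofReal σ)⁻¹ * m univ)) := by
        gcongr
    _ = ENNReal.ofReal B * ∫⁻ y in D, ‖G y‖ₑ ^ p := by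
        rw [hmS _ MeasurableSet.univ, Measure.restrict_univ, ← mul_assoc, ← mul_assoc,
          ← ENNReal.ofReal_inv_of_pos hσ0, show (4 : ENNReal) = ENNReal.ofReal 4 by norm_num,
          ← ENNReal.ofReal_pow (by norm_num), ← ENNReal.ofReal_mul hHs.le,
          ← ENNReal.ofReal_mul (by positivity)]
        congr 2
        rw [hσ, hB]
        field_simp

theorem IsWeakGradient.neg {u : E → ℝ} {g : E → E} (h : IsWeakGradient D u g) :
    IsWeakGradient D (fun x => -u x) (fun x => -g x) where
  locallyIntegrableOn := h.locallyIntegrableOn.neg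
  locallyIntegrableOn_gradient := h.locallyIntegrableOn_gradient.neg
  integral_fderiv v ψ hψ := by
    have := h.integral_fderiv v ψ hψ
    simp only [neg_mul, inner_neg_left, integral_neg, this]

theorem IsWeakGradient.const_mul {u : E → ℝ} {g : E → E} (h : IsWeakGradient D u g) (c : ℝ) :
    IsWeakGradient D (fun x => c * u x) (fun x => c • g x) where
  locallyIntegrableOn := fun x hx => by
    obtain ⟨s, hs, hi⟩ := h.locallyIntegrableOn x hx
    exact ⟨s, hs, hi.smul c⟩
  locallyIntegrableOn_gradient := fun x hx => by
    obtain ⟨s, hs, hi⟩ := h.locallyIntegrableOn_gradient x hx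
    exact ⟨s, hs, hi.smul c⟩
  integral_fderiv v ψ hψ := by
    have := h.integral_fderiv v ψ hψ
    simp only [mul_assoc, real_inner_smul_left, integral_const_mul, this, mul_neg]

/-- Summing the weak type estimates of the dyadic truncations of `u` above a median. -/
theorem IsWeakGradient.lintegral_posPart_le (hD : IsOpen D) (hDb : Bornology.IsBounded D) {p : ℝ}
    (hp : 0 < p) {H : ℝ → ℝ} (hH : IsNFunction H) {K B : ℝ} (hK : 0 < K)
    (hKB : ∀ w G, IsWeakGradient D w G →
      AEStronglyMeasurable G (volume.restrict D) → ∫⁻ y in D, ‖G y‖ₑ ^ p ≤ 1 →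
      ∃ d : ℝ, ∀ s, 0 < s → ENNReal.ofReal (H (s / K)) *
        (volume.restrict D) {x | s ≤ |w x - d|} ≤ ENNReal.ofReal B * ∫⁻ y in D, ‖G y‖ₑ ^ p)
    {u : E → ℝ} {g : E → E} (h : IsWeakGradient D u g) (hu : Measurable u)
    (hgm : AEStronglyMeasurable g (volume.restrict D)) (hg : ∫⁻ y in D, ‖g y‖ₑ ^ p ≤ 1) {m : ℝ}
    (hm : (volume.restrict D) {x | m < u x} ≤ (volume.restrict D) univ / 2) :
    ∫⁻ x in D, ENNReal.ofReal (H (max (u x - m) 0 / (8 * K))) ≤ ENNReal.ofReal B := by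
  set μ := volume.restrict D with hμ
  have : IsFiniteMeasure μ := ⟨by
    rw [hμ, Measure.restrict_apply_univ]
    exact hDb.measure_lt_top⟩
  -- Dyadic layers above the median. Half-open intervals make them disjoint while still covering `{u
  -- > m}`.
  set T : ℤ → Set E := fun j => u ⁻¹' Ioc (m + 2 ^ j) (m + 2 ^ (j + 1)) with hT
  have hTm (j : ℤ) : MeasurableSet (T j) := hu measurableSet_Ioc
  -- The weak type estimate for the truncation between `m + 2^j` and `m + 2^(j+1)`, at height
  -- `2^(j-1)`, half the gap. Only the energy on the layer `T j` enters.
  have hlevel (j : ℤ) : ENNReal.ofReal (H (2 ^ (j - 1) / K)) * μ {x | m + 2 ^ (j + 1) < u x} ≤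
      ENNReal.ofReal B * ∫⁻ y in T j, ‖g y‖ₑ ^ p ∂μ := by
    set a : ℝ := m + 2 ^ j with ha
    set b : ℝ := m + 2 ^ (j + 1) with hb
    have h2j : (2 : ℝ) ^ (j + 1) = 2 * 2 ^ j := by rw [zpow_add_one₀ two_ne_zero]; ring
    have h2j' : (2 : ℝ) ^ (j - 1) = 2 ^ j / 2 := by rw [zpow_sub_one₀ two_ne_zero]; ring
    have h2 : (0 : ℝ) < 2 ^ j := by positivity
    have hab : a ≤ b := by rw [ha, hb, h2j]; linarith
    have hSm : MeasurableSet (u ⁻¹' Ioo a b) := hu measurableSet_Ioo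
    have henorm (y : E) : ‖(u ⁻¹' Ioo a b).indicator g y‖ₑ ^ p =
        (u ⁻¹' Ioo a b).indicator (fun y => ‖g y‖ₑ ^ p) y := by
      by_cases hy : y ∈ u ⁻¹' Ioo a b <;> simp [hy, hp]
    have hint : ∫⁻ y, ‖(u ⁻¹' Ioo a b).indicator g y‖ₑ ^ p ∂μ =
        ∫⁻ y in u ⁻¹' Ioo a b, ‖g y‖ₑ ^ p ∂μ := by
      simp_rw [henorm, lintegral_indicator hSm]
    obtain ⟨d, hd⟩ := hKB _ _ (h.truncate hD hu hab) (hgm.indicator hSm)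
      (by rw [hint]; exact (setLIntegral_le_lintegral _ _).trans hg)
    have h3 := hd (2 ^ (j - 1)) (by positivity)
    rw [hint] at h3
    have ham : μ {x | a < u x} ≤ μ univ / 2 :=
      (measure_mono fun x (hx : a < u x) => (lt_add_of_pos_right m h2).trans hx).trans hm
    have h4 := measure_le_measure_abs_sub_ge hu hab ham d
    have h5 : (b - a) / 2 = 2 ^ (j - 1) := by rw [ha, hb, h2j, h2j']; ring
    rw [h5] at h4
    calc _ ≤ _ := mul_le_mul_right h4 _
      _ ≤ _ := h3
      _ ≤ _ := mul_le_mul_right (lintegral_mono_set (preimage_mono Ioo_subset_Ioc_self)) _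
  have hcov (x : E) (hx : m < u x) : ∃ j, x ∈ T (j + 1) := by
    obtain ⟨j, hj, hj'⟩ := exists_mem_Ioc_zpow (sub_pos.2 hx) (one_lt_two (α := ℝ))
    exact ⟨j - 1, by rw [sub_add_cancel]; exact ⟨by linarith, by linarith⟩⟩
  have hdisj : Pairwise (Function.onFun Disjoint T) := by
    intro i j hij
    rw [Function.onFun, Set.disjoint_left]
    rintro x ⟨h1, h2⟩ ⟨h3, h4⟩
    have h5 : (2 : ℝ) ^ i < 2 ^ (j + 1) := by linarith
    have h6 : (2 : ℝ) ^ j < 2 ^ (i + 1) := by linarith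
    rw [zpow_lt_zpow_iff_right₀ one_lt_two] at h5 h6
    omega
  have hstep (j : ℤ) : ∫⁻ x in T (j + 1), ENNReal.ofReal (H (max (u x - m) 0 / (8 * K))) ∂μ ≤
      ENNReal.ofReal B * ∫⁻ y in T j, ‖g y‖ₑ ^ p ∂μ := by
    refine le_trans ?_ (hlevel j)
    calc _ ≤ ∫⁻ x in T (j + 1), ENNReal.ofReal (H (2 ^ (j - 1) / K)) ∂μ := by
          refine setLIntegral_mono' (hTm _) fun x hx => ENNReal.ofReal_le_ofReal ?_
          refine hH.strictMonoOn.monotoneOn (mem_Ici.2 (by positivity))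
            (mem_Ici.2 (by positivity)) ?_
          -- On `T (j + 1)` the excess is at most `2^(j+2)`, while the available height is
          -- `2^(j-1)`. This is the origin of the constant `8 K`.
          have h1 : u x - m ≤ 8 * 2 ^ (j - 1) := by
            have h2 : (2 : ℝ) ^ (j + 1 + 1) = 8 * 2 ^ (j - 1) := by
              rw [show j + 1 + 1 = 3 + (j - 1) by ring, zpow_add₀ two_ne_zero]
              norm_num
            have := hx.2
            linarith
          rw [← mul_div_mul_left _ K (by norm_num : (8 : ℝ) ≠ 0)]
          gcongr
          exact max_le h1 (by positivity)
      _ = ENNReal.ofReal (H (2 ^ (j - 1) / K)) * μ (T (j + 1)) := setLIntegral_const _ _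
      _ ≤ _ := by
          gcongr
          exact fun x hx => hx.1
  have hzero : ∫⁻ x, ENNReal.ofReal (H (max (u x - m) 0 / (8 * K))) ∂μ ≤
      ∫⁻ x in ⋃ j : ℤ, T (j + 1), ENNReal.ofReal (H (max (u x - m) 0 / (8 * K))) ∂μ := by
    rw [← lintegral_indicator (MeasurableSet.iUnion fun j => hTm _)]
    refine lintegral_mono fun x => ?_
    by_cases hx : x ∈ ⋃ j : ℤ, T (j + 1)
    · rw [indicator_of_mem hx]
    · have h1 : u x - m ≤ 0 := by
        by_contra! h1
        exact hx (mem_iUnion.2 (hcov x (sub_pos.1 h1)))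
      rw [max_eq_right h1, zero_div, hH.map_zero, ENNReal.ofReal_zero]
      exact zero_le
  calc _ ≤ _ := hzero
    _ ≤ _ := lintegral_iUnion_le _ _
    _ ≤ ∑' j : ℤ, ENNReal.ofReal B * ∫⁻ y in T j, ‖g y‖ₑ ^ p ∂μ := ENNReal.tsum_le_tsum hstep
    _ = ENNReal.ofReal B * ∫⁻ y in ⋃ j, T j, ‖g y‖ₑ ^ p ∂μ := by
        rw [ENNReal.tsum_mul_left, lintegral_iUnion hTm hdisj]
    _ ≤ ENNReal.ofReal B * 1 := by
        gcongr
        exact (setLIntegral_le_lintegral _ _).trans hg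
    _ = _ := mul_one _

/-- The Orlicz–Sobolev–Poincaré inequality for a measurable function whose weak gradient has
`L^p`-norm at most one. -/
theorem exists_lintegral_sub_average_le_one (hD : IsOpen D) (hDb : Bornology.IsBounded D)
    (hn : 2 ≤ finrank ℝ E) {p : ℝ} (hp : 1 ≤ p) (hpn : p < finrank ℝ E) {φ h H : ℝ → ℝ}
    (hφ : IsStrictGauge φ) (hφ2 : IsDeltaTwo φ) (hφq : HasAlmostIncreasingQuotient φ)
    (hh : DominatesDyadicSum (finrank ℝ E) φ h) (hH : IsNFunction H)
    (hgrowth : SatisfiesGrowthCondition (finrank ℝ E) p φ h H) {c : ℝ} (hc : 0 < c) {x₀ : E}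
    (hJ : IsJohnWith φ D c x₀) :
    ∃ C : ℝ, 0 < C ∧ ∀ u g, IsWeakGradient D u g → Measurable u →
      AEStronglyMeasurable g (volume.restrict D) → ∫⁻ y in D, ‖g y‖ₑ ^ p ≤ 1 →
      IntegrableOn u D ∧ ∫⁻ x in D, ENNReal.ofReal (H (|u x - ⨍ y in D, u y| / C)) ≤ 1 := by
  obtain ⟨K, B, hK, hB, hKB⟩ := exists_mul_measure_abs_sub_ge_le hD hDb hn hp hpn hφ hφ2 hφq hh hH
    hgrowth hc hJ
  have : IsFiniteMeasure (volume.restrict D) := ⟨by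
    rw [Measure.restrict_apply_univ]
    exact hDb.measure_lt_top⟩
  have hp0 : 0 < p := by linarith
  refine ⟨2 * (8 * K) * max 1 (B + B), by positivity, fun u g h hu hgm hg => ?_⟩
  obtain ⟨m, hm1, hm2⟩ := exists_median (volume.restrict D) hu
  refine hH.lintegral_sub_average_le hu (m := m) (by positivity) (le_max_left _ _) ?_
  have h1 := h.lintegral_posPart_le hD hDb hp0 hH hK hKB hu hgm hg hm1
  -- The part of `u` below the median is the part of `-u` above its median `-m`. Together they give
  -- the total bound `B + B`.
  have h2 := h.neg.lintegral_posPart_le hD hDb hp0 hH hK hKB hu.neg hgm.neg (m := -m)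
    (by simpa using hg) (by simpa using hm2)
  calc _ ≤ ∫⁻ x in D, (ENNReal.ofReal (H (max (u x - m) 0 / (8 * K))) +
        ENNReal.ofReal (H (max (-u x - -m) 0 / (8 * K)))) := by
        refine lintegral_mono fun x => ?_
        rcases le_total m (u x) with hx | hx
        · rw [abs_of_nonneg (sub_nonneg.2 hx), max_eq_left (sub_nonneg.2 hx)]
          exact le_self_add
        · rw [abs_of_nonpos (sub_nonpos.2 hx), neg_sub, max_eq_left (a := -u x - -m) (by linarith),
            neg_sub_neg]
          exact le_add_self
    _ = _ := lintegral_add_left (hH.measurable_comp (by fun_prop) fun x => by positivity).ennreal_ofReal _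
    _ ≤ ENNReal.ofReal B + ENNReal.ofReal B := add_le_add h1 h2
    _ ≤ _ := by
        rw [← ENNReal.ofReal_add hB.le hB.le]
        exact ENNReal.ofReal_le_ofReal (le_max_right _ _)

end OrliczEstimate

/-! ### Scaling and change of representative -/

section Scaling

variable {D : Set E}

theorem IsWeakGradient.congr {u v : E → ℝ} {g : E → E} (h : IsWeakGradient D u g)
    (hD : MeasurableSet D) (huv : u =ᵐ[volume.restrict D] v) : IsWeakGradient D v g where
  locallyIntegrableOn x hx := by
    obtain ⟨s, hs, hi⟩ := h.locallyIntegrableOn x hx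
    exact ⟨s ∩ D, inter_mem hs self_mem_nhdsWithin, (hi.mono_set inter_subset_left).congr
      (ae_restrict_of_ae_restrict_of_subset inter_subset_right huv)⟩
  locallyIntegrableOn_gradient := h.locallyIntegrableOn_gradient
  integral_fderiv w ψ hψ := by
    rw [← h.integral_fderiv w ψ hψ]
    refine integral_congr_ae ?_
    filter_upwards [(ae_restrict_iff' hD).1 huv] with x hx
    by_cases hxD : x ∈ D
    · rw [hx hxD]
    · have := image_eq_zero_of_notMem_tsupport
        fun hxt => hxD ((hψ.fderiv_apply w).tsupport_subset hxt)
      rw [this, mul_zero, mul_zero]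

theorem lintegral_enorm_rpow_le_one {X F : Type*} [MeasurableSpace X] [NormedAddCommGroup F]
    {μ : Measure X} {G : X → F} {p : ℝ} (hp : 0 < p) (h : eLpNorm G (ENNReal.ofReal p) μ ≤ 1) :
    ∫⁻ x, ‖G x‖ₑ ^ p ∂μ ≤ 1 := by
  rw [eLpNorm_eq_lintegral_rpow_enorm_toReal (ENNReal.ofReal_pos.2 hp).ne' ENNReal.ofReal_ne_top,
    ENNReal.toReal_ofReal hp.le] at h
  have := ENNReal.rpow_le_one h hp.le
  rwa [← ENNReal.rpow_mul, one_div_mul_cancel hp.ne', ENNReal.rpow_one] at this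

/-- The Orlicz–Sobolev–Poincaré inequality for functions with a weak gradient in `L^p`. -/
theorem exists_lintegral_sub_average_div_le_one (hD : IsOpen D) (hDb : Bornology.IsBounded D)
    (hn : 2 ≤ finrank ℝ E) {p : ℝ} (hp : 1 ≤ p) (hpn : p < finrank ℝ E) {φ h H : ℝ → ℝ}
    (hφ : IsStrictGauge φ) (hφ2 : IsDeltaTwo φ) (hφq : HasAlmostIncreasingQuotient φ)
    (hh : DominatesDyadicSum (finrank ℝ E) φ h) (hH : IsNFunction H)
    (hgrowth : SatisfiesGrowthCondition (finrank ℝ E) p φ h H) {c : ℝ} (hc : 0 < c) {x₀ : E}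
    (hJ : IsJohnWith φ D c x₀) :
    ∃ C : ℝ, 0 < C ∧ ∀ u g, IsWeakGradient D u g → AEStronglyMeasurable g (volume.restrict D) →
      ∀ s, 0 < s → eLpNorm g (ENNReal.ofReal p) (volume.restrict D) ≤ ENNReal.ofReal s →
      IntegrableOn u D ∧
        ∫⁻ x in D, ENNReal.ofReal (H (|u x - ⨍ y in D, u y| / (C * s))) ≤ 1 := by
  obtain ⟨C, hC, hmain⟩ := exists_lintegral_sub_average_le_one hD hDb hn hp hpn hφ hφ2 hφq hh hH
    hgrowth hc hJ
  refine ⟨C, hC, fun u g hug hgm s hs hgs => ?_⟩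
  have hum := hug.locallyIntegrableOn.aestronglyMeasurable
  set v := hum.mk u with hv
  have hvm : Measurable v := hum.stronglyMeasurable_mk.measurable
  have huv : u =ᵐ[volume.restrict D] v := hum.ae_eq_mk
  have hg1 : eLpNorm (fun x => s⁻¹ • g x) (ENNReal.ofReal p) (volume.restrict D) ≤ 1 := by
    refine (eLpNorm_const_smul_le (c := s⁻¹) (f := g)).trans ?_
    rw [Real.enorm_of_nonneg (inv_pos.2 hs).le, ENNReal.ofReal_inv_of_pos hs, mul_comm,
      ← div_eq_mul_inv]
    exact ENNReal.div_le_of_le_mul (by rwa [one_mul])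
  obtain ⟨h1, h2⟩ := hmain _ _ ((hug.congr hD.measurableSet huv).const_mul s⁻¹)
    (hvm.const_mul _) (hgm.const_smul _) (lintegral_enorm_rpow_le_one (by linarith) hg1)
  have h3 : IntegrableOn u D := by
    refine ((h1.const_mul s).congr (ae_of_all _ fun x => ?_)).congr huv.symm
    exact mul_inv_cancel_left₀ hs.ne' _
  refine ⟨h3, le_trans (le_of_eq ?_) h2⟩
  refine lintegral_congr_ae ?_
  have havg : ⨍ y in D, s⁻¹ * v y = s⁻¹ * ⨍ y in D, u y := by
    rw [average_eq, average_eq, integral_const_mul, integral_congr_ae huv, smul_eq_mul,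
      smul_eq_mul]
    ring
  filter_upwards [huv] with x hx
  rw [havg, hx, ← mul_sub, abs_mul, abs_of_pos (inv_pos.2 hs)]
  congr 2
  field_simp

end Scaling

end FiniteDimensional

/-! ### Distributions on a John domain -/

section Distributions

variable {n : ℕ}

theorem HasUnitSpeedOn.dist_le {γ : ℝ → EuclideanSpace ℝ (Fin n)} {S : Set ℝ}
    (h : HasUnitSpeedOn γ S) {s t : ℝ} (hs : s ∈ S) (ht : t ∈ S) :
    dist (γ s) (γ t) ≤ |s - t| := by
  wlog hst : s ≤ t generalizing s t
  · rw [dist_comm, abs_sub_comm]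
    exact this ht hs (le_of_not_ge hst)
  have h1 := eVariationOn.edist_le γ (s := S ∩ Icc s t) ⟨hs, le_rfl, hst⟩ ⟨ht, hst, le_rfl⟩
  rw [h hs ht, edist_dist, NNReal.coe_one, one_mul,
    ENNReal.ofReal_le_ofReal_iff (sub_nonneg.2 hst)] at h1
  rwa [abs_sub_comm, abs_of_nonneg (sub_nonneg.2 hst)]

/-- A nearest point of the complement lies on the boundary, so the distance to the boundary is at
most the distance to the complement. The latter suits the chain radii, and only the Lipschitz bound
of the unit speed curve is kept. -/
theorem IsJohnDomain.exists_isJohnWith (hn : 0 < n) {φ : ℝ → ℝ}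
    {D : Set (EuclideanSpace ℝ (Fin n))} (hD : IsJohnDomain φ D) :
    ∃ c : ℝ, 0 < c ∧ ∃ x₀, IsJohnWith φ D c x₀ := by
  obtain ⟨-, -, hDb, c, hc, x₀, hx₀, h⟩ := hD
  have : Nontrivial (EuclideanSpace ℝ (Fin n)) :=
    Module.nontrivial_of_finrank_pos (R := ℝ) (by simpa using hn)
  have hDu : D ≠ univ := by
    rintro rfl
    exact NormedSpace.unbounded_univ ℝ _ hDb
  refine ⟨c, hc, x₀, hx₀, fun x hx => ?_⟩
  obtain ⟨l, γ, hl, -, hγ, h0, h1, hγD, hφ⟩ := h x hx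
  refine ⟨l, γ, hl, fun s hs t ht => hγ.dist_le hs ht, h0, h1, hγD, fun t ht => ?_⟩
  obtain ⟨y, hy, hyd⟩ := exists_mem_frontier_infDist_compl_eq_dist (hγD t ht) hDu
  refine (hφ t ht).trans ?_
  rw [hyd]
  gcongr
  exact infDist_le_dist_of_mem hy

variable {D : TopologicalSpace.Opens (EuclideanSpace ℝ (Fin n))}

/-- A smooth function with compact support in `D`, as an element of the space of test functions. -/
def IsTest.toTestFunction {ψ : EuclideanSpace ℝ (Fin n) → ℝ}
    (h : IsTest (D : Set (EuclideanSpace ℝ (Fin n))) ψ) : 𝓓(D, ℝ) :=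
  ⟨ψ, h.contDiff, h.hasCompactSupport, h.tsupport_subset⟩

theorem TestFunction.isTest (ψ : 𝓓(D, ℝ)) : IsTest (D : Set (EuclideanSpace ℝ (Fin n))) ψ :=
  ⟨ψ.contDiff, ψ.hasCompactSupport, ψ.tsupport_subset⟩

theorem lineDerivOp_toTestFunction {ψ : EuclideanSpace ℝ (Fin n) → ℝ}
    (h : IsTest (D : Set (EuclideanSpace ℝ (Fin n))) ψ) (v : EuclideanSpace ℝ (Fin n)) :
    ∂_{v} h.toTestFunction = (h.fderiv_apply v).toTestFunction := by
  ext x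
  rw [TestFunction.lineDerivOp_eq_lineDerivCLM ℝ,
    TestFunction.lineDerivCLM_apply_of_le (by simp)]
  exact (h.contDiff.differentiable (by simp)).differentiableAt.lineDeriv_eq_fderiv

theorem IsTest.setIntegral_mul {ψ : EuclideanSpace ℝ (Fin n) → ℝ}
    (h : IsTest (D : Set (EuclideanSpace ℝ (Fin n))) ψ) (f : EuclideanSpace ℝ (Fin n) → ℝ) :
    ∫ x in (D : Set (EuclideanSpace ℝ (Fin n))), f x * ψ x = ∫ x, f x * ψ x :=
  setIntegral_eq_integral_of_forall_compl_eq_zero fun x hx => by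
    rw [image_eq_zero_of_notMem_tsupport fun hxt => hx (h.tsupport_subset hxt), mul_zero]

open Classical in
/-- A distribution, as a functional on all functions, with value `0` off the test functions. -/
noncomputable def Distribution.toFunctional (T : 𝓓'(D, ℝ)) (ψ : EuclideanSpace ℝ (Fin n) → ℝ) :
    ℝ :=
  if h : IsTest (D : Set (EuclideanSpace ℝ (Fin n))) ψ then T h.toTestFunction else 0

theorem Distribution.toFunctional_apply (T : 𝓓'(D, ℝ)) {ψ : EuclideanSpace ℝ (Fin n) → ℝ}
    (h : IsTest (D : Set (EuclideanSpace ℝ (Fin n))) ψ) :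
    T.toFunctional ψ = T h.toTestFunction :=
  dif_pos h

theorem HasLpGradient.apply_lineDeriv {p : ℝ} {T : 𝓓'(D, ℝ)}
    {g : EuclideanSpace ℝ (Fin n) → EuclideanSpace ℝ (Fin n)} (hT : HasLpGradient p T g)
    {ψ : EuclideanSpace ℝ (Fin n) → ℝ} (h : IsTest (D : Set (EuclideanSpace ℝ (Fin n))) ψ)
    (v : EuclideanSpace ℝ (Fin n)) :
    T (h.fderiv_apply v).toTestFunction = -∫ x, inner ℝ (g x) v * ψ x := by
  have h1 := hT.2 v h.toTestFunction
  rw [Distribution.lineDerivOp_apply_apply, map_neg, lineDerivOp_toTestFunction h v] at h1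
  rw [← h.setIntegral_mul, ← neg_eq_iff_eq_neg]
  exact h1

theorem HasLpGradient.isGradFunctional {p : ℝ} {T : 𝓓'(D, ℝ)}
    {g : EuclideanSpace ℝ (Fin n) → EuclideanSpace ℝ (Fin n)} (hT : HasLpGradient p T g) :
    IsGradFunctional (D : Set (EuclideanSpace ℝ (Fin n))) T.toFunctional g where
  map_add ψ χ hψ hχ := by
    rw [T.toFunctional_apply hψ, T.toFunctional_apply hχ, T.toFunctional_apply (hψ.add hχ),
      ← map_add]
    rfl
  map_smul c ψ hψ := by
    rw [T.toFunctional_apply hψ, T.toFunctional_apply (hψ.const_mul c), ← smul_eq_mul, ← map_smul]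
    rfl
  map_fderiv v ψ hψ := by
    rw [T.toFunctional_apply (hψ.fderiv_apply v), hT.apply_lineDeriv hψ]

theorem HasLpGradient.locallyIntegrableOn {p : ℝ} (hp : 1 ≤ p) {T : 𝓓'(D, ℝ)}
    {g : EuclideanSpace ℝ (Fin n) → EuclideanSpace ℝ (Fin n)} (hT : HasLpGradient p T g)
    (hD : Bornology.IsBounded (D : Set (EuclideanSpace ℝ (Fin n)))) :
    LocallyIntegrableOn g (D : Set (EuclideanSpace ℝ (Fin n))) := by
  have : IsFiniteMeasure (volume.restrict (D : Set (EuclideanSpace ℝ (Fin n)))) := ⟨by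
    rw [Measure.restrict_apply_univ]
    exact hD.measure_lt_top⟩
  exact IntegrableOn.locallyIntegrableOn (hT.1.integrable (by simpa using hp))

theorem HasLpGradient.exists_isRepresentedBy {p : ℝ} (hn : 0 < n) (hp : 1 ≤ p) {T : 𝓓'(D, ℝ)}
    {g : EuclideanSpace ℝ (Fin n) → EuclideanSpace ℝ (Fin n)} (hT : HasLpGradient p T g)
    (hD : Bornology.IsBounded (D : Set (EuclideanSpace ℝ (Fin n)))) :
    ∃ u, IsRepresentedBy T u := by
  obtain ⟨u, hu, hTu⟩ := hT.isGradFunctional.exists_locallyIntegrableOn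
    (hT.locallyIntegrableOn hp hD) (by simpa using hn) D.isOpen
  refine ⟨u, hu, fun ψ => ?_⟩
  rw [ψ.isTest.setIntegral_mul]
  refine Eq.trans ?_ (hTu ψ ψ.isTest)
  rw [T.toFunctional_apply ψ.isTest]
  rfl

/-- This covers an arbitrary representative of the distribution, not only the one constructed above.
-/
theorem HasLpGradient.isWeakGradient {p : ℝ} (hp : 1 ≤ p) {T : 𝓓'(D, ℝ)}
    {g : EuclideanSpace ℝ (Fin n) → EuclideanSpace ℝ (Fin n)} (hT : HasLpGradient p T g)
    (hD : Bornology.IsBounded (D : Set (EuclideanSpace ℝ (Fin n))))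
    {u : EuclideanSpace ℝ (Fin n) → ℝ} (hu : IsRepresentedBy T u) :
    IsWeakGradient (D : Set (EuclideanSpace ℝ (Fin n))) u g where
  locallyIntegrableOn := hu.1
  locallyIntegrableOn_gradient := hT.locallyIntegrableOn hp hD
  integral_fderiv v ψ hψ := by
    rw [← hT.apply_lineDeriv hψ v, hu.2, ← (hψ.fderiv_apply v).setIntegral_mul]
    rfl

end Distributions

/-! ### The inequality for distributions -/

theorem corollary5p3 (n : ℕ) (hn : 2 ≤ n) (p : ℝ) (hp : 1 ≤ p) (hpn : p < n)
    (φ h H : ℝ → ℝ)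
    (hφ : IsStrictGauge φ) (hφ2 : IsDeltaTwo φ) (hφq : HasAlmostIncreasingQuotient φ)
    (hh : DominatesDyadicSum n φ h)
    (hH : IsNFunction H) (hH2 : IsDeltaTwo H)
    (hgrowth : SatisfiesGrowthCondition n p φ h H)
    (hsum : p = 1 → Summable fun j : ℕ => H ((1 / 2) ^ (j + 1)))
    (D : TopologicalSpace.Opens (EuclideanSpace ℝ (Fin n)))
    (hD : IsJohnDomain φ (D : Set (EuclideanSpace ℝ (Fin n)))) :
    ∃ C : ℝ, 0 ≤ C ∧
      ∀ (T : 𝓓'(D, ℝ)) (g : EuclideanSpace ℝ (Fin n) → EuclideanSpace ℝ (Fin n)),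
        HasLpGradient p T g →
          (∃ u : EuclideanSpace ℝ (Fin n) → ℝ, IsRepresentedBy T u) ∧
          ∀ u : EuclideanSpace ℝ (Fin n) → ℝ, IsRepresentedBy T u →
            IntegrableOn u (D : Set (EuclideanSpace ℝ (Fin n))) ∧
            luxemburgNorm H (D : Set (EuclideanSpace ℝ (Fin n)))
                (fun x => u x - ⨍ y in (D : Set (EuclideanSpace ℝ (Fin n))), u y)
              ≤ ENNReal.ofReal C * eLpNorm g (ENNReal.ofReal p)
                  (volume.restrict (D : Set (EuclideanSpace ℝ (Fin n)))) := by
  obtain ⟨c, hc, x₀, hJ⟩ := hD.exists_isJohnWith (by omega)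
  have hDb := hD.2.2.1
  have hfin : finrank ℝ (EuclideanSpace ℝ (Fin n)) = n := finrank_euclideanSpace_fin
  obtain ⟨C, hC, hmain⟩ := exists_lintegral_sub_average_div_le_one D.isOpen hDb (by rwa [hfin]) hp
    (by rwa [hfin]) hφ hφ2 hφq (by rwa [hfin]) hH (by rwa [hfin]) hc hJ
  refine ⟨C, hC.le, fun T g hT => ⟨hT.exists_isRepresentedBy (by omega) hp hDb, fun u hu => ?_⟩⟩
  have hest := hmain u g (hT.isWeakGradient hp hDb hu) hT.1.1
  set N := eLpNorm g (ENNReal.ofReal p)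
    (volume.restrict (D : Set (EuclideanSpace ℝ (Fin n)))) with hN
  have hNtop : N ≠ ⊤ := hT.1.2.ne
  -- The scaled estimate needs a positive bound for the norm of `g`. Using `N + ε` and letting `ε →
  -- 0` also covers a vanishing gradient.
  have hNε (ε : ℝ) (hε : 0 < ε) : N ≤ ENNReal.ofReal (N.toReal + ε) := by
    rw [ENNReal.le_ofReal_iff_toReal_le hNtop (by positivity)]
    linarith
  refine ⟨(hest (N.toReal + 1) (by positivity) (hNε 1 one_pos)).1, ?_⟩
  have hlim : Tendsto (fun ε : ℝ => ENNReal.ofReal (C * (N.toReal + ε))) (𝓝[>] 0)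
      (𝓝 (ENNReal.ofReal (C * (N.toReal + 0)))) :=
    ((ENNReal.continuous_ofReal.comp (by fun_prop : Continuous fun ε : ℝ =>
      C * (N.toReal + ε))).tendsto 0).mono_left nhdsWithin_le_nhds
  rw [add_zero, ENNReal.ofReal_mul hC.le, ENNReal.ofReal_toReal hNtop] at hlim
  refine ge_of_tendsto hlim ?_
  filter_upwards [self_mem_nhdsWithin] with ε hε
  have hε0 : 0 < ε := hε
  exact iInf₂_le_of_le (C * (N.toReal + ε)) (by positivity)
    (iInf_le_of_le (hest _ (by positivity) (hNε ε hε0)).2 le_rfl)
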